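/- Theorem 1.3. For integers $l\ge 0$, $r_1,\dots,r_l\ge 0$ and $n\ge 0$ let $$\sigma_{r_1,\dots,r_l}(n)=\sum_{\substack{u_1v_1+\dots+u_lv_l=n\\ u_1>\dots>u_l>0,\ v_1,\dots,v_l>0}} v_1^{r_1}\cdots v_l^{r_l},$$ the sum running over integers. For integers $l\ge 1$ and $s_1,\dots,s_l\ge 1$ define the bracket $$[s_1,\dots,s_l]=\frac{1}{(s_1-1)!\cdots(s_l-1)!}\sum_{n>0}\sigma_{s_1-1,\dots,s_l-1}(n)\,q^n\in\mathbb{Q}[[q]],$$ and let $[\emptyset]=1$ be the empty bracket (of weight $0$ and length $0$). For $k,l\ge 0$ let $\operatorname{Fil}^{W,L}_{k,l}(\mathcal{MD})$ be the $\mathbb{Q}$-vector subspace of $\mathbb{Q}[[q]]$ spanned by all brackets $[s_1,\dots,s_r]$ of weight $s_1+\dots+s_r\le k$ and length $r\le l$ (including $[\emptyset]$). Then the dimensions $\dim_{\mathbb{Q}}\operatorname{Fil}^{W,L}_{k,l}(\mathcal{MD})$ satisfy all the equalities and inequalities in the following table, where an entry $=d$ or $\ge d$ in row $k$ and column $l$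 means $\dim_{\mathbb{Q}}\operatorname{Fil}^{W,L}_{k,l}(\mathcal{MD})=d$ or $\dim_{\mathbb{Q}}\operatorname{Fil}^{W,L}_{k,l}(\mathcal{MD})\ge d$ respectively, and an empty entry asserts nothing: $$\begin{array}{c|cccccccccccc} k\backslash l & 0 & 1 & 2 & 3 & 4 & 5 & 6 & 7 & 8 & 9 & 10 & 11 \\ \hline 0 & =1 & & & & & & & & & & & \\ 1 & =1 & =2 & & & & & & & & & & \\ 2 & =1 & =3 & =4 & & & & & & & & & \\ 3 & =1 & =4 & =7 & =8 & & & & & & & & \\ 4 & =1 & =5 & =10 & =14 & =15 & & & & & & & \\ 5 & =1 & =6 & =14 & =22 & =27 & =28 & & & & & & \\ 6 & =1 & =7 & =18 & =32 & \ge 44 & \ge 50 & \ge 51 & & & & & \\ 7 & =1 & =8 & =23 & \ge 44 & \ge 67 & \ge 84 & \ge 91 & \ge 92 & & & & \\ 8 & =1 & =9 & =28 & \ge 59 & \ge 97 & \ge 133 & \ge 156 & \ge 164 & \ge 165 & & & \\ 9 & =1 & =10 & =34 & \ge 76 & \ge 135 & \ge 200 & \ge 254 & \ge 284 & \ge 293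 & \ge 294 & & \\ 10 & =1 & =11 & =40 & \ge 97 & \ge 183 & \ge 290 & \ge 396 & \ge 474 & \ge 512 & \ge 522 & \ge 523 & \\ 11 & =1 & =12 & =47 & \ge 120 & \ge 242 & \ge 408 & \ge 594 & \ge 760 & \ge 869 & \ge 916 & \ge 927 & \ge 928 \\ 12 & =1 & =13 & =54 & \ge 147 & \ge 313 & \ge 559 & & & & & & \\ 13 & =1 & =14 & =62 & \ge 177 & \ge 398 & & & & & & & \\ 14 & =1 & =15 & =70 & \ge 212 & \ge 498 & & & & & & & \\ 15 & =1 & =16 & =79 & \ge 249 & & & & & & & & \end{array}$$ -/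

import Mathlib

open scoped PowerSeries

/-- The multiple divisor sum
`σ_{r₁,…,r_l}(n) = ∑ v₁ ^ r₁ ⋯ v_l ^ r_l`, the sum over all positive integers
`u₁ > ⋯ > u_l` and `v₁, …, v_l` with `u₁ v₁ + ⋯ + u_l v_l = n`.
These equations force `u i ≤ n` and `v i ≤ n`, so that the range of summation is finite. -/
def multipleDivisorSum {l : ℕ} (r : Fin l → ℕ) (n : ℕ) : ℕ :=
  ∑ p ∈ ((Fintype.piFinset fun _ : Fin l => Finset.Icc 1 n) ×ˢ
      (Fintype.piFinset fun _ : Fin l => Finset.Icc 1 n)).filter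
      (fun p => (∀ i j : Fin l, i < j → p.1 j < p.1 i) ∧ ∑ i, p.1 i * p.2 i = n),
    ∏ i, p.2 i ^ r i

/-- The summation condition without the bounds on `u` and `v`. -/
theorem mem_multipleDivisorSum_index {l : ℕ} (n : ℕ) (p : (Fin l → ℕ) × (Fin l → ℕ)) :
    p ∈ ((Fintype.piFinset fun _ : Fin l => Finset.Icc 1 n) ×ˢ
      (Fintype.piFinset fun _ : Fin l => Finset.Icc 1 n)).filter
      (fun p => (∀ i j : Fin l, i < j → p.1 j < p.1 i) ∧ ∑ i, p.1 i * p.2 i = n) ↔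
    (∀ i, 0 < p.1 i) ∧ (∀ i, 0 < p.2 i) ∧ StrictAnti p.1 ∧ ∑ i, p.1 i * p.2 i = n := by
  simp only [Finset.mem_filter, Finset.mem_product, Fintype.mem_piFinset, Finset.mem_Icc]
  constructor
  · rintro ⟨⟨hu, hv⟩, ha, hs⟩
    exact ⟨fun i => (hu i).1, fun i => (hv i).1, fun i j h => ha i j h, hs⟩
  · rintro ⟨hu, hv, ha, hs⟩
    have key : ∀ i, p.1 i * p.2 i ≤ n := fun i => hs ▸
      Finset.single_le_sum (f := fun i => p.1 i * p.2 i) (fun _ _ => Nat.zero_le _)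
        (Finset.mem_univ i)
    exact ⟨⟨fun i => ⟨hu i, (Nat.le_mul_of_pos_right _ (hv i)).trans (key i)⟩,
      fun i => ⟨hv i, (Nat.le_mul_of_pos_left _ (hu i)).trans (key i)⟩⟩,
      fun i j h => ha h, hs⟩

/-- The bracket `[s₁,…,s_l]`, for positive integers `s₁, …, s_l`: the formal power series
`1 / ((s₁-1)! ⋯ (s_l-1)!) * ∑_{n > 0} σ_{s₁-1,…,s_l-1}(n) q ^ n`.
For `l > 0` the coefficient of `q ^ 0` below is `0`, and for `l = 0` the series below is `1`, the
value of the empty bracket; both are proved next. -/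
noncomputable def bracket {l : ℕ} (s : Fin l → ℕ) : ℚ⟦X⟧ :=
  PowerSeries.mk fun n =>
    (multipleDivisorSum (fun i => s i - 1) n : ℚ) / ((∏ i, (s i - 1).factorial : ℕ) : ℚ)

theorem coeff_zero_bracket {l : ℕ} (hl : 0 < l) (s : Fin l → ℕ) :
    PowerSeries.coeff 0 (bracket s) = 0 := by
  have : NeZero l := ⟨hl.ne'⟩
  have h : multipleDivisorSum (fun i => s i - 1) 0 = 0 := by
    unfold multipleDivisorSum
    refine Finset.sum_eq_zero fun p hp => ?_
    obtain ⟨hu, hv, -, hs⟩ := (mem_multipleDivisorSum_index 0 p).1 hp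
    have h0 := Finset.sum_eq_zero_iff.1 hs 0 (Finset.mem_univ _)
    exact absurd h0 (Nat.mul_pos (hu 0) (hv 0)).ne'
  simp [bracket, h]

theorem bracket_empty (s : Fin 0 → ℕ) : bracket s = 1 := by
  ext n
  rcases Nat.eq_zero_or_pos n with rfl | hn
  · simp [bracket, multipleDivisorSum]
  · simp [bracket, multipleDivisorSum, PowerSeries.coeff_one, hn.ne', hn.ne]

/-- The space `Fil^{W,L}_{k,l}(MD)`: the `ℚ`-span in `ℚ⟦q⟧` of all brackets `[s₁,…,s_r]`
(the empty bracket `1` included) of length `r ≤ l` and weight `s₁ + ⋯ + s_r ≤ k`. -/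
def filWL (k l : ℕ) : Submodule ℚ ℚ⟦X⟧ :=
  Submodule.span ℚ {f | ∃ (r : ℕ) (s : Fin r → ℕ),
    (∀ i, 0 < s i) ∧ ∑ i, s i ≤ k ∧ r ≤ l ∧ f = bracket s}

/-! A bracket is a limit of nested sums in the letters `m ↦ ∑_v v^(s-1) q^(mv)`. For `s ≤ d` these
letters span the same space as the powers `(q^m/(1-q^m))^s`, so both alphabets give the same nested
sums in each weight and length (`nestedSpan_geomSeq`). A product of two such powers is again one,
and the quasi-shuffle formula makes the brackets a bifiltered algebra (`mul_mem_filWL`).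

Upper bounds come from computing a product of brackets in two ways. The quasi-shuffle formula gives
the sum over all interleavings, modulo shorter brackets. Alternatively, the sum over all `u₁v₁ +
u₂v₂ = n`, with no order on the `u`'s, is cut according to the order of the `v`'s, and a linear
substitution turns each region into an ordered sum again. Polynomial weights that vanish on the
walls between regions leave no boundary terms. In length two and weight `d + 2`, symmetric
polynomials give `d / 2` independent relations (`finrank_map_pairSum_le`), which settles the column
`l = 2`. In length three, weight five needs two relations and weight six four; they come from
`tripleSum_relation` and from multiplying a relation of weight four by a bracket. The other exact
entries only need a count of words.

For lower bounds, integral series are independent over `ℚ` once their truncations modulo 31 are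
independent (`linearIndependent_of_zmod`). For each of four ranges of weight and length, `N`
products of nested sums of known weight and length are generated such that the matrix of their first
`N` coefficients is invertible modulo 31. The listed series of weight at most `k` and length at most
`l` then bound the dimension of `filWL k l` from below (`length_filter_le_finrank`). To make this
computable, a truncated series is one natural number with its coefficients as digits in base `2 ^
20`: products and row operations become integer operations, and since `31 = 2 ^ 5 - 1`, all digits
are reduced at once by masks and shifts. Only one direction needs proof: the number of pivots found
never exceeds the rank (`eliminate_le`). -/

/-! ### Nested sums, their limits and the quasi-shuffle product. -/

noncomputable section Foundation

open Finset PowerSeries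

variable {R : Type*} [CommRing R]

/-- The series `∑_{v > 0} f v * q ^ (m v)` for `m > 0`; the value at `m = 0` is `0`. -/
def dilate (f : ℕ → R) (m : ℕ) : R⟦X⟧ :=
  PowerSeries.mk fun n => if m ∣ n ∧ n ≠ 0 then f (n / m) else 0

/-- `∑_{u > m₁ > ⋯ > m_l} a₁(m₁) ⋯ a_l(m_l)`. -/
def nestedSum : List (ℕ → R⟦X⟧) → ℕ → R⟦X⟧
  | [], _ => 1
  | a :: w, u => ∑ m ∈ range u, a m * nestedSum w m

/-- The limit of a sequence of power series whose `n`-th coefficient is constant from index `n + 1`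
on. -/
def diagLimit : (ℕ → R⟦X⟧) →ₗ[R] R⟦X⟧ where
  toFun g := PowerSeries.mk fun n => coeff n (g (n + 1))
  map_add' g h := by ext n; simp
  map_smul' c g := by ext n; simp

theorem coeff_diagLimit (g : ℕ → R⟦X⟧) (n : ℕ) :
    coeff n (diagLimit g) = coeff n (g (n + 1)) := by
  simp [diagLimit]

theorem coeff_dilate (f : ℕ → R) (m n : ℕ) :
    coeff n (dilate f m) = if m ∣ n ∧ n ≠ 0 then f (n / m) else 0 := by
  simp [dilate]

theorem dilate_zero (f : ℕ → R) : dilate f 0 = 0 := by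
  ext n
  rw [coeff_dilate, if_neg (by rintro ⟨h, h'⟩; exact h' (Nat.eq_zero_of_zero_dvd h))]
  simp

theorem X_pow_dvd_dilate (f : ℕ → R) (m : ℕ) : (X : R⟦X⟧) ^ m ∣ dilate f m := by
  rw [X_pow_dvd_iff]
  intro n hn
  rw [coeff_dilate, if_neg]
  rintro ⟨h, h'⟩
  exact absurd (Nat.le_of_dvd (Nat.pos_of_ne_zero h') h) (by omega)

/-- The `n`-th coefficient of `g u` does not depend on `u > n`. -/
def IsStable (g : ℕ → R⟦X⟧) : Prop :=
  ∀ n u, n < u → coeff n (g u) = coeff n (g (n + 1))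

/-- Summands with index `m > n` are divisible by `X ^ m` and do not reach the coefficient of `X ^
n`. -/
theorem IsStable.sum_mul {a : ℕ → R⟦X⟧} (ha : ∀ m, (X : R⟦X⟧) ^ m ∣ a m) (g : ℕ → R⟦X⟧) :
    IsStable fun u => ∑ m ∈ range u, a m * g m := by
  intro n u hu
  obtain ⟨d, rfl⟩ := Nat.exists_eq_add_of_le (Nat.succ_le_of_lt hu)
  simp only [Finset.sum_range_add, Nat.succ_eq_add_one]
  rw [map_add, add_eq_left, map_sum]
  refine Finset.sum_eq_zero fun i _ => ?_
  exact X_pow_dvd_iff.1 ((ha _).mul_right _) n (by omega)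

theorem IsStable.add {g h : ℕ → R⟦X⟧} (hg : IsStable g) (hh : IsStable h) : IsStable (g + h) := by
  intro n u hu
  simp [hg n u hu, hh n u hu]

theorem IsStable.smul {g : ℕ → R⟦X⟧} (c : R) (hg : IsStable g) : IsStable (c • g) := by
  intro n u hu
  simp [hg n u hu]

/-- Coefficient `n` of the product uses the factors at index `n + 1` in coefficients `i ≤ n`;
stability moves these to index `i + 1`, where `diagLimit` reads them. -/
theorem diagLimit_mul {g h : ℕ → R⟦X⟧} (hg : IsStable g) (hh : IsStable h) :
    diagLimit (g * h) = diagLimit g * diagLimit h := by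
  ext n
  rw [coeff_diagLimit, Pi.mul_apply, coeff_mul, coeff_mul]
  refine Finset.sum_congr rfl fun p hp => ?_
  have := HasAntidiagonal.mem_antidiagonal.1 hp
  rw [coeff_diagLimit, coeff_diagLimit, hg p.1 (n + 1) (by omega), hh p.2 (n + 1) (by omega)]

theorem isStable_nestedSum {w : List (ℕ → R⟦X⟧)} (hw : ∀ a ∈ w, ∀ m, (X : R⟦X⟧) ^ m ∣ a m) :
    IsStable (nestedSum w) := by
  cases w with
  | nil => exact fun _ _ _ => rfl
  | cons a w => exact IsStable.sum_mul (hw a (by simp)) _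

theorem sum_range_mul_sum_range (a b : ℕ → R⟦X⟧) (u : ℕ) :
    (∑ m ∈ range u, a m) * ∑ m ∈ range u, b m =
      ∑ m ∈ range u, (a m * ∑ i ∈ range m, b i) + ∑ m ∈ range u, (b m * ∑ i ∈ range m, a i) +
        ∑ m ∈ range u, a m * b m := by
  induction u with
  | zero => simp
  | succ u ih =>
    simp only [Finset.sum_range_succ]
    linear_combination ih

/-- The linear operator `g ↦ (u ↦ ∑_{m < u} a(m) g(m))`. -/
def cumul : (ℕ → R⟦X⟧) →ₗ[R] (ℕ → R⟦X⟧) →ₗ[R] (ℕ → R⟦X⟧) :=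
  LinearMap.mk₂ R (fun a g u => ∑ m ∈ range u, a m * g m)
    (fun a b g => by ext1 u; simp [add_mul, Finset.sum_add_distrib])
    (fun c a g => by ext1 u; simp [Finset.smul_sum])
    (fun a g h => by ext1 u; simp [mul_add, Finset.sum_add_distrib])
    (fun c a g => by ext1 u; simp [Finset.smul_sum])

theorem cumul_apply (a g : ℕ → R⟦X⟧) (u : ℕ) : cumul a g u = ∑ m ∈ range u, a m * g m := rfl

theorem cumul_nestedSum (a : ℕ → R⟦X⟧) (w : List (ℕ → R⟦X⟧)) :
    cumul a (nestedSum w) = nestedSum (a :: w) := rfl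

/-- The quasi-shuffle product formula. -/
theorem nestedSum_cons_mul_cons (a b : ℕ → R⟦X⟧) (v w : List (ℕ → R⟦X⟧)) :
    nestedSum (a :: v) * nestedSum (b :: w) =
      cumul a (nestedSum v * nestedSum (b :: w)) + cumul b (nestedSum (a :: v) * nestedSum w) +
        cumul (a * b) (nestedSum v * nestedSum w) := by
  ext1 u
  simp only [Pi.add_apply, Pi.mul_apply, cumul_apply, nestedSum]
  rw [sum_range_mul_sum_range]
  congr 1
  · congr 1 <;> refine Finset.sum_congr rfl fun m _ => ?_ <;> ring
  · refine Finset.sum_congr rfl fun m _ => ?_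
    ring

/-! ### The coefficients of nested sums -/

/-- The range of summation of `multipleDivisorSum`. -/
def chainIndex (l n : ℕ) : Finset ((Fin l → ℕ) × (Fin l → ℕ)) :=
  ((Fintype.piFinset fun _ : Fin l => Finset.Icc 1 n) ×ˢ
      (Fintype.piFinset fun _ : Fin l => Finset.Icc 1 n)).filter
      (fun p => (∀ i j : Fin l, i < j → p.1 j < p.1 i) ∧ ∑ i, p.1 i * p.2 i = n)

theorem mem_chainIndex {l n : ℕ} {p : (Fin l → ℕ) × (Fin l → ℕ)} :
    p ∈ chainIndex l n ↔
      (∀ i, 0 < p.1 i) ∧ (∀ i, 0 < p.2 i) ∧ StrictAnti p.1 ∧ ∑ i, p.1 i * p.2 i = n :=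
  mem_multipleDivisorSum_index n p

theorem strictAnti_cons_iff {l : ℕ} {a : ℕ} {u : Fin l → ℕ} :
    StrictAnti (Fin.cons a u : Fin (l + 1) → ℕ) ↔ (∀ i, u i < a) ∧ StrictAnti u := by
  constructor
  · intro h
    refine ⟨fun i => by simpa using h (Fin.succ_pos i), fun i j hij => ?_⟩
    simpa using h (Fin.succ_lt_succ_iff.2 hij)
  · rintro ⟨h, hu⟩ i j hij
    induction i using Fin.cases with
    | zero =>
      induction j using Fin.cases with
      | zero => exact absurd hij (lt_irrefl _)
      | succ j => simpa using h j
    | succ i =>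
      induction j using Fin.cases with
      | zero => exact absurd hij (by simp)
      | succ j => simpa using hu (Fin.succ_lt_succ_iff.1 hij)

/-- The outermost summation index is the largest part `u₁ < U`, and it becomes the bound `U` for the
inner chain. -/
theorem coeff_nestedSum_ofFn {l : ℕ} (f : Fin l → ℕ → R) (U n : ℕ) :
    coeff n (nestedSum (List.ofFn fun i => dilate (f i)) U) =
      ∑ p ∈ (chainIndex l n).filter (fun p => ∀ i, p.1 i < U), ∏ i, f i (p.2 i) := by
  induction l generalizing U n with
  | zero =>
    rcases Nat.eq_zero_or_pos n with rfl | hn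
    · simp [nestedSum, chainIndex]
    · simp [nestedSum, chainIndex, coeff_one, hn.ne', hn.ne]
  | succ l ih =>
    rw [List.ofFn_succ]
    simp only [nestedSum, map_sum, coeff_mul, coeff_dilate, ih (fun i => f i.succ)]
    simp only [ite_mul, zero_mul, Finset.mul_sum, ← Finset.sum_filter]
    rw [Finset.sum_sigma', Finset.sum_sigma']
    -- The first factor contributes the exponent `a = u₁ v₁` with `u₁ = m`, so `v₁` is recovered as
    -- `a / m`.
    refine Finset.sum_bij'
      (fun q _ => (Fin.cons q.1.1 q.2.1, Fin.cons (q.1.2.1 / q.1.1) q.2.2))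
      (fun p _ => ⟨⟨p.1 0, (p.1 0 * p.2 0, ∑ i : Fin l, p.1 i.succ * p.2 i.succ)⟩,
        (Fin.tail p.1, Fin.tail p.2)⟩) ?_ ?_ ?_ ?_ ?_
    · rintro ⟨⟨m, a, b⟩, u, v⟩ h
      simp only [mem_sigma, mem_range, mem_filter, HasAntidiagonal.mem_antidiagonal,
        mem_chainIndex] at h
      obtain ⟨⟨hm, hab⟩, ⟨⟨hu, hv, hanti, hs⟩, hlt⟩, hma, ha⟩ := h
      have hm0 : 0 < m := Nat.pos_of_dvd_of_pos hma (Nat.pos_of_ne_zero ha)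
      simp only [mem_filter, mem_chainIndex]
      refine ⟨⟨?_, ?_, strictAnti_cons_iff.2 ⟨hlt, hanti⟩, ?_⟩, ?_⟩
      · exact Fin.cases (by simpa using hm0) (fun i => by simpa using hu i)
      · refine Fin.cases ?_ (fun i => by simpa using hv i)
        simpa using ⟨Nat.pos_of_ne_zero (by rintro rfl; omega),
          Nat.le_of_dvd (Nat.pos_of_ne_zero ha) hma⟩
      · rw [Fin.sum_univ_succ]
        simp only [Fin.cons_zero, Fin.cons_succ]
        rw [Nat.mul_div_cancel' hma, hs, hab]
      · exact Fin.cases (by simpa using hm) (fun i => by simpa using (hlt i).trans hm)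
    · rintro ⟨u, v⟩ h
      simp only [mem_filter, mem_chainIndex] at h
      obtain ⟨⟨hu, hv, hanti, hs⟩, hlt⟩ := h
      rw [Fin.sum_univ_succ] at hs
      have hanti' := hanti
      rw [← Fin.cons_self_tail u, strictAnti_cons_iff] at hanti'
      simp only [mem_sigma, mem_range, mem_filter, HasAntidiagonal.mem_antidiagonal, mem_chainIndex]
      exact ⟨⟨hlt 0, hs⟩, ⟨⟨fun i => hu i.succ, fun i => hv i.succ, hanti'.2, rfl⟩, hanti'.1⟩,
        dvd_mul_right _ _, (Nat.mul_pos (hu 0) (hv 0)).ne'⟩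
    · rintro ⟨⟨m, a, b⟩, u, v⟩ h
      simp only [mem_sigma, mem_range, mem_filter, HasAntidiagonal.mem_antidiagonal,
        mem_chainIndex] at h
      obtain ⟨⟨hm, hab⟩, ⟨⟨hu, hv, hanti, hs⟩, hlt⟩, hma, ha⟩ := h
      simp [Nat.mul_div_cancel' hma, hs]
    · rintro ⟨u, v⟩ h
      simp only [mem_filter, mem_chainIndex] at h
      simp [Nat.mul_div_cancel_left _ (h.1.1 0)]
    · rintro ⟨⟨m, a, b⟩, u, v⟩ h
      simp [Fin.prod_univ_succ]

theorem coeff_diagLimit_nestedSum_ofFn {l : ℕ} (f : Fin l → ℕ → R) (n : ℕ) :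
    coeff n (diagLimit (nestedSum (List.ofFn fun i => dilate (f i)))) =
      ∑ p ∈ chainIndex l n, ∏ i, f i (p.2 i) := by
  rw [coeff_diagLimit, coeff_nestedSum_ofFn, Finset.filter_true_of_mem]
  intro p hp i
  obtain ⟨hu, hv, -, hs⟩ := mem_chainIndex.1 hp
  have h1 : p.1 i * p.2 i ≤ n := hs ▸ Finset.single_le_sum (f := fun i => p.1 i * p.2 i)
    (fun _ _ => Nat.zero_le _) (Finset.mem_univ i)
  exact Nat.lt_succ_of_le ((Nat.le_mul_of_pos_right _ (hv i)).trans h1)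

end Foundation

/-! ### Change of letters, and the bifiltered algebra of brackets. -/

noncomputable section Filtration

open Finset PowerSeries

variable {R : Type*} [CommRing R]

/-- The sequence `m ↦ q ^ m / (1 - q ^ m)`, with value `0` at `m = 0`. -/
def geomSeq (R : Type*) [CommRing R] : ℕ → R⟦X⟧ := dilate fun _ => 1

/-- The sequence `m ↦ ∑_{v > 0} v ^ (s - 1) q ^ (m v)`. -/
def powSeq (R : Type*) [CommRing R] (s : ℕ) : ℕ → R⟦X⟧ := dilate fun v => (v : R) ^ (s - 1)

theorem dilate_congr {f g : ℕ → R} (h : ∀ v, 0 < v → f v = g v) : dilate f = dilate g := by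
  ext m n
  rw [coeff_dilate, coeff_dilate]
  split_ifs with hn
  · exact h _ (Nat.div_pos (Nat.le_of_dvd (Nat.pos_of_ne_zero hn.2) hn.1)
      (Nat.pos_of_dvd_of_pos hn.1 (Nat.pos_of_ne_zero hn.2)))
  · rfl

theorem dilate_add (f g : ℕ → R) : dilate (f + g) = dilate f + dilate g := by
  ext m n
  simp only [Pi.add_apply, map_add, coeff_dilate]
  split_ifs <;> simp

theorem dilate_smul (c : R) (f : ℕ → R) : dilate (c • f) = c • dilate f := by
  ext m n
  simp only [Pi.smul_apply, map_smul, coeff_dilate]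
  split_ifs <;> simp

/-- Multiplication by `1 - X ^ m` takes differences of `f` along the multiples of `m`. As `dilate g`
ignores `g 0`, the constant `C (g 0)` supplies the coefficient of `X ^ m`. -/
theorem dilate_mul_one_sub (f g : ℕ → R) (h1 : f 1 = g 0)
    (h : ∀ v, 0 < v → f (v + 1) - f v = g v) {m : ℕ} (hm : 0 < m) :
    dilate f m * (1 - X ^ m) = X ^ m * (dilate g m + C (g 0)) := by
  ext n
  rw [mul_sub, mul_one, map_sub, coeff_mul_X_pow', coeff_X_pow_mul', map_add, coeff_dilate]
  by_cases hmn : m ∣ n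
  · obtain ⟨v, rfl⟩ := hmn
    rcases v with _ | _ | v
    · simp [hm.ne']
    · simp [hm.ne', h1, coeff_dilate, Nat.div_self hm]
    · have e : m * (v + 1 + 1) - m = m * (v + 1) := by rw [mul_add m (v + 1) 1]; omega
      have hle : m ≤ m * (v + 1 + 1) := Nat.le_mul_of_pos_right _ (by omega)
      simp only [if_pos hle, e, coeff_dilate, coeff_C]
      rw [if_pos ⟨dvd_mul_right _ _, by positivity⟩, if_pos ⟨dvd_mul_right _ _, by positivity⟩,
        if_pos ⟨dvd_mul_right _ _, by positivity⟩, if_neg (by positivity),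
        Nat.mul_div_cancel_left _ hm, Nat.mul_div_cancel_left _ hm, add_zero]
      exact h (v + 1) (by omega)
  · rw [if_neg (fun h => hmn h.1), zero_sub]
    split_ifs with hle
    · have h2 : ¬ m ∣ n - m := fun h => hmn ((Nat.dvd_sub_iff_left hle dvd_rfl).1 h)
      have h3 : n - m ≠ 0 := fun h => h2 (h ▸ dvd_zero _)
      simp [coeff_dilate, h2, coeff_C, h3]
    · simp

theorem isUnit_one_sub_X_pow {m : ℕ} (hm : 0 < m) : IsUnit (1 - X ^ m : R⟦X⟧) := by
  rw [isUnit_iff_constantCoeff]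
  simp [hm.ne']

/-- After multiplication by the unit `1 - X ^ m`, the induction step is Pascal's rule. -/
theorem geomSeq_pow_succ (s : ℕ) :
    geomSeq R ^ (s + 1) = dilate fun v => ((v - 1).choose s : R) := by
  induction s with
  | zero => simp [geomSeq]
  | succ s ih =>
    ext1 m
    rw [pow_succ, ih]
    rcases Nat.eq_zero_or_pos m with rfl | hm
    · simp [dilate_zero, geomSeq]
    · refine (isUnit_one_sub_X_pow (R := R) hm).mul_right_cancel ?_
      have h1 := dilate_mul_one_sub (R := R) (fun _ => 1) (fun v => if v = 0 then 1 else 0)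
        (by simp) (by intro v hv; simp [hv.ne']) hm
      -- Here `g 0` has to equal `f 1 = 0`, whereas truncated subtraction would give `(0 - 1).choose
      -- 0 = 1`; hence the case distinction.
      have h2 := dilate_mul_one_sub (R := R) (fun v => ((v - 1).choose (s + 1) : R))
        (fun v => if v = 0 then 0 else ((v - 1).choose s : R)) (by simp)
        (by
          intro v hv
          obtain ⟨v, rfl⟩ := Nat.exists_eq_add_of_le' hv
          simp [Nat.choose_succ_succ]) hm
      rw [h2]
      have e1 : dilate (fun v => if v = 0 then (1 : R) else 0) = 0 := by
        rw [dilate_congr (g := 0) (by intro v hv; simp [hv.ne'])]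
        simpa using dilate_smul (0 : R) (0 : ℕ → R)
      have e2 : dilate (fun v => if v = 0 then (0 : R) else ((v - 1).choose s : R)) =
          dilate fun v => ((v - 1).choose s : R) :=
        dilate_congr (by intro v hv; simp [hv.ne'])
      rw [e1] at h1
      rw [e2, Pi.mul_apply, mul_assoc, geomSeq, h1]
      simp
      ring

/-- The span of the sequences `b 1, …, b d`. -/
def letterSpan (b : ℕ → ℕ → ℚ⟦X⟧) (d : ℕ) : Submodule ℚ (ℕ → ℚ⟦X⟧) :=
  Submodule.span ℚ {a | ∃ s, 0 < s ∧ s ≤ d ∧ a = b s}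

/-- The span of the nested sums of weight at most `k` and length at most `l` in the sequences
`b s`. -/
def nestedSpan (b : ℕ → ℕ → ℚ⟦X⟧) (k l : ℕ) : Submodule ℚ (ℕ → ℚ⟦X⟧) :=
  Submodule.span ℚ {g | ∃ s : List ℕ, (∀ x ∈ s, 0 < x) ∧ s.sum ≤ k ∧ s.length ≤ l ∧
    g = nestedSum (s.map b)}

theorem letterSpan_mono (b : ℕ → ℕ → ℚ⟦X⟧) {d e : ℕ} (h : d ≤ e) :
    letterSpan b d ≤ letterSpan b e :=
  Submodule.span_mono fun _ ⟨s, h1, h2, h3⟩ => ⟨s, h1, h2.trans h, h3⟩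

theorem nestedSpan_mono (b : ℕ → ℕ → ℚ⟦X⟧) {k l k' l' : ℕ} (hk : k ≤ k') (hl : l ≤ l') :
    nestedSpan b k l ≤ nestedSpan b k' l' :=
  Submodule.span_mono fun _ ⟨s, h1, h2, h3, h4⟩ => ⟨s, h1, h2.trans hk, h3.trans hl, h4⟩

theorem cumul_mem_nestedSpan {b : ℕ → ℕ → ℚ⟦X⟧} {d k l : ℕ} {a g : ℕ → ℚ⟦X⟧}
    (ha : a ∈ letterSpan b d) (hg : g ∈ nestedSpan b k l) :
    cumul a g ∈ nestedSpan b (d + k) (l + 1) := by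
  have h := Submodule.apply_mem_map₂ cumul ha hg
  rw [letterSpan, nestedSpan, Submodule.map₂_span_span] at h
  refine Submodule.span_le.2 ?_ h
  rintro _ ⟨_, ⟨t, ht, htd, rfl⟩, _, ⟨s, h1, h2, h3, rfl⟩, rfl⟩
  refine Submodule.subset_span ⟨t :: s, ?_, ?_, ?_, rfl⟩
  · simpa using ⟨ht, h1⟩
  · simp only [List.sum_cons]; omega
  · simpa using h3

theorem one_mem_nestedSpan (b : ℕ → ℕ → ℚ⟦X⟧) (k l : ℕ) : 1 ∈ nestedSpan b k l :=
  Submodule.subset_span ⟨[], by simp, by simp, by simp, rfl⟩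

theorem nestedSum_mem_nestedSpan {b b' : ℕ → ℕ → ℚ⟦X⟧}
    (h : ∀ s, 0 < s → b s ∈ letterSpan b' s) (s : List ℕ) (hs : ∀ x ∈ s, 0 < x) :
    nestedSum (s.map b) ∈ nestedSpan b' s.sum s.length := by
  induction s with
  | nil => exact one_mem_nestedSpan _ _ _
  | cons t s ih =>
    exact cumul_mem_nestedSpan (h t (hs t (by simp))) (ih fun x hx => hs x (by simp [hx]))

theorem nestedSpan_le {b b' : ℕ → ℕ → ℚ⟦X⟧} (h : ∀ s, 0 < s → b s ∈ letterSpan b' s) (k l : ℕ) :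
    nestedSpan b k l ≤ nestedSpan b' k l := by
  refine Submodule.span_le.2 ?_
  rintro _ ⟨s, h1, h2, h3, rfl⟩
  exact nestedSpan_mono b' h2 h3 (nestedSum_mem_nestedSpan h s h1)

/-- Both sides are `(s + 1) * C(v, s + 1)`. The identity trades one factor `v` for one step in the
lower index, and drives the passage between powers and binomials in both directions. -/
theorem mul_choose_pred (v s : ℕ) (hv : 0 < v) :
    (v : ℚ) * ((v - 1).choose s : ℚ) =
      (s + 1) * ((v - 1).choose (s + 1) : ℚ) + (s + 1) * ((v - 1).choose s : ℚ) := by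
  obtain ⟨v, rfl⟩ := Nat.exists_eq_add_of_le' hv
  have h := Nat.add_one_mul_choose_eq v s
  have h' := Nat.choose_succ_succ v s
  rw [h'] at h
  simp only [Nat.add_sub_cancel]
  have h2 : ((v + 1 : ℕ) : ℚ) * (v.choose s : ℚ) =
      ((v.choose s : ℚ) + (v.choose (s + 1) : ℚ)) * ((s + 1 : ℕ) : ℚ) := by exact_mod_cast h
  rw [h2]
  push_cast
  ring

theorem dilate_pow_mul_choose (j s : ℕ) :
    dilate (fun v => (v : ℚ) ^ (j + 1) * ((v - 1).choose s : ℚ)) =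
      ((s : ℚ) + 1) • dilate (fun v => (v : ℚ) ^ j * ((v - 1).choose (s + 1) : ℚ)) +
        ((s : ℚ) + 1) • dilate (fun v => (v : ℚ) ^ j * ((v - 1).choose s : ℚ)) := by
  rw [← dilate_smul, ← dilate_smul, ← dilate_add]
  refine dilate_congr fun v hv => ?_
  simp only [Pi.add_apply, Pi.smul_apply, smul_eq_mul]
  rw [pow_succ, mul_assoc, mul_choose_pred v s hv]
  ring

theorem dilate_pow_mul_choose_mem_geom (j s : ℕ) :
    dilate (fun v => (v : ℚ) ^ j * ((v - 1).choose s : ℚ)) ∈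
      letterSpan (fun s => geomSeq ℚ ^ s) (s + j + 1) := by
  induction j generalizing s with
  | zero =>
    refine Submodule.subset_span ⟨s + 1, by omega, by omega, ?_⟩
    simp [geomSeq_pow_succ]
  | succ j ih =>
    rw [dilate_pow_mul_choose]
    exact add_mem (Submodule.smul_mem _ _ (letterSpan_mono _ (by omega) (ih (s + 1))))
      (Submodule.smul_mem _ _ (letterSpan_mono _ (by omega) (ih s)))

/-- The recursion `dilate_pow_mul_choose` is solved for its term with the higher binomial, at the
price of dividing by `s + 1`. -/
theorem dilate_pow_mul_choose_mem_pow (j s : ℕ) :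
    dilate (fun v => (v : ℚ) ^ j * ((v - 1).choose s : ℚ)) ∈
      letterSpan (powSeq ℚ) (s + j + 1) := by
  induction s generalizing j with
  | zero =>
    refine Submodule.subset_span ⟨j + 1, by omega, by omega, ?_⟩
    simp [powSeq]
  | succ s ih =>
    have h : dilate (fun v => (v : ℚ) ^ j * ((v - 1).choose (s + 1) : ℚ)) =
        ((s : ℚ) + 1)⁻¹ • dilate (fun v => (v : ℚ) ^ (j + 1) * ((v - 1).choose s : ℚ)) -
          dilate (fun v => (v : ℚ) ^ j * ((v - 1).choose s : ℚ)) := by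
      rw [dilate_pow_mul_choose, smul_add, smul_smul, smul_smul, inv_mul_cancel₀ (by positivity)]
      simp
    rw [h]
    exact sub_mem (Submodule.smul_mem _ _ (letterSpan_mono _ (by omega) (ih (j + 1))))
      (letterSpan_mono _ (by omega) (ih j))

theorem powSeq_mem (s : ℕ) (hs : 0 < s) :
    powSeq ℚ s ∈ letterSpan (fun s => geomSeq ℚ ^ s) s := by
  have := dilate_pow_mul_choose_mem_geom (s - 1) 0
  simp only [Nat.choose_zero_right, Nat.cast_one, mul_one, zero_add] at this
  rwa [Nat.sub_add_cancel hs] at this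

theorem geomSeq_pow_mem (s : ℕ) (hs : 0 < s) :
    geomSeq ℚ ^ s ∈ letterSpan (powSeq ℚ) s := by
  have := dilate_pow_mul_choose_mem_pow 0 (s - 1)
  simp only [pow_zero, one_mul, add_zero] at this
  rwa [← geomSeq_pow_succ, Nat.sub_add_cancel hs] at this

/-- Each letter of weight `s` expands in letters of the other kind of weight at most `s`, so
expanding a word letter by letter keeps its length and does not raise its weight. -/
theorem nestedSpan_geomSeq (k l : ℕ) :
    nestedSpan (fun s => geomSeq ℚ ^ s) k l = nestedSpan (powSeq ℚ) k l :=
  le_antisymm (nestedSpan_le geomSeq_pow_mem k l) (nestedSpan_le powSeq_mem k l)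

theorem X_pow_dvd_geomSeq_pow {s : ℕ} (hs : 0 < s) (m : ℕ) :
    (X : R⟦X⟧) ^ m ∣ (geomSeq R ^ s) m :=
  (X_pow_dvd_dilate _ m).trans (dvd_pow_self _ hs.ne')

theorem isStable_of_mem_nestedSpan {b : ℕ → ℕ → ℚ⟦X⟧} {k l : ℕ} {g : ℕ → ℚ⟦X⟧}
    (hb : ∀ s, 0 < s → ∀ m, (X : ℚ⟦X⟧) ^ m ∣ b s m) (hg : g ∈ nestedSpan b k l) : IsStable g := by
  induction hg using Submodule.span_induction with
  | mem g hg =>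
    obtain ⟨s, h1, -, -, rfl⟩ := hg
    refine isStable_nestedSum fun a ha m => ?_
    obtain ⟨x, hx, rfl⟩ := List.mem_map.1 ha
    exact hb x (h1 x hx) m
  | zero => exact fun _ _ _ => by simp
  | add g h _ _ hg hh => exact hg.add hh
  | smul c g _ hg => exact hg.smul c

/-- The bracket without its factorial denominators, indexed by a list. -/
def rawBracket (s : List ℕ) : ℚ⟦X⟧ := diagLimit (nestedSum (s.map (powSeq ℚ)))

theorem bracket_eq_smul {l : ℕ} (s : Fin l → ℕ) :
    bracket s = (((∏ i, (s i - 1).factorial : ℕ) : ℚ))⁻¹ • rawBracket (List.ofFn s) := by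
  ext n
  have e : (List.ofFn s).map (powSeq ℚ) =
      List.ofFn fun i => dilate (fun v => (v : ℚ) ^ (s i - 1)) := by
    rw [List.map_ofFn]; rfl
  rw [rawBracket, e, map_smul, coeff_diagLimit_nestedSum_ofFn, bracket, coeff_mk, div_eq_inv_mul,
    smul_eq_mul]
  congr 1
  rw [multipleDivisorSum, ← chainIndex]
  push_cast
  rfl

theorem filWL_eq_map (k l : ℕ) :
    filWL k l = (nestedSpan (powSeq ℚ) k l).map diagLimit := by
  apply le_antisymm
  · refine Submodule.span_le.2 ?_
    rintro _ ⟨r, s, h1, h2, h3, rfl⟩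
    rw [bracket_eq_smul]
    refine Submodule.smul_mem _ _ (Submodule.mem_map_of_mem (Submodule.subset_span
      ⟨List.ofFn s, ?_, ?_, ?_, rfl⟩))
    · intro x hx
      obtain ⟨i, rfl⟩ := (List.mem_ofFn' _ _).1 hx
      exact h1 i
    · rwa [List.sum_ofFn]
    · rwa [List.length_ofFn]
  · rw [Submodule.map_le_iff_le_comap]
    refine Submodule.span_le.2 ?_
    rintro _ ⟨s, h1, h2, h3, rfl⟩
    change rawBracket s ∈ filWL k l
    have h := bracket_eq_smul s.get
    rw [List.ofFn_get] at h
    have hne : (((∏ i, (s.get i - 1).factorial : ℕ) : ℚ)) ≠ 0 := by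
      exact_mod_cast Finset.prod_ne_zero_iff.2 fun i _ => Nat.factorial_ne_zero _
    rw [eq_inv_smul_iff₀ hne] at h
    rw [← h]
    refine Submodule.smul_mem _ _ (Submodule.subset_span ⟨s.length, s.get, ?_, ?_, h3, rfl⟩)
    · exact fun i => h1 _ (List.get_mem _ _)
    · rwa [← List.sum_ofFn, List.ofFn_get]

theorem rawBracket_mem {s : List ℕ} {k l : ℕ} (h1 : ∀ x ∈ s, 0 < x) (h2 : s.sum ≤ k)
    (h3 : s.length ≤ l) : rawBracket s ∈ filWL k l := by
  rw [filWL_eq_map]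
  exact Submodule.mem_map_of_mem (Submodule.subset_span ⟨s, h1, h2, h3, rfl⟩)

theorem filWL_eq_span (k l : ℕ) : filWL k l = Submodule.span ℚ
    {f | ∃ s : List ℕ, (∀ x ∈ s, 0 < x) ∧ s.sum ≤ k ∧ s.length ≤ l ∧ f = rawBracket s} := by
  apply le_antisymm
  · rw [filWL_eq_map, nestedSpan, Submodule.map_span]
    refine Submodule.span_mono ?_
    rintro _ ⟨_, ⟨s, h1, h2, h3, rfl⟩, rfl⟩
    exact ⟨s, h1, h2, h3, rfl⟩
  · refine Submodule.span_le.2 ?_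
    rintro _ ⟨s, h1, h2, h3, rfl⟩
    exact rawBracket_mem h1 h2 h3

theorem filWL_mono {k l k' l' : ℕ} (hk : k ≤ k') (hl : l ≤ l') : filWL k l ≤ filWL k' l' :=
  Submodule.span_mono fun _ ⟨r, s, h1, h2, h3, h4⟩ => ⟨r, s, h1, h2.trans hk, h3.trans hl, h4⟩

/-- Induction along the quasi-shuffle formula. This alphabet is convenient because the contracted
letter `geomSeq ^ a * geomSeq ^ b` is the single letter `geomSeq ^ (a + b)`. -/
theorem nestedSum_mul_mem (s t : List ℕ) (hs : ∀ x ∈ s, 0 < x) (ht : ∀ x ∈ t, 0 < x) :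
    nestedSum (s.map fun s => geomSeq ℚ ^ s) * nestedSum (t.map fun s => geomSeq ℚ ^ s) ∈
      nestedSpan (fun s => geomSeq ℚ ^ s) (s.sum + t.sum) (s.length + t.length) := by
  induction s generalizing t with
  | nil =>
    have h1 : nestedSum (List.map (fun s => geomSeq ℚ ^ s) []) = 1 := rfl
    rw [h1, one_mul]
    exact Submodule.subset_span ⟨t, ht, by simp, by simp, rfl⟩
  | cons a s ih =>
    induction t with
    | nil =>
      have h1 : nestedSum (List.map (fun s => geomSeq ℚ ^ s) []) = 1 := rfl
      rw [h1, mul_one]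
      exact Submodule.subset_span ⟨a :: s, hs, by simp, by simp, rfl⟩
    | cons b t ih' =>
      have hs' : ∀ x ∈ s, 0 < x := fun x hx => hs x (by simp [hx])
      have ht' : ∀ x ∈ t, 0 < x := fun x hx => ht x (by simp [hx])
      have ha : 0 < a := hs a (by simp)
      have hb : 0 < b := ht b (by simp)
      have hl : ∀ d, 0 < d →
          geomSeq ℚ ^ d ∈ letterSpan (fun s => geomSeq ℚ ^ s) d := fun d hd =>
        Submodule.subset_span ⟨d, hd, le_rfl, rfl⟩
      have h1 := cumul_mem_nestedSpan (hl a ha) (ih (b :: t) hs' ht)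
      have h2 := cumul_mem_nestedSpan (hl b hb) (ih' ht')
      have h3 := cumul_mem_nestedSpan (hl (a + b) (by omega)) (ih t hs' ht')
      have key := nestedSum_cons_mul_cons (geomSeq ℚ ^ a) (geomSeq ℚ ^ b)
        (s.map fun s => geomSeq ℚ ^ s) (t.map fun s => geomSeq ℚ ^ s)
      simp only [List.map_cons, List.sum_cons, List.length_cons] at h1 h2 h3 ⊢
      rw [key, ← pow_add]
      refine add_mem (add_mem ?_ ?_) ?_
      · exact nestedSpan_mono _ (by omega) (by omega) h1
      · exact nestedSpan_mono _ (by omega) (by omega) h2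
      · exact nestedSpan_mono _ (by omega) (by omega) h3

theorem mul_mem_nestedSpan {k l k' l' : ℕ} {g h : ℕ → ℚ⟦X⟧}
    (hg : g ∈ nestedSpan (fun s => geomSeq ℚ ^ s) k l)
    (hh : h ∈ nestedSpan (fun s => geomSeq ℚ ^ s) k' l') :
    g * h ∈ nestedSpan (fun s => geomSeq ℚ ^ s) (k + k') (l + l') := by
  have h := Submodule.mul_mem_mul hg hh
  rw [nestedSpan, nestedSpan, Submodule.span_mul_span] at h
  refine Submodule.span_le.2 ?_ h
  rintro _ ⟨_, ⟨s, h1, h2, h3, rfl⟩, _, ⟨t, h1', h2', h3', rfl⟩, rfl⟩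
  exact nestedSpan_mono _ (by omega) (by omega) (nestedSum_mul_mem s t h1 h1')

/-- The space of all brackets is a bifiltered algebra. -/
theorem mul_mem_filWL {k l k' l' : ℕ} {f g : ℚ⟦X⟧} (hf : f ∈ filWL k l) (hg : g ∈ filWL k' l') :
    f * g ∈ filWL (k + k') (l + l') := by
  rw [filWL_eq_map, ← nestedSpan_geomSeq] at hf hg ⊢
  obtain ⟨f, hf, rfl⟩ := hf
  obtain ⟨g, hg, rfl⟩ := hg
  refine ⟨f * g, mul_mem_nestedSpan hf hg, diagLimit_mul ?_ ?_⟩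
  · exact isStable_of_mem_nestedSpan (fun s hs m => X_pow_dvd_geomSeq_pow hs m) hf
  · exact isStable_of_mem_nestedSpan (fun s hs m => X_pow_dvd_geomSeq_pow hs m) hg

theorem one_mem_filWL (k l : ℕ) : 1 ∈ filWL k l := by
  rw [filWL_eq_map]
  refine ⟨1, one_mem_nestedSpan _ _ _, ?_⟩
  ext n
  simp [coeff_diagLimit]

/-- The limit of the nested sum of the sequences `m ↦ (q ^ m / (1 - q ^ m)) ^ s`. -/
def geomBracket (R : Type*) [CommRing R] (s : List ℕ) : R⟦X⟧ :=
  diagLimit (nestedSum (s.map fun s => geomSeq R ^ s))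

theorem geomBracket_mem {s : List ℕ} (h : ∀ x ∈ s, 0 < x) :
    geomBracket ℚ s ∈ filWL s.sum s.length := by
  rw [filWL_eq_map, ← nestedSpan_geomSeq]
  exact Submodule.mem_map_of_mem (Submodule.subset_span ⟨s, h, le_rfl, le_rfl, rfl⟩)

end Filtration

/-! ### Double and triple sums with arbitrary weights; monomial weights give brackets and products.
-/

noncomputable section Relations

open Finset PowerSeries

/-- Positive `(u₁, v₁, u₂, v₂)` with `u₁ v₁ + u₂ v₂ = n`. -/
def quadIndex (n : ℕ) : Finset (ℕ × ℕ × ℕ × ℕ) :=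
  (range (n + 1) ×ˢ range (n + 1) ×ˢ range (n + 1) ×ˢ range (n + 1)).filter fun p =>
    0 < p.1 ∧ 0 < p.2.1 ∧ 0 < p.2.2.1 ∧ 0 < p.2.2.2 ∧ p.1 * p.2.1 + p.2.2.1 * p.2.2.2 = n

/-- Positive `(u₁, v₁, u₂, v₂, u₃, v₃)` with `u₁ v₁ + u₂ v₂ + u₃ v₃ = n`. -/
def hexIndex (n : ℕ) : Finset (ℕ × ℕ × ℕ × ℕ × ℕ × ℕ) :=
  (range (n + 1) ×ˢ range (n + 1) ×ˢ range (n + 1) ×ˢ range (n + 1) ×ˢ range (n + 1) ×ˢ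
    range (n + 1)).filter fun p =>
    0 < p.1 ∧ 0 < p.2.1 ∧ 0 < p.2.2.1 ∧ 0 < p.2.2.2.1 ∧ 0 < p.2.2.2.2.1 ∧ 0 < p.2.2.2.2.2 ∧
      p.1 * p.2.1 + p.2.2.1 * p.2.2.2.1 + p.2.2.2.2.1 * p.2.2.2.2.2 = n

theorem mem_quadIndex {n a b c d : ℕ} : (a, b, c, d) ∈ quadIndex n ↔
    0 < a ∧ 0 < b ∧ 0 < c ∧ 0 < d ∧ a * b + c * d = n := by
  simp only [quadIndex, mem_filter, mem_product, mem_range, and_iff_right_iff_imp]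
  rintro ⟨ha, hb, hc, hd, rfl⟩
  have h1 := Nat.le_mul_of_pos_right a hb
  have h2 := Nat.le_mul_of_pos_left b ha
  have h3 := Nat.le_mul_of_pos_right c hd
  have h4 := Nat.le_mul_of_pos_left d hc
  omega

theorem mem_hexIndex {n a b c d e f : ℕ} : (a, b, c, d, e, f) ∈ hexIndex n ↔
    0 < a ∧ 0 < b ∧ 0 < c ∧ 0 < d ∧ 0 < e ∧ 0 < f ∧ a * b + c * d + e * f = n := by
  simp only [hexIndex, mem_filter, mem_product, mem_range, and_iff_right_iff_imp]
  rintro ⟨ha, hb, hc, hd, he, hf, rfl⟩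
  have h1 := Nat.le_mul_of_pos_right a hb
  have h2 := Nat.le_mul_of_pos_left b ha
  have h3 := Nat.le_mul_of_pos_right c hd
  have h4 := Nat.le_mul_of_pos_left d hc
  have h5 := Nat.le_mul_of_pos_right e hf
  have h6 := Nat.le_mul_of_pos_left f he
  omega

/-- A power series whose coefficients are finite sums, as a linear map in the summand. -/
def sumSeries {α : Type*} (S : ℕ → Finset α) : (α → ℚ) →ₗ[ℚ] ℚ⟦X⟧ where
  toFun F := PowerSeries.mk fun n => ∑ p ∈ S n, F p
  map_add' F G := by ext n; simp [Finset.sum_add_distrib]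
  map_smul' c F := by ext n; simp [Finset.mul_sum]

theorem coeff_sumSeries {α : Type*} (S : ℕ → Finset α) (F : α → ℚ) (n : ℕ) :
    coeff n (sumSeries S F) = ∑ p ∈ S n, F p := by simp [sumSeries]

/-- `∑ F(v₁, v₂) q ^ (u₁ v₁ + u₂ v₂)`, the sum over `u₁ > u₂ > 0` and `v₁, v₂ > 0`. -/
def pairSum : (ℕ × ℕ → ℚ) →ₗ[ℚ] ℚ⟦X⟧ :=
  sumSeries (fun n => (quadIndex n).filter fun p => p.2.2.1 < p.1) ∘ₗ
    LinearMap.funLeft ℚ ℚ fun p => (p.2.1, p.2.2.2)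

/-- `∑ F(v₁, v₂) q ^ (u₁ v₁ + u₂ v₂)`, the sum over all positive integers. -/
def fullPairSum : (ℕ × ℕ → ℚ) →ₗ[ℚ] ℚ⟦X⟧ :=
  sumSeries quadIndex ∘ₗ LinearMap.funLeft ℚ ℚ fun p => (p.2.1, p.2.2.2)

/-- `∑ F(v₁, v₂, v₃) q ^ (u₁ v₁ + u₂ v₂ + u₃ v₃)`, the sum over `u₁ > u₂ > u₃ > 0` and
`v₁, v₂, v₃ > 0`. -/
def tripleSum : (ℕ × ℕ × ℕ → ℚ) →ₗ[ℚ] ℚ⟦X⟧ :=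
  sumSeries (fun n => (hexIndex n).filter fun p => p.2.2.1 < p.1 ∧ p.2.2.2.2.1 < p.2.2.1) ∘ₗ
    LinearMap.funLeft ℚ ℚ fun p => (p.2.1, p.2.2.2.1, p.2.2.2.2.2)

/-- `∑ F(v₁, v₂, v₃) q ^ (u₁ v₁ + u₂ v₂ + u₃ v₃)`, the sum over positive integers with
`u₂ > u₃`. -/
def mixedTripleSum : (ℕ × ℕ × ℕ → ℚ) →ₗ[ℚ] ℚ⟦X⟧ :=
  sumSeries (fun n => (hexIndex n).filter fun p => p.2.2.2.2.1 < p.2.2.1) ∘ₗ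
    LinearMap.funLeft ℚ ℚ fun p => (p.2.1, p.2.2.2.1, p.2.2.2.2.2)

theorem coeff_pairSum (F : ℕ × ℕ → ℚ) (n : ℕ) :
    coeff n (pairSum F) =
      ∑ p ∈ (quadIndex n).filter fun p => p.2.2.1 < p.1, F (p.2.1, p.2.2.2) := by
  rw [pairSum, LinearMap.comp_apply, coeff_sumSeries]
  rfl

theorem coeff_fullPairSum (F : ℕ × ℕ → ℚ) (n : ℕ) :
    coeff n (fullPairSum F) = ∑ p ∈ quadIndex n, F (p.2.1, p.2.2.2) := by
  rw [fullPairSum, LinearMap.comp_apply, coeff_sumSeries]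
  rfl

theorem coeff_tripleSum (F : ℕ × ℕ × ℕ → ℚ) (n : ℕ) :
    coeff n (tripleSum F) =
      ∑ p ∈ (hexIndex n).filter fun p => p.2.2.1 < p.1 ∧ p.2.2.2.2.1 < p.2.2.1,
        F (p.2.1, p.2.2.2.1, p.2.2.2.2.2) := by
  rw [tripleSum, LinearMap.comp_apply, coeff_sumSeries]
  rfl

theorem coeff_mixedTripleSum (F : ℕ × ℕ × ℕ → ℚ) (n : ℕ) :
    coeff n (mixedTripleSum F) =
      ∑ p ∈ (hexIndex n).filter fun p => p.2.2.2.2.1 < p.2.2.1,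
        F (p.2.1, p.2.2.2.1, p.2.2.2.2.2) := by
  rw [mixedTripleSum, LinearMap.comp_apply, coeff_sumSeries]
  rfl

theorem coeff_rawBracket_ofFn {l : ℕ} (s : Fin l → ℕ) (n : ℕ) :
    coeff n (rawBracket (List.ofFn s)) =
      ∑ p ∈ chainIndex l n, ∏ i, ((p.2 i : ℚ)) ^ (s i - 1) := by
  have e : (List.ofFn s).map (powSeq ℚ) =
      List.ofFn fun i => dilate (fun v => (v : ℚ) ^ (s i - 1)) := by
    rw [List.map_ofFn]; rfl
  rw [rawBracket, e, coeff_diagLimit_nestedSum_ofFn]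

theorem coeff_rawBracket_one (a n : ℕ) :
    coeff n (rawBracket [a]) = ∑ p ∈ n.divisorsAntidiagonal, (p.2 : ℚ) ^ (a - 1) := by
  have e : [a] = List.ofFn ![a] := by simp
  rw [e, coeff_rawBracket_ofFn]
  refine Finset.sum_bij' (fun p _ => (p.1 0, p.2 0)) (fun p _ => (![p.1], ![p.2])) ?_ ?_ ?_ ?_ ?_
  · rintro ⟨u, v⟩ h
    obtain ⟨hu, hv, -, hs⟩ := mem_chainIndex.1 h
    simp only [Fin.sum_univ_one] at hs
    rw [Nat.mem_divisorsAntidiagonal]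
    exact ⟨hs, hs ▸ (Nat.mul_pos (hu 0) (hv 0)).ne'⟩
  · rintro ⟨u, v⟩ h
    obtain ⟨h1, h2⟩ := Nat.mem_divisorsAntidiagonal.1 h
    rw [mem_chainIndex]
    simp only at h1
    refine ⟨?_, ?_, ?_, ?_⟩
    · simpa using Nat.pos_of_ne_zero (by rintro rfl; omega)
    · simpa using Nat.pos_of_ne_zero (by rintro rfl; omega)
    · exact fun i j hij => by omega
    · simpa using h1
  · rintro ⟨u, v⟩ -
    ext i <;> fin_cases i <;> rfl
  · rintro ⟨u, v⟩ -
    rfl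
  · rintro ⟨u, v⟩ -
    simp

theorem pairSum_monomial (i j : ℕ) :
    pairSum (fun p => (p.1 : ℚ) ^ i * (p.2 : ℚ) ^ j) = rawBracket [i + 1, j + 1] := by
  have e : [i + 1, j + 1] = List.ofFn ![i + 1, j + 1] := by simp
  ext n
  rw [e, coeff_rawBracket_ofFn, coeff_pairSum]
  refine Finset.sum_bij' (fun p _ => (![p.1, p.2.2.1], ![p.2.1, p.2.2.2]))
    (fun p _ => (p.1 0, p.2 0, p.1 1, p.2 1)) ?_ ?_ ?_ ?_ ?_
  · rintro ⟨a, b, c, d⟩ h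
    rw [mem_filter, mem_quadIndex] at h
    rw [mem_chainIndex]
    refine ⟨?_, ?_, ?_, ?_⟩
    · simp [Fin.forall_fin_two, h.1.1, h.1.2.2.1]
    · simp [Fin.forall_fin_two, h.1.2.1, h.1.2.2.2.1]
    · rw [Fin.strictAnti_iff_succ_lt]
      simpa using h.2
    · simpa using h.1.2.2.2.2
  · rintro ⟨u, v⟩ h
    obtain ⟨hu, hv, ha, hs⟩ := mem_chainIndex.1 h
    rw [mem_filter, mem_quadIndex]
    rw [Fin.sum_univ_two] at hs
    exact ⟨⟨hu 0, hv 0, hu 1, hv 1, hs⟩, ha (by simp)⟩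
  · rintro ⟨a, b, c, d⟩ h
    rfl
  · rintro ⟨u, v⟩ -
    ext i <;> fin_cases i <;> rfl
  · rintro ⟨a, b, c, d⟩ h
    simp

theorem tripleSum_monomial (i j k : ℕ) :
    tripleSum (fun p => (p.1 : ℚ) ^ i * (p.2.1 : ℚ) ^ j * (p.2.2 : ℚ) ^ k) =
      rawBracket [i + 1, j + 1, k + 1] := by
  have e : [i + 1, j + 1, k + 1] = List.ofFn ![i + 1, j + 1, k + 1] := by simp
  ext n
  rw [e, coeff_rawBracket_ofFn, coeff_tripleSum]
  refine Finset.sum_bij' (fun p _ => (![p.1, p.2.2.1, p.2.2.2.2.1],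
    ![p.2.1, p.2.2.2.1, p.2.2.2.2.2]))
    (fun p _ => (p.1 0, p.2 0, p.1 1, p.2 1, p.1 2, p.2 2)) ?_ ?_ ?_ ?_ ?_
  · rintro ⟨a, b, c, d, e, f⟩ h
    rw [mem_filter, mem_hexIndex] at h
    obtain ⟨⟨ha, hb, hc, hd, he, hf, hs⟩, h1, h2⟩ := h
    rw [mem_chainIndex]
    refine ⟨?_, ?_, ?_, ?_⟩
    · simp [Fin.forall_fin_succ, ha, hc, he]
    · simp [Fin.forall_fin_succ, hb, hd, hf]
    · rw [Fin.strictAnti_iff_succ_lt]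
      simp only at h1 h2
      simp [Fin.forall_fin_succ, h1, h2]
    · simpa [Fin.sum_univ_three] using hs
  · rintro ⟨u, v⟩ h
    obtain ⟨hu, hv, ha, hs⟩ := mem_chainIndex.1 h
    rw [mem_filter, mem_hexIndex]
    rw [Fin.sum_univ_three] at hs
    exact ⟨⟨hu 0, hv 0, hu 1, hv 1, hu 2, hv 2, hs⟩, ha (by simp), ha (by decide)⟩
  · rintro ⟨a, b, c, d, e, f⟩ h
    rfl
  · rintro ⟨u, v⟩ -
    ext i <;> fin_cases i <;> rfl
  · rintro ⟨a, b, c, d, e, f⟩ h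
    simp [Fin.prod_univ_three]

theorem fullPairSum_monomial (i j : ℕ) :
    fullPairSum (fun p => (p.1 : ℚ) ^ i * (p.2 : ℚ) ^ j) =
      rawBracket [i + 1] * rawBracket [j + 1] := by
  ext n
  rw [coeff_fullPairSum, coeff_mul]
  simp only [coeff_rawBracket_one, Finset.sum_mul_sum, Nat.add_sub_cancel]
  simp only [← Finset.sum_product']
  rw [Finset.sum_sigma']
  refine Finset.sum_bij' (fun p _ => ⟨(p.1 * p.2.1, p.2.2.1 * p.2.2.2),
    ((p.1, p.2.1), (p.2.2.1, p.2.2.2))⟩)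
    (fun p _ => (p.2.1.1, p.2.1.2, p.2.2.1, p.2.2.2)) ?_ ?_ ?_ ?_ ?_
  · rintro ⟨a, b, c, d⟩ h
    obtain ⟨ha, hb, hc, hd, hs⟩ := mem_quadIndex.1 h
    simp [hs, ha.ne', hb.ne', hc.ne', hd.ne']
  · rintro ⟨⟨x, y⟩, ⟨⟨a, b⟩, ⟨c, d⟩⟩⟩ h
    simp only [mem_sigma, mem_product, HasAntidiagonal.mem_antidiagonal,
      Nat.mem_divisorsAntidiagonal] at h
    obtain ⟨hs, ⟨rfl, h1⟩, ⟨rfl, h2⟩⟩ := h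
    rw [mem_quadIndex]
    rw [mul_ne_zero_iff] at h1 h2
    exact ⟨Nat.pos_of_ne_zero h1.1, Nat.pos_of_ne_zero h1.2, Nat.pos_of_ne_zero h2.1,
      Nat.pos_of_ne_zero h2.2, hs⟩
  · rintro ⟨a, b, c, d⟩ h
    rfl
  · rintro ⟨⟨x, y⟩, ⟨⟨a, b⟩, ⟨c, d⟩⟩⟩ h
    simp only [mem_sigma, mem_product, HasAntidiagonal.mem_antidiagonal,
      Nat.mem_divisorsAntidiagonal] at h
    obtain ⟨hs, ⟨rfl, h1⟩, ⟨rfl, h2⟩⟩ := h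
    rfl
  · rintro ⟨a, b, c, d⟩ h
    rfl

theorem mixedTripleSum_monomial (i j k : ℕ) :
    mixedTripleSum (fun p => (p.1 : ℚ) ^ i * (p.2.1 : ℚ) ^ j * (p.2.2 : ℚ) ^ k) =
      rawBracket [i + 1] * rawBracket [j + 1, k + 1] := by
  ext n
  rw [coeff_mixedTripleSum, coeff_mul]
  simp only [coeff_rawBracket_one, ← pairSum_monomial, coeff_pairSum,
    Finset.sum_mul_sum, Nat.add_sub_cancel]
  simp only [← Finset.sum_product']
  rw [Finset.sum_sigma']
  refine Finset.sum_bij' (fun p _ =>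
    ⟨(p.1 * p.2.1, p.2.2.1 * p.2.2.2.1 + p.2.2.2.2.1 * p.2.2.2.2.2), ((p.1, p.2.1), p.2.2)⟩)
    (fun p _ => (p.2.1.1, p.2.1.2, p.2.2)) ?_ ?_ ?_ ?_ ?_
  · rintro ⟨a, b, c, d, e, f⟩ h
    rw [mem_filter, mem_hexIndex] at h
    obtain ⟨⟨ha, hb, hc, hd, he, hf, hs⟩, h1⟩ := h
    simp only at h1
    simp [← hs, ha.ne', hb.ne', mem_quadIndex, hc, hd, he, hf, h1, add_assoc]
  · rintro ⟨⟨x, y⟩, ⟨⟨a, b⟩, ⟨c, d, e, f⟩⟩⟩ h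
    simp only [mem_sigma, mem_product, HasAntidiagonal.mem_antidiagonal,
      Nat.mem_divisorsAntidiagonal, mem_filter, mem_quadIndex] at h
    obtain ⟨hs, ⟨rfl, h1⟩, ⟨hc, hd, he, hf, rfl⟩, h2⟩ := h
    rw [mem_filter, mem_hexIndex]
    rw [mul_ne_zero_iff] at h1
    exact ⟨⟨Nat.pos_of_ne_zero h1.1, Nat.pos_of_ne_zero h1.2, hc, hd, he, hf,
      (add_assoc _ _ _).trans hs⟩, h2⟩
  · rintro ⟨a, b, c, d, e, f⟩ h
    rfl
  · rintro ⟨⟨x, y⟩, ⟨⟨a, b⟩, ⟨c, d, e, f⟩⟩⟩ h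
    simp only [mem_sigma, mem_product, HasAntidiagonal.mem_antidiagonal,
      Nat.mem_divisorsAntidiagonal, mem_filter, mem_quadIndex] at h
    obtain ⟨hs, ⟨rfl, h1⟩, ⟨hc, hd, he, hf, rfl⟩, h2⟩ := h
    rfl
  · rintro ⟨a, b, c, d, e, f⟩ h
    simp [mul_assoc]

end Relations

/-! ### Cutting unordered sums according to the order of the `v`'s. -/

noncomputable section Relations

open Finset PowerSeries

/-- For `v₁ > v₂` one writes `u₁v₁ + u₂v₂ = (u₁+u₂)v₂ + u₁(v₁-v₂)`, and for `v₁ < v₂` it is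
`(u₁+u₂)v₁ + u₂(v₂-v₁)`. In both cases the new `u`'s are strictly ordered, and the substitution is
bijective. The diagonal `v₁ = v₂` drops out by `hF`. -/
theorem fullPairSum_eq {F : ℕ × ℕ → ℚ} (hF : ∀ x, F (x, x) = 0) :
    fullPairSum F =
      pairSum (fun p => F (p.1 + p.2, p.1)) + pairSum (fun p => F (p.1, p.1 + p.2)) := by
  ext n
  rw [map_add, coeff_fullPairSum, coeff_pairSum, coeff_pairSum,
    ← Finset.sum_filter_add_sum_filter_not (quadIndex n) fun p => p.2.2.2 < p.2.1]
  congr 1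
  · refine Finset.sum_bij' (fun p _ => (p.1 + p.2.2.1, p.2.2.2, p.1, p.2.1 - p.2.2.2))
      (fun p _ => (p.2.2.1, p.2.1 + p.2.2.2, p.1 - p.2.2.1, p.2.1)) ?_ ?_ ?_ ?_ ?_
    · rintro ⟨a, b, c, d⟩ h
      simp only [mem_filter, mem_quadIndex] at h ⊢
      obtain ⟨⟨ha, hb, hc, hd, hs⟩, h1⟩ := h
      obtain ⟨t, rfl⟩ : ∃ t, b = d + t := ⟨b - d, by omega⟩
      rw [Nat.add_sub_cancel_left]
      exact ⟨⟨by omega, hd, ha, by omega, by rw [← hs]; ring⟩, by omega⟩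
    · rintro ⟨a, b, c, d⟩ h
      simp only [mem_filter, mem_quadIndex] at h ⊢
      obtain ⟨⟨ha, hb, hc, hd, hs⟩, h1⟩ := h
      obtain ⟨t, rfl⟩ : ∃ t, a = c + t := ⟨a - c, by omega⟩
      rw [Nat.add_sub_cancel_left]
      exact ⟨⟨hc, by omega, by omega, hb, by rw [← hs]; ring⟩, by omega⟩
    · rintro ⟨a, b, c, d⟩ h
      simp only [mem_filter, mem_quadIndex] at h
      simp only [Prod.mk.injEq, true_and, and_true]
      omega
    · rintro ⟨a, b, c, d⟩ h
      simp only [mem_filter, mem_quadIndex] at h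
      simp only [Prod.mk.injEq, true_and]
      omega
    · rintro ⟨a, b, c, d⟩ h
      simp only [mem_filter, mem_quadIndex] at h
      simp only
      rw [Nat.add_sub_cancel' h.2.le]
  · rw [← Finset.sum_filter_add_sum_filter_not _ fun p => p.2.1 < p.2.2.2, Finset.filter_filter,
      Finset.filter_filter, add_eq_left.2]
    · refine Finset.sum_bij' (fun p _ => (p.1 + p.2.2.1, p.2.1, p.2.2.1, p.2.2.2 - p.2.1))
        (fun p _ => (p.1 - p.2.2.1, p.2.1, p.2.2.1, p.2.1 + p.2.2.2)) ?_ ?_ ?_ ?_ ?_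
      · rintro ⟨a, b, c, d⟩ h
        simp only [mem_filter, mem_quadIndex] at h ⊢
        obtain ⟨⟨ha, hb, hc, hd, hs⟩, h1⟩ := h
        obtain ⟨t, rfl⟩ : ∃ t, d = b + t := ⟨d - b, by omega⟩
        rw [Nat.add_sub_cancel_left]
        exact ⟨⟨by omega, hb, hc, by omega, by rw [← hs]; ring⟩, by omega⟩
      · rintro ⟨a, b, c, d⟩ h
        simp only [mem_filter, mem_quadIndex] at h ⊢
        obtain ⟨⟨ha, hb, hc, hd, hs⟩, h1⟩ := h
        obtain ⟨t, rfl⟩ : ∃ t, a = c + t := ⟨a - c, by omega⟩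
        rw [Nat.add_sub_cancel_left]
        exact ⟨⟨by omega, by omega, by omega, by omega, by rw [← hs]; ring⟩, by omega⟩
      · rintro ⟨a, b, c, d⟩ h
        simp only [mem_filter, mem_quadIndex] at h
        simp only [Prod.mk.injEq, true_and]
        omega
      · rintro ⟨a, b, c, d⟩ h
        simp only [mem_filter, mem_quadIndex] at h
        simp only [Prod.mk.injEq, true_and]
        omega
      · rintro ⟨a, b, c, d⟩ h
        simp only [mem_filter, mem_quadIndex] at h
        simp only
        rw [Nat.add_sub_cancel' h.2.2.le]
    · refine Finset.sum_eq_zero ?_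
      rintro ⟨a, b, c, d⟩ h
      simp only [mem_filter] at h
      obtain rfl : b = d := by omega
      exact hF b

/-- The value `v₁` is compared with `v₂` and `v₂ + v₃`. The exponent `u₁v₁ + u₂v₂ + u₃v₃` becomes
`(u₁+u₂)v₂ + (u₁+u₃)v₃ + u₁(v₁-v₂-v₃)` above both, `(u₁+u₂)v₂ + (u₁+u₃)(v₁-v₂) + u₃(v₂+v₃-v₁)`
between them, and `(u₁+u₂)v₁ + u₂(v₂-v₁) + u₃v₃` below both. The hypotheses remove the two walls `v₁
= v₂` and `v₁ = v₂ + v₃`. -/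
theorem mixedTripleSum_eq {F : ℕ × ℕ × ℕ → ℚ} (h1 : ∀ x y, F (x, x, y) = 0)
    (h2 : ∀ x y, F (x + y, x, y) = 0) :
    mixedTripleSum F = tripleSum (fun p => F (p.1 + p.2.1 + p.2.2, p.1, p.2.1)) +
      tripleSum (fun p => F (p.1 + p.2.1, p.1, p.2.1 + p.2.2)) +
      tripleSum (fun p => F (p.1, p.1 + p.2.1, p.2.2)) := by
  ext n
  rw [map_add, map_add, coeff_mixedTripleSum, coeff_tripleSum, coeff_tripleSum,
    coeff_tripleSum,
    ← Finset.sum_filter_add_sum_filter_not _ fun p => p.2.1 < p.2.2.2.1, add_comm]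
  congr 1
  · rw [← Finset.sum_filter_add_sum_filter_not _ fun p => p.2.2.2.1 + p.2.2.2.2.2 < p.2.1,
      ← Finset.sum_filter_add_sum_filter_not (Finset.filter (fun p : ℕ × ℕ × ℕ × ℕ × ℕ × ℕ =>
        ¬ p.2.2.2.1 + p.2.2.2.2.2 < p.2.1) _) fun p =>
        p.2.2.2.1 < p.2.1 ∧ p.2.1 < p.2.2.2.1 + p.2.2.2.2.2]
    congr 1
    · refine Finset.sum_bij' (fun p _ => (p.1 + p.2.2.1, p.2.2.2.1, p.1 + p.2.2.2.2.1,
          p.2.2.2.2.2, p.1, p.2.1 - (p.2.2.2.1 + p.2.2.2.2.2)))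
        (fun p _ => (p.2.2.2.2.1, p.2.1 + p.2.2.2.1 + p.2.2.2.2.2, p.1 - p.2.2.2.2.1, p.2.1,
          p.2.2.1 - p.2.2.2.2.1, p.2.2.2.1)) ?_ ?_ ?_ ?_ ?_
      · rintro ⟨a, b, c, d, e, f⟩ h
        simp only [mem_filter, mem_hexIndex] at h ⊢
        obtain ⟨⟨⟨⟨ha, hb, hc, hd, he, hf, hs⟩, h1⟩, h2⟩, h3⟩ := h
        obtain ⟨t, rfl⟩ : ∃ t, b = d + f + t := ⟨b - (d + f), by omega⟩
        rw [Nat.add_sub_cancel_left]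
        exact ⟨⟨by omega, by omega, by omega, by omega, by omega, by omega, by rw [← hs]; ring⟩,
          by omega, by omega⟩
      · rintro ⟨a, b, c, d, e, f⟩ h
        simp only [mem_filter, mem_hexIndex] at h ⊢
        obtain ⟨⟨ha, hb, hc, hd, he, hf, hs⟩, h1, h2⟩ := h
        obtain ⟨t, rfl⟩ : ∃ t, c = e + t := ⟨c - e, by omega⟩
        obtain ⟨s, rfl⟩ : ∃ s, a = e + t + s := ⟨a - (e + t), by omega⟩
        rw [Nat.add_sub_cancel_left, show e + t + s - e = t + s by omega]
        exact ⟨⟨⟨⟨by omega, by omega, by omega, by omega, by omega, by omega,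
          by rw [← hs]; ring⟩, by omega⟩, by omega⟩, by omega⟩
      · rintro ⟨a, b, c, d, e, f⟩ h
        simp only [mem_filter, mem_hexIndex] at h
        simp only [Prod.mk.injEq, true_and, and_true]
        omega
      · rintro ⟨a, b, c, d, e, f⟩ h
        simp only [mem_filter, mem_hexIndex] at h
        simp only [Prod.mk.injEq, true_and]
        omega
      · rintro ⟨a, b, c, d, e, f⟩ h
        simp only [mem_filter, mem_hexIndex] at h
        simp only
        rw [Nat.add_sub_cancel' h.2.le]
    · rw [add_eq_left.2]
      · refine Finset.sum_bij' (fun p _ => (p.1 + p.2.2.1, p.2.2.2.1, p.1 + p.2.2.2.2.1,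
            p.2.1 - p.2.2.2.1, p.2.2.2.2.1, p.2.2.2.1 + p.2.2.2.2.2 - p.2.1))
          (fun p _ => (p.2.2.1 - p.2.2.2.2.1, p.2.1 + p.2.2.2.1, p.1 - (p.2.2.1 - p.2.2.2.2.1),
            p.2.1, p.2.2.2.2.1, p.2.2.2.1 + p.2.2.2.2.2)) ?_ ?_ ?_ ?_ ?_
        · rintro ⟨a, b, c, d, e, f⟩ h
          simp only [mem_filter, mem_hexIndex] at h ⊢
          obtain ⟨⟨⟨⟨⟨ha, hb, hc, hd, he, hf, hs⟩, h1⟩, h2⟩, h3⟩, h4, h5⟩ := h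
          obtain ⟨t, rfl⟩ : ∃ t, b = d + t := ⟨b - d, by omega⟩
          obtain ⟨s, rfl⟩ : ∃ s, f = t + s := ⟨f - t, by omega⟩
          rw [Nat.add_sub_cancel_left, show d + (t + s) - (d + t) = s by omega]
          exact ⟨⟨by omega, by omega, by omega, by omega, by omega, by omega,
            by rw [← hs]; ring⟩, by omega, by omega⟩
        · rintro ⟨a, b, c, d, e, f⟩ h
          simp only [mem_filter, mem_hexIndex] at h ⊢
          obtain ⟨⟨ha, hb, hc, hd, he, hf, hs⟩, h1, h2⟩ := h
          obtain ⟨t, rfl⟩ : ∃ t, c = e + t := ⟨c - e, by omega⟩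
          obtain ⟨s, rfl⟩ : ∃ s, a = e + t + s := ⟨a - (e + t), by omega⟩
          rw [Nat.add_sub_cancel_left, show e + t + s - t = e + s by omega]
          exact ⟨⟨⟨⟨⟨by omega, by omega, by omega, by omega, by omega, by omega,
            by rw [← hs]; ring⟩, by omega⟩, by omega⟩, by omega⟩, by omega, by omega⟩
        · rintro ⟨a, b, c, d, e, f⟩ h
          simp only [mem_filter, mem_hexIndex] at h
          simp only [Prod.mk.injEq, true_and]
          omega
        · rintro ⟨a, b, c, d, e, f⟩ h
          simp only [mem_filter, mem_hexIndex] at h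
          simp only [Prod.mk.injEq, true_and]
          omega
        · rintro ⟨a, b, c, d, e, f⟩ h
          simp only [mem_filter, mem_hexIndex] at h
          simp only
          congr 1
          simp only [Prod.mk.injEq, true_and]
          omega
      · refine Finset.sum_eq_zero ?_
        rintro ⟨a, b, c, d, e, f⟩ h
        simp only [mem_filter] at h
        simp only
        rcases (by omega : b = d ∨ b = d + f) with rfl | rfl
        · exact h1 _ _
        · exact h2 _ _
  · refine Finset.sum_bij' (fun p _ => (p.1 + p.2.2.1, p.2.1, p.2.2.1,
        p.2.2.2.1 - p.2.1, p.2.2.2.2.1, p.2.2.2.2.2))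
      (fun p _ => (p.1 - p.2.2.1, p.2.1, p.2.2.1, p.2.1 + p.2.2.2.1, p.2.2.2.2.1, p.2.2.2.2.2))
      ?_ ?_ ?_ ?_ ?_
    · rintro ⟨a, b, c, d, e, f⟩ h
      simp only [mem_filter, mem_hexIndex] at h ⊢
      obtain ⟨⟨⟨ha, hb, hc, hd, he, hf, hs⟩, h1⟩, h2⟩ := h
      obtain ⟨t, rfl⟩ : ∃ t, d = b + t := ⟨d - b, by omega⟩
      rw [Nat.add_sub_cancel_left]
      exact ⟨⟨by omega, by omega, by omega, by omega, by omega, by omega, by rw [← hs]; ring⟩,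
        by omega, by omega⟩
    · rintro ⟨a, b, c, d, e, f⟩ h
      simp only [mem_filter, mem_hexIndex] at h ⊢
      obtain ⟨⟨ha, hb, hc, hd, he, hf, hs⟩, h1, h2⟩ := h
      obtain ⟨t, rfl⟩ : ∃ t, a = c + t := ⟨a - c, by omega⟩
      rw [Nat.add_sub_cancel_left]
      exact ⟨⟨⟨by omega, by omega, by omega, by omega, by omega, by omega,
        by rw [← hs]; ring⟩, by omega⟩, by omega⟩
    · rintro ⟨a, b, c, d, e, f⟩ h
      simp only [mem_filter, mem_hexIndex] at h
      simp only [Prod.mk.injEq, true_and, and_true]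
      omega
    · rintro ⟨a, b, c, d, e, f⟩ h
      simp only [mem_filter, mem_hexIndex] at h
      simp only [Prod.mk.injEq, true_and, and_true]
      omega
    · rintro ⟨a, b, c, d, e, f⟩ h
      simp only [mem_filter, mem_hexIndex] at h
      simp only
      rw [Nat.add_sub_cancel' h.2.le]

end Relations

/-! ### Linear relations between brackets modulo shorter ones. -/

noncomputable section UpperBounds

open Finset PowerSeries

/-- One passes to powers of `geomSeq`, multiplies there and returns. -/
theorem powSeq_mul_powSeq_mem {a b : ℕ} (ha : 0 < a) (hb : 0 < b) :
    powSeq ℚ a * powSeq ℚ b ∈ letterSpan (powSeq ℚ) (a + b) := by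
  have h := Submodule.mul_mem_mul (powSeq_mem a ha) (powSeq_mem b hb)
  rw [letterSpan, letterSpan, Submodule.span_mul_span] at h
  refine Submodule.span_le.2 ?_ h
  rintro _ ⟨_, ⟨s, h1, h2, rfl⟩, _, ⟨t, h1', h2', rfl⟩, rfl⟩
  simp only [SetLike.mem_coe, ← pow_add]
  exact letterSpan_mono _ (by omega) (geomSeq_pow_mem (s + t) (by omega))

theorem diagLimit_mem_filWL {k l : ℕ} {g : ℕ → ℚ⟦X⟧} (hg : g ∈ nestedSpan (powSeq ℚ) k l) :
    diagLimit g ∈ filWL k l := by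
  rw [filWL_eq_map]
  exact Submodule.mem_map_of_mem hg

theorem isStable_nestedSum_powSeq (s : List ℕ) : IsStable (nestedSum (s.map (powSeq ℚ))) := by
  refine isStable_nestedSum fun a ha m => ?_
  obtain ⟨x, -, rfl⟩ := List.mem_map.1 ha
  exact X_pow_dvd_dilate _ m

theorem rawBracket_mul_rawBracket (s t : List ℕ) : rawBracket s * rawBracket t =
    diagLimit (nestedSum (s.map (powSeq ℚ)) * nestedSum (t.map (powSeq ℚ))) :=
  (diagLimit_mul (isStable_nestedSum_powSeq s) (isStable_nestedSum_powSeq t)).symm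

theorem nestedSum_singleton_mul_singleton {R : Type*} [CommRing R] (a b : ℕ → R⟦X⟧) :
    nestedSum [a] * nestedSum [b] = nestedSum [a, b] + nestedSum [b, a] + cumul (a * b) 1 := by
  have h : nestedSum ([] : List (ℕ → R⟦X⟧)) = 1 := rfl
  rw [nestedSum_cons_mul_cons]
  simp only [h, one_mul, mul_one, cumul_nestedSum]

theorem rawBracket_singleton_mul_singleton {a b : ℕ} (ha : 0 < a) (hb : 0 < b) :
    rawBracket [a] * rawBracket [b] - rawBracket [a, b] - rawBracket [b, a] ∈
      filWL (a + b) 1 := by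
  have e : rawBracket [a] * rawBracket [b] - rawBracket [a, b] - rawBracket [b, a] =
      diagLimit (cumul (powSeq ℚ a * powSeq ℚ b) 1) := by
    rw [rawBracket_mul_rawBracket]
    simp only [List.map_cons, List.map_nil, nestedSum_singleton_mul_singleton, map_add, rawBracket]
    ring
  rw [e]
  have h := cumul_mem_nestedSpan (powSeq_mul_powSeq_mem ha hb) (one_mem_nestedSpan _ 0 0)
  exact diagLimit_mem_filWL (nestedSpan_mono _ (by omega) le_rfl h)

/-- The subtracted words are the interleavings of `a` with `b, c`. What remains are the contractions
of `a` with `b` or with `c`, of length two. -/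
theorem rawBracket_singleton_mul_pair {a b c : ℕ} (ha : 0 < a) (hb : 0 < b) (hc : 0 < c) :
    rawBracket [a] * rawBracket [b, c] - rawBracket [a, b, c] - rawBracket [b, a, c] -
      rawBracket [b, c, a] ∈ filWL (a + b + c) 2 := by
  have h : nestedSum ([] : List (ℕ → ℚ⟦X⟧)) = 1 := rfl
  have e : rawBracket [a] * rawBracket [b, c] - rawBracket [a, b, c] - rawBracket [b, a, c] -
      rawBracket [b, c, a] =
      diagLimit (cumul (powSeq ℚ b) (cumul (powSeq ℚ a * powSeq ℚ c) 1)) +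
        diagLimit (cumul (powSeq ℚ a * powSeq ℚ b) (nestedSum [powSeq ℚ c])) := by
    rw [rawBracket_mul_rawBracket]
    simp only [List.map_cons, List.map_nil]
    rw [nestedSum_cons_mul_cons]
    simp only [h, one_mul]
    rw [nestedSum_singleton_mul_singleton]
    simp only [map_add, cumul_nestedSum, rawBracket, List.map_cons, List.map_nil]
    ring
  rw [e]
  refine add_mem (diagLimit_mem_filWL ?_) (diagLimit_mem_filWL ?_)
  · have h1 : powSeq ℚ b ∈ letterSpan (powSeq ℚ) b := Submodule.subset_span ⟨b, hb, le_rfl, rfl⟩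
    have h2 := cumul_mem_nestedSpan (powSeq_mul_powSeq_mem ha hc) (one_mem_nestedSpan _ 0 0)
    exact nestedSpan_mono _ (by omega) le_rfl (cumul_mem_nestedSpan h1 h2)
  · have h1 : nestedSum [powSeq ℚ c] ∈ nestedSpan (powSeq ℚ) c 1 :=
      Submodule.subset_span ⟨[c], by simpa using hc, by simp, by simp, rfl⟩
    exact cumul_mem_nestedSpan (powSeq_mul_powSeq_mem ha hb) h1

/-- Monomials in two variables, as functions. -/
def monoPair (i j : ℕ) : ℕ × ℕ → ℚ := fun p => (p.1 : ℚ) ^ i * (p.2 : ℚ) ^ j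

/-- Monomials in three variables, as functions. -/
def monoTriple (i j k : ℕ) : ℕ × ℕ × ℕ → ℚ :=
  fun p => (p.1 : ℚ) ^ i * (p.2.1 : ℚ) ^ j * (p.2.2 : ℚ) ^ k

/-- Homogeneous polynomial functions of degree `d` in two variables. -/
def homogPair (d : ℕ) : Submodule ℚ (ℕ × ℕ → ℚ) :=
  Submodule.span ℚ {F | ∃ i j, i + j = d ∧ F = monoPair i j}

/-- Homogeneous polynomial functions of degree `d` in three variables. -/
def homogTriple (d : ℕ) : Submodule ℚ (ℕ × ℕ × ℕ → ℚ) :=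
  Submodule.span ℚ {F | ∃ i j k, i + j + k = d ∧ F = monoTriple i j k}

theorem monoPair_mem {i j d : ℕ} (h : i + j = d) : monoPair i j ∈ homogPair d :=
  Submodule.subset_span ⟨i, j, h, rfl⟩

theorem monoTriple_mem {i j k d : ℕ} (h : i + j + k = d) : monoTriple i j k ∈ homogTriple d :=
  Submodule.subset_span ⟨i, j, k, h, rfl⟩

theorem homogPair_mul_mem {d e : ℕ} {F G : ℕ × ℕ → ℚ} (hF : F ∈ homogPair d)
    (hG : G ∈ homogPair e) : F * G ∈ homogPair (d + e) := by
  have h := Submodule.mul_mem_mul hF hG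
  rw [homogPair, homogPair, Submodule.span_mul_span] at h
  refine Submodule.span_le.2 ?_ h
  rintro _ ⟨_, ⟨i, j, hd, rfl⟩, _, ⟨i', j', he, rfl⟩, rfl⟩
  have e : monoPair i j * monoPair i' j' = monoPair (i + i') (j + j') := by
    ext p
    simp only [monoPair, Pi.mul_apply]
    ring
  simp only [SetLike.mem_coe, e]
  exact monoPair_mem (by omega)

theorem homogPair_pow_mem {F : ℕ × ℕ → ℚ} (hF : F ∈ homogPair 1) (n : ℕ) :
    F ^ n ∈ homogPair n := by
  induction n with
  | zero =>
    convert monoPair_mem (i := 0) (j := 0) rfl using 1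
    ext p
    simp [monoPair]
  | succ n ih => exact pow_succ F n ▸ homogPair_mul_mem ih hF

/-- Homogeneous polynomials are closed under linear substitutions. -/
theorem homogPair_comp_mem {d : ℕ} {F : ℕ × ℕ → ℚ} (hF : F ∈ homogPair d) {a b : ℕ × ℕ → ℕ}
    (ha : (fun p => (a p : ℚ)) ∈ homogPair 1) (hb : (fun p => (b p : ℚ)) ∈ homogPair 1) :
    (fun p => F (a p, b p)) ∈ homogPair d := by
  change LinearMap.funLeft ℚ ℚ (fun p => (a p, b p)) F ∈ _
  induction hF using Submodule.span_induction with
  | mem F hF =>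
    obtain ⟨i, j, rfl, rfl⟩ := hF
    exact homogPair_mul_mem (homogPair_pow_mem ha i) (homogPair_pow_mem hb j)
  | zero => simp
  | add F G _ _ hF hG => rw [map_add]; exact add_mem hF hG
  | smul c F _ hF => rw [map_smul]; exact Submodule.smul_mem _ _ hF

theorem pairSum_monoPair (i j : ℕ) : pairSum (monoPair i j) = rawBracket [i + 1, j + 1] :=
  pairSum_monomial i j

theorem tripleSum_monoTriple (i j k : ℕ) :
    tripleSum (monoTriple i j k) = rawBracket [i + 1, j + 1, k + 1] :=
  tripleSum_monomial i j k

theorem fullPairSum_sub_mem {d : ℕ} {F : ℕ × ℕ → ℚ} (hF : F ∈ homogPair d) :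
    fullPairSum F - pairSum F - pairSum (fun p => F (p.2, p.1)) ∈ filWL (d + 2) 1 := by
  change (fullPairSum - pairSum -
    pairSum ∘ₗ LinearMap.funLeft ℚ ℚ fun p : ℕ × ℕ => (p.2, p.1)) F ∈ _
  rw [← Submodule.mem_comap]
  refine Submodule.span_le.2 ?_ hF
  rintro _ ⟨i, j, rfl, rfl⟩
  have e : LinearMap.funLeft ℚ ℚ (fun p : ℕ × ℕ => (p.2, p.1)) (monoPair i j) = monoPair j i := by
    ext p
    simp only [LinearMap.funLeft_apply, monoPair]
    ring
  rw [SetLike.mem_coe, Submodule.mem_comap, LinearMap.sub_apply, LinearMap.sub_apply,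
    LinearMap.comp_apply, e, pairSum_monoPair, pairSum_monoPair]
  change fullPairSum (fun p => (p.1 : ℚ) ^ i * (p.2 : ℚ) ^ j) - _ - _ ∈ _
  rw [fullPairSum_monomial]
  convert rawBracket_singleton_mul_singleton i.succ_pos j.succ_pos using 2
  omega

theorem mixedTripleSum_sub_mem {d : ℕ} {F : ℕ × ℕ × ℕ → ℚ} (hF : F ∈ homogTriple d) :
    mixedTripleSum F - tripleSum F - tripleSum (fun p => F (p.2.1, p.1, p.2.2)) -
      tripleSum (fun p => F (p.2.2, p.1, p.2.1)) ∈ filWL (d + 3) 2 := by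
  change (mixedTripleSum - tripleSum -
    tripleSum ∘ₗ (LinearMap.funLeft ℚ ℚ fun p : ℕ × ℕ × ℕ => (p.2.1, p.1, p.2.2)) -
    tripleSum ∘ₗ (LinearMap.funLeft ℚ ℚ fun p : ℕ × ℕ × ℕ => (p.2.2, p.1, p.2.1))) F ∈ _
  rw [← Submodule.mem_comap]
  refine Submodule.span_le.2 ?_ hF
  rintro _ ⟨i, j, k, rfl, rfl⟩
  have e : LinearMap.funLeft ℚ ℚ (fun p : ℕ × ℕ × ℕ => (p.2.1, p.1, p.2.2)) (monoTriple i j k) =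
      monoTriple j i k := by
    ext p
    simp only [LinearMap.funLeft_apply, monoTriple]
    ring
  have e' : LinearMap.funLeft ℚ ℚ (fun p : ℕ × ℕ × ℕ => (p.2.2, p.1, p.2.1)) (monoTriple i j k) =
      monoTriple j k i := by
    ext p
    simp only [LinearMap.funLeft_apply, monoTriple]
    ring
  rw [SetLike.mem_coe, Submodule.mem_comap, LinearMap.sub_apply, LinearMap.sub_apply,
    LinearMap.sub_apply, LinearMap.comp_apply, LinearMap.comp_apply, e, e', tripleSum_monoTriple,
    tripleSum_monoTriple, tripleSum_monoTriple]
  change mixedTripleSum (fun p => (p.1 : ℚ) ^ i * (p.2.1 : ℚ) ^ j * (p.2.2 : ℚ) ^ k) -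
    _ - _ - _ ∈ _
  rw [mixedTripleSum_monomial]
  convert rawBracket_singleton_mul_pair i.succ_pos j.succ_pos k.succ_pos using 2
  omega

/-- The unordered sum has two expansions: quasi-shuffle (`fullPairSum_sub_mem`) and cutting by the
`v`'s (`fullPairSum_eq`). Their difference is the relation. -/
theorem pairSum_relation {d : ℕ} {F : ℕ × ℕ → ℚ} (hF : F ∈ homogPair d)
    (h : ∀ x, F (x, x) = 0) :
    pairSum (fun p => F p + F (p.2, p.1) - F (p.1 + p.2, p.1) - F (p.1, p.1 + p.2)) ∈
      filWL (d + 2) 1 := by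
  have h1 := fullPairSum_sub_mem hF
  rw [fullPairSum_eq h] at h1
  convert neg_mem h1 using 1
  have e : (fun p : ℕ × ℕ => F p + F (p.2, p.1) - F (p.1 + p.2, p.1) - F (p.1, p.1 + p.2)) =
      F + (fun p => F (p.2, p.1)) - (fun p => F (p.1 + p.2, p.1)) -
        (fun p => F (p.1, p.1 + p.2)) := rfl
  rw [e, map_sub, map_sub, map_add]
  ring

/-- The same comparison for length one times length two: three interleavings against three regions.
The weight `G` is a separate variable so that it can be supplied as an explicit combination of
monomials. -/
theorem tripleSum_relation {d : ℕ} {F G : ℕ × ℕ × ℕ → ℚ} (hF : F ∈ homogTriple d)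
    (h1 : ∀ x y, F (x, x, y) = 0) (h2 : ∀ x y, F (x + y, x, y) = 0)
    (hG : ∀ x y z, G (x, y, z) = F (x, y, z) + F (y, x, z) + F (z, x, y) - F (x + y + z, x, y) -
      F (x + y, x, y + z) - F (x, x + y, z)) :
    tripleSum G ∈ filWL (d + 3) 2 := by
  have h := mixedTripleSum_sub_mem hF
  rw [mixedTripleSum_eq h1 h2] at h
  convert neg_mem h using 1
  have e : G = F + (fun p => F (p.2.1, p.1, p.2.2)) + (fun p => F (p.2.2, p.1, p.2.1)) -
      (fun p => F (p.1 + p.2.1 + p.2.2, p.1, p.2.1)) -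
      (fun p => F (p.1 + p.2.1, p.1, p.2.1 + p.2.2)) -
      (fun p => F (p.1, p.1 + p.2.1, p.2.2)) := by
    ext ⟨x, y, z⟩
    exact hG x y z
  rw [e, map_sub, map_sub, map_sub, map_add, map_add]
  ring

end UpperBounds

/-! ### Dimension bounds from counting words, and the bound in length two. -/

noncomputable section UpperBounds

open Finset PowerSeries

theorem finrank_sup_le_finrank_add_finrank_map {K V : Type*} [Field K] [AddCommGroup V]
    [Module K V] (A N : Submodule K V) [FiniteDimensional K A] [FiniteDimensional K N] :
    Module.finrank K ↥(A ⊔ N) ≤ Module.finrank K A + Module.finrank K (N.map A.mkQ) := by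
  have h := LinearMap.finrank_range_add_finrank_ker (A.mkQ.domRestrict (A ⊔ N))
  have h1 : LinearMap.range (A.mkQ.domRestrict (A ⊔ N)) ≤ N.map A.mkQ := by
    rintro _ ⟨⟨x, hx⟩, rfl⟩
    obtain ⟨a, ha, n, hn, rfl⟩ := Submodule.mem_sup.1 hx
    refine ⟨n, hn, ?_⟩
    simp [ha]
  have h2 : Module.finrank K (LinearMap.ker (A.mkQ.domRestrict (A ⊔ N))) ≤ Module.finrank K A := by
    have hle : (LinearMap.ker (A.mkQ.domRestrict (A ⊔ N))).map (A ⊔ N).subtype ≤ A := by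
      rintro _ ⟨⟨x, hx⟩, hk, rfl⟩
      simpa using hk
    exact ((Submodule.equivMapOfInjective _ (A ⊔ N).injective_subtype _).finrank_eq).trans_le
      (Submodule.finrank_mono hle)
  have h3 := Submodule.finrank_mono h1
  omega

instance finiteDimensional_filWL (k l : ℕ) : FiniteDimensional ℚ (filWL k l) := by
  refine FiniteDimensional.span_of_finite ℚ (Set.Finite.subset
    (s := ⋃ r ∈ Set.Iic l, (bracket (l := r)) '' Set.Iic fun _ => k) ?_ ?_)
  · exact (Set.finite_Iic l).biUnion fun r _ => (Set.finite_Iic _).image _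
  · rintro _ ⟨r, s, -, h2, h3, rfl⟩
    refine Set.mem_biUnion (Set.mem_Iic.2 h3) ⟨s, fun i => ?_, rfl⟩
    exact (Finset.single_le_sum (fun _ _ => Nat.zero_le _) (mem_univ i)).trans h2

/-- The lists of `l` positive integers with sum at most `k`. -/
def words : ℕ → ℕ → List (List ℕ)
  | 0, _ => [[]]
  | l + 1, k => (List.range k).flatMap fun a => (words l (k - 1 - a)).map ((a + 1) :: ·)

theorem mem_words {s : List ℕ} {k : ℕ} (h1 : ∀ x ∈ s, 0 < x) (h2 : s.sum ≤ k) :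
    s ∈ words s.length k := by
  induction s generalizing k with
  | nil => simp [words]
  | cons a s ih =>
    have ha : 0 < a := h1 a (by simp)
    simp only [List.sum_cons] at h2
    simp only [List.length_cons, words, List.mem_flatMap, List.mem_range, List.mem_map]
    exact ⟨a - 1, by omega, s, ih (fun x hx => h1 x (by simp [hx])) (by omega),
      by rw [Nat.sub_add_cancel ha]⟩

theorem filWL_succ_le {k l : ℕ} {T : Submodule ℚ ℚ⟦X⟧} (h : filWL k l ≤ T)
    (hw : ∀ s ∈ words (l + 1) k, rawBracket s ∈ T) : filWL k (l + 1) ≤ T := by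
  rw [filWL_eq_span]
  refine Submodule.span_le.2 ?_
  rintro _ ⟨s, h1, h2, h3, rfl⟩
  rcases Nat.lt_succ_iff_lt_or_eq.1 (Nat.lt_succ_of_le h3) with h4 | h4
  · exact h (rawBracket_mem h1 h2 (Nat.le_of_lt_succ h4))
  · exact hw s (h4 ▸ mem_words h1 h2)

theorem finrank_sup_span_list_le (A : Submodule ℚ ℚ⟦X⟧) [FiniteDimensional ℚ A]
    (L : List (List ℕ)) :
    Module.finrank ℚ ↥(A ⊔ Submodule.span ℚ {f | ∃ s ∈ L, f = rawBracket s}) ≤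
      Module.finrank ℚ A + L.length := by
  classical
  have e : {f | ∃ s ∈ L, f = rawBracket s} = ((L.map rawBracket).toFinset : Set ℚ⟦X⟧) := by
    ext f
    simp [eq_comm]
  rw [e]
  refine (Submodule.finrank_add_le_finrank_add_finrank _ _).trans (Nat.add_le_add_left ?_ _)
  refine (finrank_span_finset_le_card _).trans ((List.toFinset_card_le _).trans ?_)
  simp

instance finiteDimensional_span_list (L : List (List ℕ)) :
    FiniteDimensional ℚ (Submodule.span ℚ {f | ∃ s ∈ L, f = rawBracket s}) := by
  refine FiniteDimensional.span_of_finite ℚ (Set.Finite.subset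
    (L.map rawBracket).finite_toSet ?_)
  rintro _ ⟨s, hs, rfl⟩
  exact List.mem_map_of_mem hs

theorem finrank_filWL_succ_le_of_words {k l : ℕ} (L : List (List ℕ))
    (hw : ∀ s ∈ words (l + 1) k, s ∈ L ∨
      rawBracket s ∈ filWL k l ⊔ Submodule.span ℚ {f | ∃ s ∈ L, f = rawBracket s}) :
    Module.finrank ℚ (filWL k (l + 1)) ≤ Module.finrank ℚ (filWL k l) + L.length := by
  refine (Submodule.finrank_mono (filWL_succ_le le_sup_left fun s hs => ?_)).trans
    (finrank_sup_span_list_le _ L)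
  rcases hw s hs with h | h
  · exact Submodule.mem_sup_right (Submodule.subset_span ⟨s, h, rfl⟩)
  · exact h

theorem finrank_filWL_succ_le (k l : ℕ) :
    Module.finrank ℚ (filWL k (l + 1)) ≤
      Module.finrank ℚ (filWL k l) + (words (l + 1) k).length :=
  finrank_filWL_succ_le_of_words _ fun _ hs => Or.inl hs

theorem finrank_filWL_zero_right (k : ℕ) : Module.finrank ℚ (filWL k 0) = 1 := by
  have e : filWL k 0 = Submodule.span ℚ {1} := by
    apply le_antisymm
    · rw [filWL_eq_span]
      refine Submodule.span_le.2 ?_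
      rintro _ ⟨s, -, -, h3, rfl⟩
      obtain rfl := List.eq_nil_of_length_eq_zero (Nat.le_zero.1 h3)
      refine Submodule.subset_span ?_
      ext n
      simp [rawBracket, coeff_diagLimit, nestedSum]
    · rw [Submodule.span_singleton_le_iff_mem]
      exact one_mem_filWL k 0
  rw [e, finrank_span_singleton one_ne_zero]

theorem finrank_filWL_one_right_le (k : ℕ) : Module.finrank ℚ (filWL k 1) ≤ k + 1 := by
  have h : Module.finrank ℚ (filWL k 1) ≤ Module.finrank ℚ (filWL k 0) + (words 1 k).length :=
    finrank_filWL_succ_le k 0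
  have e : (words 1 k).length = k := by simp [words, List.length_flatMap]
  rw [finrank_filWL_zero_right] at h
  omega

theorem finrank_homogPair_le (d : ℕ) : FiniteDimensional ℚ (homogPair d) ∧
    Module.finrank ℚ (homogPair d) ≤ d + 1 := by
  classical
  have e : {F | ∃ i j, i + j = d ∧ F = monoPair i j} =
      (((range (d + 1)).image fun i => monoPair i (d - i) : Finset (ℕ × ℕ → ℚ)) :
        Set (ℕ × ℕ → ℚ)) := by
    ext F
    simp only [Set.mem_ofPred_eq, coe_image, Set.mem_image, mem_coe, mem_range]
    constructor
    · rintro ⟨i, j, rfl, rfl⟩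
      exact ⟨i, by omega, by rw [Nat.add_sub_cancel_left]⟩
    · rintro ⟨i, hi, rfl⟩
      exact ⟨i, d - i, by omega, rfl⟩
  rw [homogPair, e]
  refine ⟨FiniteDimensional.span_finset ℚ _, (finrank_span_finset_le_card _).trans ?_⟩
  simpa using card_image_le (s := range (d + 1)) (f := fun i => monoPair i (d - i))

/-- Symmetric polynomials vanishing on the diagonal. -/
def symPair (d : ℕ) : (Fin (d / 2) → ℚ) →ₗ[ℚ] (ℕ × ℕ → ℚ) :=
  Fintype.linearCombination ℚ fun j : Fin (d / 2) =>
    monoPair j (d - j) + monoPair (d - j) j - monoPair (d / 2) (d - d / 2) -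
      monoPair (d - d / 2) (d / 2)

theorem symPair_apply (d : ℕ) (c : Fin (d / 2) → ℚ) (p : ℕ × ℕ) :
    symPair d c p = ∑ j, c j * (monoPair j (d - j) p + monoPair (d - j) j p -
      monoPair (d / 2) (d - d / 2) p - monoPair (d - d / 2) (d / 2) p) := by
  simp [symPair, Fintype.linearCombination_apply, Finset.sum_apply]

theorem symPair_mem (d : ℕ) (c : Fin (d / 2) → ℚ) : symPair d c ∈ homogPair d := by
  rw [symPair, Fintype.linearCombination_apply]
  refine sum_mem fun j _ => Submodule.smul_mem _ _ (sub_mem (sub_mem (add_mem ?_ ?_) ?_) ?_) <;>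
    exact monoPair_mem (by omega)

theorem symPair_swap (d : ℕ) (c : Fin (d / 2) → ℚ) (x y : ℕ) :
    symPair d c (x, y) = symPair d c (y, x) := by
  simp only [symPair_apply, monoPair]
  refine Finset.sum_congr rfl fun j _ => ?_
  ring

theorem symPair_diag (d : ℕ) (c : Fin (d / 2) → ℚ) (x : ℕ) : symPair d c (x, x) = 0 := by
  rw [symPair_apply]
  refine Finset.sum_eq_zero fun j _ => ?_
  simp only [monoPair, ← pow_add]
  rw [show (j : ℕ) + (d - j) = d by omega, show d - (j : ℕ) + j = d by omega,
    show d / 2 + (d - d / 2) = d by omega, show d - d / 2 + d / 2 = d by omega]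
  ring

/-- With symmetry the hypothesis gives `f(n+2, 1) = f(n+1, 1)`, so `f(n+1, 1) = f(1, 1) = 0` for all
`n` and the polynomial `f(x, 1)` vanishes. For `i < d / 2` the exponent `i` is below `d / 2`, `d - d
/ 2` and every `d - j`, so coefficient `i` of this polynomial is `c i`. -/
theorem symPair_eq_zero {d : ℕ} {c : Fin (d / 2) → ℚ}
    (h : ∀ x y, symPair d c (x, y) = symPair d c (x + y, x)) : c = 0 := by
  have h0 : ∀ n : ℕ, symPair d c (n + 1, 1) = 0 := by
    intro n
    induction n with
    | zero => exact symPair_diag d c 1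
    | succ n ih => rwa [symPair_swap, h, add_comm 1] at ih
  let P : Polynomial ℚ := ∑ j, Polynomial.C (c j) * (Polynomial.X ^ (j : ℕ) +
    Polynomial.X ^ (d - j) - Polynomial.X ^ (d / 2) - Polynomial.X ^ (d - d / 2))
  have hP : P = 0 := by
    refine Polynomial.eq_zero_of_infinite_isRoot P (Set.infinite_of_injective_forall_mem
      (f := fun n : ℕ => ((n + 1 : ℕ) : ℚ)) (fun a b hab => ?_) fun n => ?_)
    · simpa using hab
    · have := h0 n
      simp only [symPair_apply, monoPair, Nat.cast_one, one_pow, mul_one] at this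
      simpa [P, Polynomial.IsRoot, Polynomial.eval_finsetSum] using this
  funext i
  have hi := congrArg (fun Q => Polynomial.coeff Q (i : ℕ)) hP
  simp only [P, Polynomial.finsetSum_coeff, Polynomial.coeff_C_mul, Polynomial.coeff_sub,
    Polynomial.coeff_add, Polynomial.coeff_X_pow, Polynomial.coeff_zero] at hi
  rw [Finset.sum_eq_single i] at hi
  · have h1 := i.2
    rw [if_pos rfl, if_neg (by omega), if_neg (by omega), if_neg (by omega)] at hi
    simpa using hi
  · intro j _ hj
    have h1 := i.2
    have h2 := j.2
    rw [if_neg (fun e => hj (Fin.ext e.symm)), if_neg (by omega), if_neg (by omega),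
      if_neg (by omega)]
    simp
  · simp

/-- The operator of the double sum relation. -/
def pairRelator : (ℕ × ℕ → ℚ) →ₗ[ℚ] (ℕ × ℕ → ℚ) :=
  LinearMap.id + LinearMap.funLeft ℚ ℚ (fun p : ℕ × ℕ => (p.2, p.1)) -
    LinearMap.funLeft ℚ ℚ (fun p : ℕ × ℕ => (p.1 + p.2, p.1)) -
    LinearMap.funLeft ℚ ℚ (fun p : ℕ × ℕ => (p.1, p.1 + p.2))

theorem pairRelator_mem {d : ℕ} {F : ℕ × ℕ → ℚ} (hF : F ∈ homogPair d) :
    pairRelator F ∈ homogPair d := by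
  have hx : (fun p : ℕ × ℕ => (p.1 : ℚ)) ∈ homogPair 1 := by
    convert monoPair_mem (i := 1) (j := 0) rfl using 1
    ext p
    simp [monoPair]
  have hy : (fun p : ℕ × ℕ => (p.2 : ℚ)) ∈ homogPair 1 := by
    convert monoPair_mem (i := 0) (j := 1) rfl using 1
    ext p
    simp [monoPair]
  have hxy : (fun p : ℕ × ℕ => ((p.1 + p.2 : ℕ) : ℚ)) ∈ homogPair 1 := by
    convert add_mem hx hy using 1
    ext p
    simp
  exact sub_mem (sub_mem (add_mem hF (homogPair_comp_mem hF hy hx))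
    (homogPair_comp_mem hF hxy hx)) (homogPair_comp_mem hF hx hxy)

/-- The `d + 1` monomials are subject to the relations `pairRelator f` with `f` symmetric and zero
on the diagonal, a space of dimension `d / 2`. No relation is lost: for symmetric `f`, `pairRelator
f = 0` says `f(x, y) = f(x+y, x)`, and `symPair_eq_zero` applies. -/
theorem finrank_map_pairSum_le (d : ℕ) (A : Submodule ℚ ℚ⟦X⟧) (hA : filWL (d + 2) 1 ≤ A) :
    Module.finrank ℚ (((homogPair d).map pairSum).map A.mkQ) ≤ d + 1 - d / 2 := by
  have := (finrank_homogPair_le d).1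
  have h := LinearMap.finrank_range_add_finrank_ker ((A.mkQ ∘ₗ pairSum).domRestrict (homogPair d))
  have e : LinearMap.range ((A.mkQ ∘ₗ pairSum).domRestrict (homogPair d)) =
      ((homogPair d).map pairSum).map A.mkQ := by
    rw [LinearMap.range_domRestrict, Submodule.map_comp]
  rw [e] at h
  let g : (Fin (d / 2) → ℚ) →ₗ[ℚ]
      LinearMap.ker ((A.mkQ ∘ₗ pairSum).domRestrict (homogPair d)) :=
    LinearMap.codRestrict _ (LinearMap.codRestrict (homogPair d) (pairRelator ∘ₗ symPair d)
      fun c => pairRelator_mem (symPair_mem d c)) fun c => by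
        rw [LinearMap.mem_ker]
        change A.mkQ (pairSum (pairRelator (symPair d c))) = 0
        rw [Submodule.mkQ_apply, Submodule.Quotient.mk_eq_zero]
        exact hA (pairSum_relation (symPair_mem d c) (symPair_diag d c))
  have hg : Function.Injective g := by
    rw [injective_iff_map_eq_zero]
    intro c hc
    have hc' : pairRelator (symPair d c) = 0 := congrArg (fun z => (z.1.1 : ℕ × ℕ → ℚ)) hc
    refine symPair_eq_zero fun x y => ?_
    have hxy : symPair d c (x, y) + symPair d c (y, x) - symPair d c (x + y, x) -
      symPair d c (x, x + y) = 0 := congrFun hc' (x, y)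
    rw [← symPair_swap d c x y, symPair_swap d c x (x + y)] at hxy
    linarith
  have h1 := LinearMap.finrank_le_finrank_of_injective hg
  have h2 := (finrank_homogPair_le d).2
  simp only [Module.finrank_fintype_fun_eq_card, Fintype.card_fin] at h1
  omega

/-- Beyond weight `d + 1`, the new brackets are the single `[d + 2]` and those of length two, which
are counted modulo it and everything of lower weight. -/
theorem finrank_filWL_add_two_two_le (d : ℕ) :
    Module.finrank ℚ (filWL (d + 2) 2) ≤
      Module.finrank ℚ (filWL (d + 1) 2) + 1 + (d + 1 - d / 2) := by
  set A := filWL (d + 1) 2 ⊔ Submodule.span ℚ {f | ∃ s ∈ [[d + 2]], f = rawBracket s} with hA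
  have h1 : filWL (d + 2) 1 ≤ A := by
    rw [filWL_eq_span]
    refine Submodule.span_le.2 ?_
    rintro _ ⟨s, h1, h2, h3, rfl⟩
    by_cases h : s.sum ≤ d + 1
    · exact Submodule.mem_sup_left (rawBracket_mem h1 h (by omega))
    · refine Submodule.mem_sup_right (Submodule.subset_span ⟨s, ?_, rfl⟩)
      match s, h3 with
      | [], _ => simp at h
      | [a], _ =>
        simp only [List.sum_cons, List.sum_nil] at h h2
        simp only [List.mem_singleton, List.cons.injEq, and_true]
        omega
  have h2 : filWL (d + 2) 2 ≤ A ⊔ (homogPair d).map pairSum := by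
    rw [filWL_eq_span]
    refine Submodule.span_le.2 ?_
    rintro _ ⟨s, h1', h2, h3, rfl⟩
    by_cases h : s.sum ≤ d + 1
    · exact Submodule.mem_sup_left (Submodule.mem_sup_left (rawBracket_mem h1' h (by omega)))
    by_cases h' : s.length ≤ 1
    · exact Submodule.mem_sup_left (h1 (rawBracket_mem h1' h2 h'))
    · refine Submodule.mem_sup_right ?_
      match s, h3, h' with
      | [a, b], _, _ =>
        simp only [List.sum_cons, List.sum_nil] at h h2
        have ha : 0 < a := h1' a (by simp)
        have hb : 0 < b := h1' b (by simp)
        refine ⟨monoPair (a - 1) (b - 1), monoPair_mem (by omega), ?_⟩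
        rw [pairSum_monoPair, Nat.sub_add_cancel ha, Nat.sub_add_cancel hb]
      | [], _, h' => simp at h'
      | [a], _, h' => simp at h'
  have := (finrank_homogPair_le d).1
  have h3 := Submodule.finrank_mono h2
  have h4 := finrank_sup_le_finrank_add_finrank_map A ((homogPair d).map pairSum)
  have h5 := finrank_map_pairSum_le d A h1
  have h6 := finrank_sup_span_list_le (filWL (d + 1) 2) [[d + 2]]
  rw [← hA] at h6
  simp only [List.length_singleton] at h6
  omega

theorem finrank_filWL_two_right_le (k : ℕ) :
    Module.finrank ℚ (filWL (k + 1) 2) ≤ 2 + k + ∑ d ∈ range k, (d + 1 - d / 2) := by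
  induction k with
  | zero =>
    have h1 := finrank_filWL_one_right_le 1
    have h2 : Module.finrank ℚ (filWL 1 2) ≤ Module.finrank ℚ (filWL 1 1) + (words 2 1).length :=
      finrank_filWL_succ_le 1 1
    have e : (words 2 1).length = 0 := by decide
    simp only [range_zero, sum_empty]
    change Module.finrank ℚ (filWL 1 2) ≤ _
    omega
  | succ k ih =>
    have h : Module.finrank ℚ (filWL (k + 1 + 1) 2) ≤ _ := finrank_filWL_add_two_two_le k
    rw [sum_range_succ]
    omega

end UpperBounds

/-! ### Relations in length three and the table of upper bounds. -/

noncomputable section UpperBounds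

open Finset PowerSeries

theorem rawBracket_three_one_mem :
    (2 : ℚ) • rawBracket [3, 1] - (4 : ℚ) • rawBracket [2, 2] ∈ filWL 4 1 := by
  -- The weight is `F = (x - y)²`.
  have hF : monoPair 2 0 + monoPair 0 2 - (2 : ℚ) • monoPair 1 1 ∈ homogPair 2 :=
    sub_mem (add_mem (monoPair_mem rfl) (monoPair_mem rfl))
      (Submodule.smul_mem _ _ (monoPair_mem rfl))
  have h := pairSum_relation hF fun x => by simp [monoPair]; ring
  rw [show (fun p : ℕ × ℕ => _ + _ - _ - _) =
    (2 : ℚ) • monoPair 2 0 - (4 : ℚ) • monoPair 1 1 by ext p; simp [monoPair]; ring] at h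
  simpa only [map_sub, map_smul, pairSum_monoPair] using h

/-- Multiplication of the relation in weight four by a bracket of length one. -/
theorem rawBracket_three_one_mul_mem {a : ℕ} (ha : 0 < a) :
    (2 : ℚ) • (rawBracket [a, 3, 1] + rawBracket [3, a, 1] + rawBracket [3, 1, a]) -
      (4 : ℚ) • (rawBracket [a, 2, 2] + rawBracket [2, a, 2] + rawBracket [2, 2, a]) ∈
        filWL (a + 4) 2 := by
  have h1 := mul_mem_filWL (rawBracket_mem (s := [a]) (k := a) (l := 1) (by simpa using ha)
    (by simp) (by simp)) rawBracket_three_one_mem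
  have h2 := rawBracket_singleton_mul_pair (b := 3) (c := 1) ha (by simp) (by simp)
  have h3 := rawBracket_singleton_mul_pair (b := 2) (c := 2) ha (by simp) (by simp)
  have h4 := add_mem (sub_mem h1 (Submodule.smul_mem _ (2 : ℚ) h2))
    (Submodule.smul_mem _ (4 : ℚ) h3)
  convert h4 using 1
  simp only [mul_sub, mul_smul_comm]
  module

/-- The product of the two wall equations, `F = (x - y)(x - y - z)`, satisfies both vanishing
conditions. The three cubic relations that follow use `F` times `z`, `y` and `x`. -/
theorem tripleSum_relation_quadratic :
    (3 : ℚ) • rawBracket [3, 1, 1] - (3 : ℚ) • rawBracket [2, 2, 1] + rawBracket [1, 3, 1] -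
      (2 : ℚ) • rawBracket [2, 1, 2] - (2 : ℚ) • rawBracket [1, 2, 2] ∈ filWL 5 2 := by
  have h := tripleSum_relation
    (F := monoTriple 2 0 0 - (2 : ℚ) • monoTriple 1 1 0 - monoTriple 1 0 1 + monoTriple 0 2 0 +
      monoTriple 0 1 1)
    (G := (3 : ℚ) • monoTriple 2 0 0 - (3 : ℚ) • monoTriple 1 1 0 + monoTriple 0 2 0 -
      (2 : ℚ) • monoTriple 1 0 1 - (2 : ℚ) • monoTriple 0 1 1) (d := 2)
    (by
      refine add_mem (add_mem (sub_mem (sub_mem ?_ (Submodule.smul_mem _ _ ?_)) ?_) ?_) ?_ <;>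
        exact monoTriple_mem rfl)
    (fun x y => by simp [monoTriple]; ring)
    (fun x y => by simp [monoTriple]; ring)
    (fun x y z => by simp [monoTriple]; ring)
  simpa only [map_sub, map_add, map_smul, tripleSum_monoTriple] using h

theorem tripleSum_relation_cubic_right :
    (2 : ℚ) • rawBracket [3, 1, 2] - (6 : ℚ) • rawBracket [2, 2, 2] + rawBracket [3, 2, 1] +
      rawBracket [2, 3, 1] ∈ filWL 6 2 := by
  have h := tripleSum_relation
    (F := monoTriple 2 0 1 - (2 : ℚ) • monoTriple 1 1 1 - monoTriple 1 0 2 + monoTriple 0 2 1 +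
      monoTriple 0 1 2)
    (G := (2 : ℚ) • monoTriple 2 0 1 - (6 : ℚ) • monoTriple 1 1 1 + monoTriple 2 1 0 +
      monoTriple 1 2 0) (d := 3)
    (by
      refine add_mem (add_mem (sub_mem (sub_mem ?_ (Submodule.smul_mem _ _ ?_)) ?_) ?_) ?_ <;>
        exact monoTriple_mem rfl)
    (fun x y => by simp [monoTriple]; ring)
    (fun x y => by simp [monoTriple]; ring)
    (fun x y z => by simp [monoTriple]; ring)
  simpa only [map_sub, map_add, map_smul, tripleSum_monoTriple] using h

theorem tripleSum_relation_cubic_middle :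
    (2 : ℚ) • rawBracket [4, 1, 1] - (2 : ℚ) • rawBracket [2, 3, 1] -
      (4 : ℚ) • rawBracket [2, 2, 2] - rawBracket [3, 1, 2] ∈ filWL 6 2 := by
  have h := tripleSum_relation
    (F := monoTriple 2 1 0 - (2 : ℚ) • monoTriple 1 2 0 - monoTriple 1 1 1 + monoTriple 0 3 0 +
      monoTriple 0 2 1)
    (G := (2 : ℚ) • monoTriple 3 0 0 - (2 : ℚ) • monoTriple 1 2 0 -
      (4 : ℚ) • monoTriple 1 1 1 - monoTriple 2 0 1) (d := 3)
    (by
      refine add_mem (add_mem (sub_mem (sub_mem ?_ (Submodule.smul_mem _ _ ?_)) ?_) ?_) ?_ <;>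
        exact monoTriple_mem rfl)
    (fun x y => by simp [monoTriple]; ring)
    (fun x y => by simp [monoTriple]; ring)
    (fun x y z => by simp [monoTriple]; ring)
  simpa only [map_sub, map_add, map_smul, tripleSum_monoTriple] using h

theorem tripleSum_relation_cubic_left :
    rawBracket [4, 1, 1] - rawBracket [3, 2, 1] - (2 : ℚ) • rawBracket [2, 3, 1] +
      (2 : ℚ) • rawBracket [2, 2, 2] + rawBracket [1, 4, 1] - rawBracket [1, 3, 2] -
      (3 : ℚ) • rawBracket [2, 1, 3] - (3 : ℚ) • rawBracket [1, 2, 3] ∈ filWL 6 2 := by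
  have h := tripleSum_relation
    (F := monoTriple 3 0 0 - (2 : ℚ) • monoTriple 2 1 0 - monoTriple 2 0 1 + monoTriple 1 2 0 +
      monoTriple 1 1 1)
    (G := monoTriple 3 0 0 - monoTriple 2 1 0 - (2 : ℚ) • monoTriple 1 2 0 +
      (2 : ℚ) • monoTriple 1 1 1 + monoTriple 0 3 0 - monoTriple 0 2 1 -
      (3 : ℚ) • monoTriple 1 0 2 - (3 : ℚ) • monoTriple 0 1 2) (d := 3)
    (by
      refine add_mem (add_mem (sub_mem (sub_mem ?_ (Submodule.smul_mem _ _ ?_)) ?_) ?_) ?_ <;>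
        exact monoTriple_mem rfl)
    (fun x y => by simp [monoTriple]; ring)
    (fun x y => by simp [monoTriple]; ring)
    (fun x y z => by simp [monoTriple]; ring)
  simpa only [map_sub, map_add, map_smul, tripleSum_monoTriple] using h

/-- Modulo `T` the quadratic relation and the weight four relation times `[1]` are two linear
equations in the two classes sought. Their matrix is invertible, and its inverse gives the
coefficients below. -/
theorem rawBracket_mem_of_weight_five {T : Submodule ℚ ℚ⟦X⟧} (hT : filWL 5 2 ≤ T)
    (hL : ∀ s ∈ [[1, 2, 2], [2, 1, 2], [3, 1, 1]], rawBracket s ∈ T) :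
    ∀ s ∈ [[1, 3, 1], [2, 2, 1]], rawBracket s ∈ T := by
  replace hT : ∀ f ∈ filWL 5 2, T.mkQ f = 0 := fun f hf =>
    (Submodule.Quotient.mk_eq_zero T).2 (hT hf)
  replace hL : ∀ s ∈ [[1, 2, 2], [2, 1, 2], [3, 1, 1]], T.mkQ (rawBracket s) = 0 := fun s hs =>
    (Submodule.Quotient.mk_eq_zero T).2 (hL s hs)
  have h1 := hT _ tripleSum_relation_quadratic
  have h2 := hT _ (rawBracket_three_one_mul_mem (a := 1) one_pos)
  simp only [map_sub, map_add, map_smul, hL [1, 2, 2] (by decide), hL [2, 1, 2] (by decide),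
    hL [3, 1, 1] (by decide)] at h1 h2
  intro s hs
  simp only [List.mem_cons, List.not_mem_nil, or_false] at hs
  rcases hs with rfl | rfl <;> rw [← Submodule.Quotient.mk_eq_zero T, ← Submodule.mkQ_apply]
  · linear_combination (norm := module) (-2 : ℚ) • h1 + (3 / 2 : ℚ) • h2
  · linear_combination (norm := module) (-1 : ℚ) • h1 + (1 / 2 : ℚ) • h2

/-- Four unknown classes, and four independent equations: the cubic relations and the weight four
relation times `[2]`. -/
theorem rawBracket_mem_of_weight_six {T : Submodule ℚ ℚ⟦X⟧} (hT : filWL 6 2 ≤ T)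
    (hL : ∀ s ∈ [[4, 1, 1], [3, 2, 1], [2, 1, 3], [1, 2, 3], [1, 3, 2]], rawBracket s ∈ T) :
    ∀ s ∈ [[1, 4, 1], [2, 2, 2], [2, 3, 1], [3, 1, 2]], rawBracket s ∈ T := by
  replace hT : ∀ f ∈ filWL 6 2, T.mkQ f = 0 := fun f hf =>
    (Submodule.Quotient.mk_eq_zero T).2 (hT hf)
  replace hL : ∀ s ∈ [[4, 1, 1], [3, 2, 1], [2, 1, 3], [1, 2, 3], [1, 3, 2]],
      T.mkQ (rawBracket s) = 0 := fun s hs => (Submodule.Quotient.mk_eq_zero T).2 (hL s hs)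
  have h1 := hT _ tripleSum_relation_cubic_right
  have h2 := hT _ tripleSum_relation_cubic_middle
  have h3 := hT _ tripleSum_relation_cubic_left
  have h4 := hT _ (rawBracket_three_one_mul_mem (a := 2) two_pos)
  simp only [map_sub, map_add, map_smul, hL [4, 1, 1] (by decide), hL [3, 2, 1] (by decide),
    hL [2, 1, 3] (by decide), hL [1, 2, 3] (by decide), hL [1, 3, 2] (by decide)] at h1 h2 h3 h4
  intro s hs
  simp only [List.mem_cons, List.not_mem_nil, or_false] at hs
  rcases hs with rfl | rfl | rfl | rfl <;>
    rw [← Submodule.Quotient.mk_eq_zero T, ← Submodule.mkQ_apply]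
  · linear_combination (norm := module)
      h3 - (5 / 8 : ℚ) • h2 + (17 / 16 : ℚ) • h4 - (11 / 8 : ℚ) • h1
  · linear_combination (norm := module)
      (-1 / 16 : ℚ) • h2 - (3 / 32 : ℚ) • h4 + (1 / 16 : ℚ) • h1
  · linear_combination (norm := module)
      (-3 / 8 : ℚ) • h2 + (7 / 16 : ℚ) • h4 - (5 / 8 : ℚ) • h1
  · linear_combination (norm := module) h1 - (1 / 2 : ℚ) • h4

/-- There are ten words of length three and weight at most five; two of weight five are redundant.
-/
theorem finrank_filWL_five_three_le :
    Module.finrank ℚ (filWL 5 3) ≤ Module.finrank ℚ (filWL 5 2) + 8 := by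
  let L : List (List ℕ) := [[1, 1, 1], [1, 1, 2], [1, 2, 1], [2, 1, 1], [1, 1, 3], [1, 2, 2],
    [2, 1, 2], [3, 1, 1]]
  refine finrank_filWL_succ_le_of_words (l := 2) L fun s hs => ?_
  have hL : ∀ s ∈ L, rawBracket s ∈ filWL 5 2 ⊔ Submodule.span ℚ {f | ∃ s ∈ L, f = rawBracket s} :=
    fun s hs => Submodule.mem_sup_right (Submodule.subset_span ⟨s, hs, rfl⟩)
  by_cases h : s ∈ [[1, 3, 1], [2, 2, 1]]
  · exact Or.inr (rawBracket_mem_of_weight_five le_sup_left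
      (fun s hs => hL s (by revert s; decide)) s h)
  · left
    revert s
    decide

/-- Of the twenty words of length three and weight at most six, two of weight five and four of
weight six are redundant. -/
theorem finrank_filWL_six_three_le :
    Module.finrank ℚ (filWL 6 3) ≤ Module.finrank ℚ (filWL 6 2) + 14 := by
  let L : List (List ℕ) := [[1, 1, 1], [1, 1, 2], [1, 2, 1], [2, 1, 1], [1, 1, 3], [1, 2, 2],
    [2, 1, 2], [3, 1, 1], [4, 1, 1], [3, 2, 1], [2, 1, 3], [1, 2, 3], [1, 3, 2], [1, 1, 4]]
  refine finrank_filWL_succ_le_of_words (l := 2) L fun s hs => ?_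
  have hL : ∀ s ∈ L, rawBracket s ∈ filWL 6 2 ⊔ Submodule.span ℚ {f | ∃ s ∈ L, f = rawBracket s} :=
    fun s hs => Submodule.mem_sup_right (Submodule.subset_span ⟨s, hs, rfl⟩)
  by_cases h : s ∈ [[1, 3, 1], [2, 2, 1]]
  · exact Or.inr (rawBracket_mem_of_weight_five
      ((filWL_mono (by norm_num) le_rfl).trans le_sup_left)
      (fun s hs => hL s (by revert s; decide)) s h)
  by_cases h' : s ∈ [[1, 4, 1], [2, 2, 2], [2, 3, 1], [3, 1, 2]]
  · exact Or.inr (rawBracket_mem_of_weight_six le_sup_left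
      (fun s hs => hL s (by revert s; decide)) s h')
  · left
    revert s
    decide

/-- The upper bounds for the exact entries of the table. -/
theorem finrank_filWL_le_of_mem_table : ∀ t ∈ ([
      (0, [1]),
      (1, [1, 2]),
      (2, [1, 3, 4]),
      (3, [1, 4, 7, 8]),
      (4, [1, 5, 10, 14, 15]),
      (5, [1, 6, 14, 22, 27, 28]),
      (6, [1, 7, 18, 32]),
      (7, [1, 8, 23]),
      (8, [1, 9, 28]),
      (9, [1, 10, 34]),
      (10, [1, 11, 40]),
      (11, [1, 12, 47]),
      (12, [1, 13, 54]),
      (13, [1, 14, 62]),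
      (14, [1, 15, 70]),
      (15, [1, 16, 79])] : List (ℕ × List ℕ)),
      ∀ (l : ℕ) (hl : l < t.2.length), Module.finrank ℚ (filWL t.1 l) ≤ t.2[l] := by
  have h0 : ∀ k, Module.finrank ℚ (filWL k 0) ≤ 1 := fun k => (finrank_filWL_zero_right k).le
  have h1 := finrank_filWL_one_right_le
  have h2 : ∀ k d, 2 + k + ∑ d ∈ range k, (d + 1 - d / 2) = d →
      Module.finrank ℚ (filWL (k + 1) 2) ≤ d := fun k d h => h ▸ finrank_filWL_two_right_le k
  have hw : ∀ k l c d e, (words (l + 1) k).length = c → Module.finrank ℚ (filWL k l) ≤ d →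
      d + c = e → Module.finrank ℚ (filWL k (l + 1)) ≤ e := fun k l c d e hc hd he => by
    have := finrank_filWL_succ_le k l
    omega
  -- Except in `h53` and `h63`, counting all words of the new length is enough.
  have h33 := hw 3 2 1 7 8 (by decide) (h2 2 7 (by decide)) rfl
  have h43 := hw 4 2 4 10 14 (by decide) (h2 3 10 (by decide)) rfl
  have h44 := hw 4 3 1 14 15 (by decide) h43 rfl
  have h53 : Module.finrank ℚ (filWL 5 3) ≤ 22 :=
    finrank_filWL_five_three_le.trans (Nat.add_le_add_right (h2 4 14 (by decide)) 8)
  have h54 := hw 5 3 5 22 27 (by decide) h53 rfl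
  have h55 := hw 5 4 1 27 28 (by decide) h54 rfl
  have h63 : Module.finrank ℚ (filWL 6 3) ≤ 32 :=
    finrank_filWL_six_three_le.trans (Nat.add_le_add_right (h2 5 18 (by decide)) 14)
  simp only [List.forall_mem_cons, List.not_mem_nil, false_imp_iff, implies_true, and_true]
  have key : ∀ (L : List ℕ) (k : ℕ), (∀ p ∈ L.zipIdx, Module.finrank ℚ (filWL k p.2) ≤ p.1) →
      ∀ (l : ℕ) (hl : l < L.length), Module.finrank ℚ (filWL k l) ≤ L[l] := fun L k h l hl =>
    h (L[l], l) (List.mk_mem_zipIdx_iff_getElem?.2 (List.getElem?_eq_getElem hl))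
  refine ⟨?_, ?_, ?_, ?_, ?_, ?_, ?_, ?_, ?_, ?_, ?_, ?_, ?_, ?_, ?_, ?_⟩ <;>
    refine key _ _ ?_ <;>
    simp only [List.zipIdx_cons, List.zipIdx_nil, List.forall_mem_cons, List.not_mem_nil,
      false_imp_iff, implies_true, and_true, zero_add, Nat.reduceAdd]
  · exact h0 0
  · exact ⟨h0 1, h1 1⟩
  · exact ⟨h0 2, h1 2, h2 1 4 (by decide)⟩
  · exact ⟨h0 3, h1 3, h2 2 7 (by decide), h33⟩
  · exact ⟨h0 4, h1 4, h2 3 10 (by decide), h43, h44⟩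
  · exact ⟨h0 5, h1 5, h2 4 14 (by decide), h53, h54, h55⟩
  · exact ⟨h0 6, h1 6, h2 5 18 (by decide), h63⟩
  · exact ⟨h0 7, h1 7, h2 6 23 (by decide)⟩
  · exact ⟨h0 8, h1 8, h2 7 28 (by decide)⟩
  · exact ⟨h0 9, h1 9, h2 8 34 (by decide)⟩
  · exact ⟨h0 10, h1 10, h2 9 40 (by decide)⟩
  · exact ⟨h0 11, h1 11, h2 10 47 (by decide)⟩
  · exact ⟨h0 12, h1 12, h2 11 54 (by decide)⟩
  · exact ⟨h0 13, h1 13, h2 12 62 (by decide)⟩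
  · exact ⟨h0 14, h1 14, h2 13 70 (by decide)⟩
  · exact ⟨h0 15, h1 15, h2 14 79 (by decide)⟩

end UpperBounds

/-! ### Polynomials over `ZMod 31` packed into natural numbers. -/

noncomputable section Packing

open Finset Polynomial

/-- The number whose `N` lowest digits in base `2 ^ 20` are all equal to `m`. -/
def repdigit (N m : ℕ) : ℕ :=
  Nat.mul m (Nat.div (Nat.sub (Nat.pow 2 (Nat.mul 20 N)) 1) 1048575)

/-- One step of the reduction modulo `31` of all digits: `a + 2 ^ e * b` becomes `a + b`, where `M`
is the mask of the lowest `e` bits of the digits. -/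
def foldStep (e M x : ℕ) : ℕ :=
  Nat.add (Nat.land x M) (Nat.shiftRight (Nat.sub x (Nat.land x M)) e)

/-- The reduction modulo `31` of all digits, to residues that are at most `33`. -/
def foldDigits (M10 M5 x : ℕ) : ℕ := foldStep 5 M5 (foldStep 5 M5 (foldStep 10 M10 x))

/-- The digits of `x` in base `2 ^ 20` are at most `M`, there are at most `N` of them, and they
reduce modulo `31` to the coefficients of `p`. -/
def Packs (N M x : ℕ) (p : (ZMod 31)[X]) : Prop :=
  ∃ P : ℕ[X], P.eval 1048576 = x ∧ (∀ i, P.coeff i ≤ M) ∧ (∀ i, N ≤ i → P.coeff i = 0) ∧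
    P.map (Nat.castRingHom (ZMod 31)) = p

theorem repdigit_eq (N m : ℕ) : repdigit N m = ∑ i ∈ range N, m * 1048576 ^ i := by
  have h := Nat.geomSum_eq (m := 1048576) (by norm_num) N
  rw [← Finset.mul_sum, h]
  change m * ((2 ^ (20 * N) - 1) / 1048575) = _
  rw [pow_mul, show (2 : ℕ) ^ 20 = 1048576 by norm_num]

theorem land_add_mul {a c : ℕ} (ha : a < 1048576) (hc : c < 1048576) (b d : ℕ) :
    (a + 1048576 * b) &&& (c + 1048576 * d) = (a &&& c) + 1048576 * (b &&& d) := by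
  have h : a &&& c < 2 ^ 20 := lt_of_le_of_lt Nat.and_le_left ha
  change a < 2 ^ 20 at ha
  change c < 2 ^ 20 at hc
  change (a + 2 ^ 20 * b) &&& (c + 2 ^ 20 * d) = (a &&& c) + 2 ^ 20 * (b &&& d)
  refine Nat.eq_of_testBit_eq fun j => ?_
  rw [add_comm a, add_comm c, add_comm (a &&& c), Nat.testBit_and,
    Nat.testBit_two_pow_mul_add _ ha, Nat.testBit_two_pow_mul_add _ hc,
    Nat.testBit_two_pow_mul_add _ h]
  split_ifs <;> simp

theorem eval_eq_coeff_zero_add (P : ℕ[X]) (b : ℕ) : P.eval b = P.coeff 0 + b * P.divX.eval b := by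
  conv_lhs => rw [← Polynomial.divX_mul_X_add P]
  simp
  ring

theorem land_repdigit {m : ℕ} (hm : m < 1048576) (N : ℕ) (P : ℕ[X])
    (hP : ∀ i, P.coeff i < 1048576) : Nat.land (P.eval 1048576) (repdigit N m) =
      ∑ i ∈ range N, (P.coeff i &&& m) * 1048576 ^ i := by
  change P.eval 1048576 &&& repdigit N m = _
  rw [repdigit_eq]
  induction N generalizing P with
  | zero => simp
  | succ N ih =>
    rw [eval_eq_coeff_zero_add, Finset.sum_range_succ', Finset.sum_range_succ']
    have e : ∀ f : ℕ → ℕ, ∑ i ∈ range N, f i * 1048576 ^ (i + 1) + f 0 * 1048576 ^ 0 =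
        f 0 + 1048576 * ∑ i ∈ range N, f i * 1048576 ^ i := by
      intro f
      rw [Finset.mul_sum, add_comm, pow_zero, mul_one]
      congr 1
      exact Finset.sum_congr rfl fun i _ => by ring
    have e1 := e fun _ => m
    rw [e1, land_add_mul (hP 0) hm, ih P.divX fun i => by rw [coeff_divX]; exact hP _,
      Finset.mul_sum, add_comm, pow_zero, mul_one]
    congr 1
    refine Finset.sum_congr rfl fun i _ => ?_
    rw [coeff_divX]
    ring

theorem coeff_sum_monomial {R : Type*} [Semiring R] (N : ℕ) (c : ℕ → R) (j : ℕ) :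
    (∑ i ∈ range N, monomial i (c i)).coeff j = if j < N then c j else 0 := by
  simp [finsetSum_coeff, coeff_monomial]

theorem packs_sum {N M : ℕ} {c : ℕ → ℕ} (hc : ∀ i < N, c i ≤ M) :
    Packs N M (∑ i ∈ range N, c i * 1048576 ^ i) (∑ i ∈ range N, monomial i (c i : ZMod 31)) := by
  refine ⟨∑ i ∈ range N, monomial i (c i), ?_, fun i => ?_, fun i hi => ?_, ?_⟩
  · simp [eval_finsetSum]
  · rw [coeff_sum_monomial]
    split_ifs with h
    exacts [hc i h, Nat.zero_le _]
  · rw [coeff_sum_monomial, if_neg (by omega)]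
  · simp [Polynomial.map_sum]

theorem eval_eq_sum_range_of_coeff {P : ℕ[X]} {N : ℕ} (h : ∀ i, N ≤ i → P.coeff i = 0) (b : ℕ) :
    P.eval b = ∑ i ∈ range N, P.coeff i * b ^ i := by
  rw [eval_eq_sum_range' (lt_of_le_of_lt le_rfl (Nat.lt_succ_of_le (le_max_left P.natDegree N)))]
  refine (Finset.sum_subset (fun i hi => ?_) fun i _ hi => ?_).symm
  · simp only [mem_range] at hi ⊢
    omega
  · rw [h i (by simpa using hi), zero_mul]

theorem eq_sum_monomial_of_coeff {R : Type*} [Semiring R] {p : R[X]} {N : ℕ} {c : ℕ → R}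
    (h : ∀ i, N ≤ i → p.coeff i = 0) (hc : ∀ i < N, c i = p.coeff i) :
    ∑ i ∈ range N, monomial i (c i) = p := by
  ext j
  rw [coeff_sum_monomial]
  split_ifs with hj
  · exact hc j hj
  · exact (h j (by omega)).symm

namespace Packs

variable {N M M' x y : ℕ} {p q : (ZMod 31)[X]}

theorem mono (h : Packs N M x p) (hM : M ≤ M') : Packs N M' x p := by
  obtain ⟨P, h1, h2, h3, h4⟩ := h
  exact ⟨P, h1, fun i => (h2 i).trans hM, h3, h4⟩

theorem zero : Packs N M 0 0 := ⟨0, by simp, by simp, by simp, by simp⟩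

theorem add (hx : Packs N M x p) (hy : Packs N M' y q) :
    Packs N (M + M') (Nat.add x y) (p + q) := by
  obtain ⟨P, rfl, h2, h3, rfl⟩ := hx
  obtain ⟨Q, rfl, h2', h3', rfl⟩ := hy
  refine ⟨P + Q, by simp, fun i => ?_, fun i hi => ?_, by simp⟩
  · rw [coeff_add]
    exact add_le_add (h2 i) (h2' i)
  · rw [coeff_add, h3 i hi, h3' i hi]

theorem smul (c : ℕ) (hx : Packs N M x p) :
    Packs N (c * M) (Nat.mul c x) ((c : ZMod 31) • p) := by
  obtain ⟨P, rfl, h2, h3, rfl⟩ := hx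
  refine ⟨C c * P, by simp, fun i => ?_, fun i hi => ?_, ?_⟩
  · rw [coeff_C_mul]
    exact Nat.mul_le_mul_left _ (h2 i)
  · rw [coeff_C_mul, h3 i hi, mul_zero]
  · simp [smul_eq_C_mul]

/-- A digit of the product is a sum of at most `N` products of digits. With digits at most 33 and `N
≤ 960` it is at most `960 * 33 ^ 2 < 2 ^ 20`, so there is no carry. -/
theorem mul (hx : Packs N M x p) (hy : Packs N M' y q) :
    Packs (2 * N) (N * (M * M')) (Nat.mul x y) (p * q) := by
  obtain ⟨P, rfl, h2, h3, rfl⟩ := hx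
  obtain ⟨Q, rfl, h2', h3', rfl⟩ := hy
  refine ⟨P * Q, by simp, fun i => ?_, fun i hi => ?_, by simp⟩
  · rw [coeff_mul, Finset.Nat.sum_antidiagonal_eq_sum_range_succ fun a b => P.coeff a * Q.coeff b]
    calc ∑ k ∈ range (i + 1), P.coeff k * Q.coeff (i - k)
        ≤ ∑ k ∈ range N, M * M' := by
          rw [← Finset.sum_filter_of_ne (p := fun k => k < N) (fun k _ h => by
            by_contra hk
            exact h (by rw [h3 k (by omega), zero_mul]))]
          refine (Finset.sum_le_sum fun k _ => Nat.mul_le_mul (h2 k) (h2' _)).trans ?_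
          refine Finset.sum_le_sum_of_subset fun k hk => ?_
          simp only [mem_filter, mem_range] at hk ⊢
          exact hk.2
      _ = N * (M * M') := by simp
  · rw [coeff_mul]
    refine Finset.sum_eq_zero fun k hk => ?_
    have hk := mem_antidiagonal.1 hk
    by_cases h : N ≤ k.1
    · rw [h3 _ h, zero_mul]
    · rw [h3' _ (by omega), mul_zero]

theorem truncate (hx : Packs N M x p) (hM : M < 1048576) (K : ℕ) :
    Packs K M (Nat.land x (repdigit K 1048575)) (∑ i ∈ range K, monomial i (p.coeff i)) := by
  obtain ⟨P, rfl, h2, h3, rfl⟩ := hx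
  rw [land_repdigit (by norm_num) K P fun i => (h2 i).trans_lt hM]
  convert packs_sum (N := K) (M := M) (c := fun i => P.coeff i &&& 1048575)
    (fun i _ => Nat.and_le_left.trans (h2 i)) using 3 with i
  rw [coeff_map]
  have e : P.coeff i &&& 1048575 = P.coeff i := by
    have := Nat.and_two_pow_sub_one_eq_mod (P.coeff i) 20
    rw [show 2 ^ 20 - 1 = 1048575 by norm_num] at this
    rw [this, Nat.mod_eq_of_lt ((h2 i).trans_lt hM)]
  rw [e]
  rfl

/-- As `2 ^ e = 1` modulo 31, the high part of a digit may be added to its lowest `e` bits. Once the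
masked part is subtracted, all digits are divisible by `2 ^ e`, so one shift divides them all
without mixing neighbours. -/
theorem foldStep (hx : Packs N M x p) (hM : M < 1048576) (e : ℕ) (he : (2 : ZMod 31) ^ e = 1)
    (he' : 2 ^ e ≤ 1048576) (m : ℕ) (hm : m = 2 ^ e - 1) :
    Packs N (m + M / 2 ^ e) (foldStep e (repdigit N m) x) p := by
  obtain ⟨P, rfl, h2, h3, rfl⟩ := hx
  have hpos := Nat.two_pow_pos e
  have h1 := land_repdigit (m := m) (by omega) N P fun i => (h2 i).trans_lt hM
  simp only [hm, Nat.and_two_pow_sub_one_eq_mod] at h1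
  have h4 : P.eval 1048576 = ∑ i ∈ range N, P.coeff i % 2 ^ e * 1048576 ^ i +
      2 ^ e * ∑ i ∈ range N, P.coeff i / 2 ^ e * 1048576 ^ i := by
    rw [eval_eq_sum_range_of_coeff h3, Finset.mul_sum, ← Finset.sum_add_distrib]
    refine Finset.sum_congr rfl fun i _ => ?_
    rw [← mul_assoc, ← add_mul, Nat.mod_add_div]
  have h5 : _root_.foldStep e (repdigit N m) (P.eval 1048576) =
      ∑ i ∈ range N, (P.coeff i % 2 ^ e + P.coeff i / 2 ^ e) * 1048576 ^ i := by
    rw [_root_.foldStep, hm, h1, h4]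
    change _ + (_ + _ - _) >>> e = _
    rw [Nat.add_sub_cancel_left, Nat.shiftRight_eq_div_pow, Nat.mul_div_cancel_left _ hpos,
      ← Finset.sum_add_distrib]
    exact Finset.sum_congr rfl fun i _ => by ring
  rw [h5]
  convert packs_sum (N := N) (M := m + M / 2 ^ e)
    (c := fun i => P.coeff i % 2 ^ e + P.coeff i / 2 ^ e) (fun i _ => ?_) using 1
  · symm
    refine eq_sum_monomial_of_coeff (fun i hi => ?_) fun i _ => ?_
    · rw [coeff_map, h3 i hi, map_zero]
    · rw [coeff_map]
      conv_rhs => rw [← Nat.mod_add_div (P.coeff i) (2 ^ e)]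
      simp [he]
  · have := Nat.mod_lt (P.coeff i) hpos
    exact add_le_add (by omega) (Nat.div_le_div_right (h2 i))

/-- The digit bounds are `1023 + 1023 = 2046`, then `31 + 63 = 94`, then `31 + 2 = 33`. -/
theorem foldDigits (hx : Packs N M x p) (hM : M < 1048576) :
    Packs N 33 (foldDigits (repdigit N 1023) (repdigit N 31) x) p := by
  have h1 := hx.foldStep hM 10 (by decide) (by norm_num) 1023 (by norm_num)
  have h1' : Packs N 2046 _ p := h1.mono (by omega)
  have h2 := h1'.foldStep (by norm_num) 5 (by decide) (by norm_num) 31 (by norm_num)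
  have h2' : Packs N 94 _ p := h2.mono (by omega)
  exact h2'.foldStep (by norm_num) 5 (by decide) (by norm_num) 31 (by norm_num)

theorem shift (hx : Packs N M x p) (hM : M < 1048576) :
    Packs N M (Nat.shiftRight x 20) p.divX := by
  obtain ⟨P, rfl, h2, h3, rfl⟩ := hx
  refine ⟨P.divX, ?_, fun i => ?_, fun i hi => ?_, ?_⟩
  · change _ = P.eval 1048576 >>> 20
    rw [Nat.shiftRight_eq_div_pow, eval_eq_coeff_zero_add P, show 2 ^ 20 = 1048576 by norm_num,
      Nat.add_mul_div_left _ _ (by norm_num), Nat.div_eq_of_lt ((h2 0).trans_lt hM), zero_add]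
  · rw [coeff_divX]
    exact h2 _
  · rw [coeff_divX]
    exact h3 _ (by omega)
  · ext i
    simp [coeff_divX]

theorem coeff_zero (hx : Packs N M x p) (hM : M < 1048576) :
    ((Nat.land x 1048575 : ℕ) : ZMod 31) = p.coeff 0 := by
  obtain ⟨P, rfl, h2, h3, rfl⟩ := hx
  have e : Nat.land (P.eval 1048576) 1048575 = P.coeff 0 := by
    change P.eval 1048576 &&& 1048575 = _
    rw [show 1048575 = 2 ^ 20 - 1 by norm_num, Nat.and_two_pow_sub_one_eq_mod,
      eval_eq_coeff_zero_add P, show 2 ^ 20 = 1048576 by norm_num, Nat.add_mul_mod_self_left,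
      Nat.mod_eq_of_lt ((h2 0).trans_lt hM)]
  rw [e, coeff_map]
  rfl

end Packs

end Packing

/-! ### Gaussian elimination modulo 31 on packed rows. -/

noncomputable section Elimination

open Finset Polynomial

/-- The value `k`, computed after `n`. -/
def force {α : Type} (n : ℕ) (k : α) : α := @Bool.rec (fun _ => α) k k (Nat.beq n 0)

theorem force_eq {α : Type} (n : ℕ) (k : α) : force n k = k := by
  unfold force
  cases Nat.beq n 0 <;> rfl

/-- Add a multiple of the pivot row `-1 + X * R` and shift out the constant coefficient. -/
def reduceStep (R x : ℕ) : ℕ :=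
  Nat.add (Nat.shiftRight x 20) (Nat.mul (Nat.mod (Nat.land x 1048575) 31) R)

def reduceChunk (Rs : List ℕ) : ℕ → ℕ :=
  @List.rec ℕ (fun _ => ℕ → ℕ) (fun x => x) (fun R _ ih x => ih (reduceStep R x)) Rs

def reduceAll (C : List (List ℕ)) : ℕ → ℕ :=
  @List.rec (List ℕ) (fun _ => ℕ → ℕ) (fun x => x)
    (fun R _ ih x => (fun y => force y (ih y)) (reduceChunk R x)) C

def snoc {α : Type} (y : α) (l : List α) : List α :=
  @List.rec α (fun _ => List α) [y] (fun a _ ih => a :: ih) l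

/-- The negative of the inverse modulo `31`. -/
def negInverse (c : ℕ) : ℕ := Nat.mod (Nat.mul 30 (Nat.pow c 29)) 31

/-- The tail of the row `x` with constant coefficient `c`, after normalization. -/
def pivotTail (M10 M5 c x : ℕ) : ℕ :=
  foldDigits M10 M5 (Nat.mul (negInverse c) (foldDigits M10 M5 (Nat.shiftRight x 20)))

/-- Process a list of rows. `P` and `Q` hold the pivots in order, in chunks; `j` is the space left
in the chunk `Q`. Rows that give no pivot for the next column are collected in `D`; `k` is the
number of pivots. At the end `cont` is called. -/
def eliminatePass (M10 M5 : ℕ) (cont : List (List ℕ) → List ℕ → ℕ → ℕ) (rows : List ℕ) :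
    List (List ℕ) → List ℕ → ℕ → List ℕ → ℕ → ℕ :=
  @List.rec ℕ (fun _ => List (List ℕ) → List ℕ → ℕ → List ℕ → ℕ → ℕ)
    (fun P Q _ D k => cont (snoc Q P) D k)
    (fun r _ ih P Q j D k =>
      (fun x => @Nat.rec (fun _ => ℕ) (ih P Q j (r :: D) k)
        (fun c _ => (fun y => force y (@Nat.rec (fun _ => ℕ)
            (ih (snoc (snoc y Q) P) [] 30 D (Nat.succ k))
            (fun j' _ => ih P (snoc y Q) j' D (Nat.succ k)) j))
          (pivotTail M10 M5 (Nat.succ c) x))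
        (Nat.mod (Nat.land x 1048575) 31)) (reduceChunk Q (reduceAll P r)))
    rows

/-- The number of pivots found in three passes. -/
def eliminate (M10 M5 : ℕ) (rows : List ℕ) : ℕ :=
  eliminatePass M10 M5 (fun P D k => eliminatePass M10 M5 (fun P D k =>
    eliminatePass M10 M5 (fun _ _ k => k) D P [] 30 [] k) D P [] 30 [] k) rows [] [] 30 [] 0

section EliminatePass

variable {M10 M5 : ℕ} {cont : List (List ℕ) → List ℕ → ℕ → ℕ} {r : ℕ} {rows : List ℕ}
  {P : List (List ℕ)} {Q : List ℕ} {D : List ℕ} {c k : ℕ}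

theorem eliminatePass_cons_of_eq_zero {j : ℕ}
    (h : Nat.mod (Nat.land (reduceChunk Q (reduceAll P r)) 1048575) 31 = 0) :
    eliminatePass M10 M5 cont (r :: rows) P Q j D k =
      eliminatePass M10 M5 cont rows P Q j (r :: D) k := by
  unfold eliminatePass
  simp only [h]
  rfl

theorem eliminatePass_cons_of_full
    (h : Nat.mod (Nat.land (reduceChunk Q (reduceAll P r)) 1048575) 31 = c + 1) :
    eliminatePass M10 M5 cont (r :: rows) P Q 0 D k = eliminatePass M10 M5 cont rows
      (snoc (snoc (pivotTail M10 M5 (c + 1) (reduceChunk Q (reduceAll P r))) Q) P) [] 30 D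
      (k + 1) := by
  unfold eliminatePass
  simp only [h, force_eq, Nat.succ_eq_add_one]
  rfl

theorem eliminatePass_cons_of_space {j : ℕ}
    (h : Nat.mod (Nat.land (reduceChunk Q (reduceAll P r)) 1048575) 31 = c + 1) :
    eliminatePass M10 M5 cont (r :: rows) P Q (j + 1) D k = eliminatePass M10 M5 cont rows P
      (snoc (pivotTail M10 M5 (c + 1) (reduceChunk Q (reduceAll P r))) Q) j D (k + 1) := by
  unfold eliminatePass
  simp only [h, force_eq, Nat.succ_eq_add_one]

end EliminatePass

theorem reduceChunk_nil (x : ℕ) : reduceChunk [] x = x := rfl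

theorem reduceChunk_snoc (y : ℕ) (Q : List ℕ) (x : ℕ) :
    reduceChunk (snoc y Q) x = reduceStep y (reduceChunk Q x) := by
  induction Q generalizing x with
  | nil => rfl
  | cons R Q ih => exact ih (reduceStep R x)

theorem reduceAll_cons (Q : List ℕ) (P : List (List ℕ)) (x : ℕ) :
    reduceAll (Q :: P) x = reduceAll P (reduceChunk Q x) :=
  force_eq _ _

theorem reduceAll_snoc (Q : List ℕ) (P : List (List ℕ)) (x : ℕ) :
    reduceAll (snoc Q P) x = reduceChunk Q (reduceAll P x) := by
  induction P generalizing x with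
  | nil => exact force_eq _ _
  | cons R P ih =>
    change reduceAll (R :: snoc Q P) x = _
    rw [reduceAll_cons, reduceAll_cons, ih]

/-- The linear map with kernel spanned by `-1 + X * r`. -/
def pivotMap (r : (ZMod 31)[X]) : (ZMod 31)[X] →ₗ[ZMod 31] (ZMod 31)[X] where
  toFun p := p.divX + p.coeff 0 • r
  map_add' p q := by
    ext i
    simp [coeff_divX]
    ring
  map_smul' c p := by
    ext i
    simp [coeff_divX]
    ring

/-- The function `g` on packed polynomials realizes the linear map `T`, using `n` pivots. -/
def Reduces (N : ℕ) (g : ℕ → ℕ) (n : ℕ) (T : (ZMod 31)[X] →ₗ[ZMod 31] (ZMod 31)[X]) : Prop :=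
  ∀ M x p, M + 990 * n < 1048576 → Packs N M x p → Packs N (M + 990 * n) (g x) (T p)

theorem reduces_id (N : ℕ) : Reduces N (fun x => x) 0 LinearMap.id := fun _ _ _ _ h => h

/-- The multiplier is at most 30 and the digits of `R` are at most 33, so a pivot adds at most `990
= 30 * 33` to a digit. This is why rows need no folding between pivots. -/
theorem reduces_reduceStep {N R : ℕ} {r : (ZMod 31)[X]} (hR : Packs N 33 R r) :
    Reduces N (reduceStep R) 1 (pivotMap r) := by
  intro M x p hM hx
  have hM' : M < 1048576 := by omega
  have h1 := (hx.shift hM').add (hR.smul (Nat.mod (Nat.land x 1048575) 31))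
  have h2 : ((Nat.mod (Nat.land x 1048575) 31 : ℕ) : ZMod 31) = p.coeff 0 := by
    rw [← hx.coeff_zero hM']
    exact ZMod.natCast_mod _ _
  rw [h2] at h1
  refine h1.mono ?_
  have : Nat.mod (Nat.land x 1048575) 31 < 31 := Nat.mod_lt _ (by norm_num)
  omega

theorem Reduces.comp {N : ℕ} {g h : ℕ → ℕ} {n m : ℕ}
    {T S : (ZMod 31)[X] →ₗ[ZMod 31] (ZMod 31)[X]} (hh : Reduces N h m S) (hg : Reduces N g n T) :
    Reduces N (fun x => h (g x)) (n + m) (S ∘ₗ T) := by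
  intro M x p hM hx
  have h1 := hh _ _ _ (by omega) (hg M x p (by omega) hx)
  exact h1.mono (by omega)

instance fact_prime_thirtyOne : Fact (Nat.Prime 31) := ⟨by norm_num⟩

/-- By Fermat `c ^ 29` is the inverse of `c`, and `30 = -1`. With this tail `t`, the row `p` is a
multiple of `-1 + X * t`. -/
theorem packs_pivotTail {N M c x : ℕ} {p : (ZMod 31)[X]} (hx : Packs N M x p) (hM : M < 1048576)
    (hc : (c : ZMod 31) = p.coeff 0) (hc0 : p.coeff 0 ≠ 0) :
    Packs N 33 (pivotTail (repdigit N 1023) (repdigit N 31) c x) (-(p.coeff 0)⁻¹ • p.divX) := by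
  have h1 := ((hx.shift hM).foldDigits hM).smul (negInverse c)
  have h2 : negInverse c < 31 := Nat.mod_lt _ (by norm_num)
  have h3 : ((negInverse c : ℕ) : ZMod 31) = -(p.coeff 0)⁻¹ := by
    change ((30 * c ^ 29 % 31 : ℕ) : ZMod 31) = _
    rw [ZMod.natCast_mod, Nat.cast_mul, Nat.cast_pow, hc,
      show ((30 : ℕ) : ZMod 31) = -1 by decide, neg_one_mul]
    refine congrArg _ (eq_inv_of_mul_eq_one_left ?_)
    rw [← pow_succ]
    exact ZMod.pow_card_sub_one_eq_one hc0
  rw [h3] at h1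
  exact h1.foldDigits (by omega)

theorem finrank_map_add_one_le {K V : Type*} [Field K] [AddCommGroup V] [Module K V]
    (W : Submodule K V) [FiniteDimensional K W] (T : V →ₗ[K] V) {v : V} (hv : v ∈ W) (h0 : v ≠ 0)
    (hT : T v = 0) : Module.finrank K (W.map T) + 1 ≤ Module.finrank K W := by
  have h := LinearMap.finrank_range_add_finrank_ker (T.domRestrict W)
  rw [LinearMap.range_domRestrict] at h
  have h1 : 0 < Module.finrank K (LinearMap.ker (T.domRestrict W)) := by
    rw [Module.finrank_pos_iff_exists_ne_zero]
    exact ⟨⟨⟨v, hv⟩, hT⟩, fun h => h0 (congrArg (fun z => z.1.1) h)⟩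
  omega

/-- The invariant is that `k` plus the dimension of the image of `U` under the composite `T` of all
pivot maps never grows: a new pivot map kills the nonzero vector `T p` of this image. Deferred rows
are kept unreduced and meet all pivots again in the next pass. `B` bounds the pivots plus the rows
still to come, and thereby the size of the digits. -/
theorem eliminatePass_le {N B : ℕ} (hB : 33 + 990 * B < 1048576)
    (U : Submodule (ZMod 31) (ZMod 31)[X]) [FiniteDimensional (ZMod 31) U]
    (cont : List (List ℕ) → List ℕ → ℕ → ℕ)
    (hcont : ∀ P D n T k, Reduces N (reduceAll P) n T → n + D.length ≤ B →
      (∀ x ∈ D, ∃ p ∈ U, Packs N 33 x p) →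
      cont P D k ≤ k + Module.finrank (ZMod 31) (U.map T))
    (rows : List ℕ) : ∀ P Q j D k n T,
      Reduces N (fun x => reduceChunk Q (reduceAll P x)) n T →
      n + rows.length + D.length ≤ B →
      (∀ x ∈ rows, ∃ p ∈ U, Packs N 33 x p) → (∀ x ∈ D, ∃ p ∈ U, Packs N 33 x p) →
      eliminatePass (repdigit N 1023) (repdigit N 31) cont rows P Q j D k ≤
        k + Module.finrank (ZMod 31) (U.map T) := by
  induction rows with
  | nil =>
    intro P Q j D k n T hT hn _ hD
    refine hcont (snoc Q P) D n T k ?_ hn hD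
    simpa only [Reduces, reduceAll_snoc] using hT
  | cons r rows ih =>
    intro P Q j D k n T hT hn hrows hD
    obtain ⟨p, hp, hr⟩ := hrows r (by simp)
    replace hrows : ∀ x ∈ rows, ∃ p ∈ U, Packs N 33 x p := fun x hx => hrows x (by simp [hx])
    rw [List.length_cons] at hn
    have hlt : 33 + 990 * n < 1048576 := by omega
    have hx := hT 33 r p hlt hr
    have hc := hx.coeff_zero hlt
    have hmod : ((Nat.mod (Nat.land (reduceChunk Q (reduceAll P r)) 1048575) 31 : ℕ) : ZMod 31) =
        (T p).coeff 0 := by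
      rw [← hc]
      exact ZMod.natCast_mod _ _
    rcases hm : Nat.mod (Nat.land (reduceChunk Q (reduceAll P r)) 1048575) 31 with _ | c
    · rw [eliminatePass_cons_of_eq_zero hm]
      refine ih P Q j (r :: D) k n T hT ?_ hrows ?_
      · rw [List.length_cons]
        omega
      · simpa using ⟨⟨p, hp, hr⟩, hD⟩
    · rw [hm] at hmod
      have hc31 : c + 1 < 31 := hm ▸ Nat.mod_lt _ (by norm_num)
      have h0 : (T p).coeff 0 ≠ 0 := by
        rw [← hmod, Ne, ZMod.natCast_eq_zero_iff]
        exact Nat.not_dvd_of_pos_of_lt (Nat.succ_pos _) hc31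
      have ht := packs_pivotTail hx hlt hmod h0
      set t := -((T p).coeff 0)⁻¹ • (T p).divX with htdef
      have hT' : Reduces N (fun x => reduceStep (pivotTail (repdigit N 1023) (repdigit N 31) (c + 1)
          (reduceChunk Q (reduceAll P r))) (reduceChunk Q (reduceAll P x))) (n + 1)
          (pivotMap t ∘ₗ T) := (reduces_reduceStep ht).comp hT
      have hfin : Module.finrank (ZMod 31) (U.map (pivotMap t ∘ₗ T)) + 1 ≤
          Module.finrank (ZMod 31) (U.map T) := by
        rw [Submodule.map_comp]
        refine finrank_map_add_one_le _ _ (Submodule.mem_map_of_mem hp)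
          (fun h => h0 (by rw [h, coeff_zero])) ?_
        change (T p).divX + (T p).coeff 0 • t = 0
        rw [htdef, smul_smul, mul_neg, mul_inv_cancel₀ h0, neg_smul, one_smul, add_neg_cancel]
      rcases j with _ | j
      · rw [eliminatePass_cons_of_full hm]
        refine (ih _ _ _ _ _ (n + 1) (pivotMap t ∘ₗ T) ?_ (by omega) hrows hD).trans (by omega)
        simpa only [Reduces, reduceAll_snoc, reduceChunk_snoc, reduceChunk_nil] using hT'
      · rw [eliminatePass_cons_of_space hm]
        refine (ih _ _ _ _ _ (n + 1) (pivotMap t ∘ₗ T) ?_ (by omega) hrows hD).trans (by omega)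
        simpa only [Reduces, reduceChunk_snoc] using hT'

theorem eliminate_le {N : ℕ} (U : Submodule (ZMod 31) (ZMod 31)[X])
    [FiniteDimensional (ZMod 31) U] (rows : List ℕ) (hlen : rows.length ≤ 1058)
    (hrows : ∀ x ∈ rows, ∃ p ∈ U, Packs N 33 x p) :
    eliminate (repdigit N 1023) (repdigit N 31) rows ≤ Module.finrank (ZMod 31) U := by
  have hB : 33 + 990 * 1058 < 1048576 := by norm_num
  have key := eliminatePass_le (N := N) hB U
    (fun P D k => eliminatePass (repdigit N 1023) (repdigit N 31) (fun P D k =>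
      eliminatePass (repdigit N 1023) (repdigit N 31) (fun _ _ k => k) D P [] 30 [] k)
      D P [] 30 [] k)
    (fun P D n T k hT hn hD => eliminatePass_le hB U _
      (fun P D n T k hT hn hD => eliminatePass_le hB U _ (fun _ _ _ _ k _ _ _ => Nat.le_add_right _ _)
        D P [] 30 [] k n T hT (by simpa using hn) hD (by simp))
      D P [] 30 [] k n T hT (by simpa using hn) hD (by simp))
    rows [] [] 30 [] 0 0 LinearMap.id (reduces_id N) (by simpa using hlen) hrows (by simp)
  rw [Submodule.map_id, zero_add] at key
  exact key

end Elimination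

/-! ### Generating packed nested sums and their products. -/

noncomputable section Generation

open Finset PowerSeries

/-- Truncated products of packed series; `W`, `M10` and `M5` are masks. -/
def mulTrunc (W M10 M5 x y : ℕ) : ℕ := foldDigits M10 M5 (Nat.land (Nat.mul x y) W)

/-- The sum of `a` and the truncated product of `g` and `t`, packed with digits at most `2046`. If
the sum of the digits of `g` is small, one folding step suffices. -/
def mulAddTrunc (W M10 M5 a g t : ℕ) : ℕ :=
  @Bool.rec (fun _ => ℕ)
    (foldDigits M10 M5 (Nat.land (Nat.add a (Nat.mul g (foldDigits M10 M5 t))) W))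
    (foldStep 10 M10 (Nat.land (Nat.add a (Nat.mul g t)) W))
    (Nat.ble (Nat.mod g 1048575) 511)

/-- The tail of a list, except that a last entry is kept. -/
def advance (ts : List ℕ) : List ℕ :=
  @List.rec ℕ (fun _ => List ℕ) []
    (fun _ l _ => @List.rec ℕ (fun _ => List ℕ) ts (fun _ _ _ => l) l) ts

def headOrZero (ts : List ℕ) : ℕ := @List.rec ℕ (fun _ => ℕ) 0 (fun a _ _ => a) ts

def lastOrZero (ts : List ℕ) : ℕ :=
  @List.rec ℕ (fun _ => ℕ → ℕ) (fun d => d) (fun a _ ih _ => ih a) ts 0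

/-- The partial sums, starting from `acc`, of the products of the entries of `Gs` and `ts`. -/
def partialSums (W M10 M5 : ℕ) (Gs : List ℕ) : List ℕ → ℕ → List ℕ :=
  @List.rec ℕ (fun _ => List ℕ → ℕ → List ℕ) (fun _ acc => [acc])
    (fun g _ ih ts acc => acc :: (fun acc' => force acc' (ih (advance ts) acc'))
      (mulAddTrunc W M10 M5 acc g (headOrZero ts))) Gs

/-- The truncation of `X ^ u / (1 - X ^ u)`, packed. -/
def packedGeom (N u : ℕ) : ℕ :=
  Nat.mul (Nat.pow 2 (Nat.mul 20 u))
    (Nat.div (Nat.sub (Nat.pow 2 (Nat.mul (Nat.mul 20 u) (Nat.div (Nat.pred N) u))) 1)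
      (Nat.sub (Nat.pow 2 (Nat.mul 20 u)) 1))

def packedGeoms (N q : ℕ) : ℕ → List ℕ :=
  @Nat.rec (fun _ => ℕ → List ℕ) (fun _ => [])
    (fun _ ih u => packedGeom N u :: ih (Nat.succ u)) q

/-- The products of the first `q` entries of two lists. -/
def pointwiseMul (W M10 M5 q : ℕ) : List ℕ → List ℕ → List ℕ :=
  @Nat.rec (fun _ => List ℕ → List ℕ → List ℕ) (fun _ _ => [])
    (fun _ ih gs hs => @List.rec ℕ (fun _ => List ℕ) [] (fun g gs' _ =>
      @List.rec ℕ (fun _ => List ℕ) [] (fun h hs' _ =>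
        mulTrunc W M10 M5 g h :: ih gs' hs') hs) gs) q

/-- The packed sequence `m ↦ (X ^ m / (1 - X ^ m)) ^ s`, from `m = 1` on. -/
structure Letter where
  s : ℕ
  vals : List ℕ

/-- For the power `s` at most `(N - 1) / s` entries matter, since `(q^m/(1-q^m))^s` is divisible by
`q^(sm)`. -/
def letters (W M10 M5 N : ℕ) (g1 : List ℕ) (S : ℕ) : List ℕ → ℕ → List Letter :=
  @Nat.rec (fun _ => List ℕ → ℕ → List Letter) (fun _ _ => [])
    (fun _ ih g s => Letter.mk s g ::
      ih (pointwiseMul W M10 M5 (Nat.div (Nat.pred N) (Nat.succ s)) g g1) (Nat.succ s)) S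

def nthD {α : Type} (d : α) (l : List α) : ℕ → α :=
  @List.rec α (fun _ => ℕ → α) (fun _ => d)
    (fun a _ ih n => @Nat.rec (fun _ => α) a (fun m _ => ih m) n) l

/-- The packed nested sums for a word of weight `k` and length `l`, from index `1` on. -/
structure Node where
  k : ℕ
  l : ℕ
  vals : List ℕ

/-- A packed series in the filtration step of weight `k` and length `l`. -/
structure Row where
  k : ℕ
  l : ℕ
  x : ℕ

/-- Each pair `(s, i)` of the program prepends the letter `s` to the word at place `i`. -/
def runProgram (W M10 M5 : ℕ) (d : Letter) (tb : List Letter) (pr : List (ℕ × ℕ)) :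
    List Node → List Node :=
  @List.rec (ℕ × ℕ) (fun _ => List Node → List Node) (fun ns => ns)
    (fun c _ ih ns => ih (ns ++ [(fun (a : Letter) (n : Node) =>
      Node.mk (Nat.add a.s n.k) (Nat.succ n.l) (partialSums W M10 M5 a.vals n.vals 0))
        (nthD d tb (Nat.pred c.1)) (nthD (Node.mk 0 0 [1]) ns c.2)])) pr

def mulRow (W M10 M5 : ℕ) (r g : Row) : Row :=
  Row.mk (Nat.add r.k g.k) (Nat.add r.l g.l) (mulTrunc W M10 M5 r.x g.x)

/-- The products of `r` with monomials in `gs`, of weight at most `K` and length at most `L`,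
in front of the list `acc`. The entries of `gs` are sorted by weight. -/
def monomialRows (W M10 M5 K L fuel : ℕ) : List Row → Row → List Row → List Row :=
  @Nat.rec (fun _ => List Row → Row → List Row → List Row) (fun _ r acc => r :: acc)
    (fun _ ih gs r acc => r :: @List.rec Row (fun _ => List Row) acc (fun g gs' ih2 =>
      @Bool.rec (fun _ => List Row) acc
        (@Bool.rec (fun _ => List Row) ih2 (ih (g :: gs') (mulRow W M10 M5 r g) ih2)
          (Nat.ble (Nat.add r.l g.l) L))
        (Nat.ble (Nat.add r.k g.k) K)) gs) fuel

/-- Rows of length one and even weight at least four. -/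
def isEvenRow (g : Row) : Bool :=
  and (Nat.beq g.l 1) (and (Nat.beq (Nat.mod g.k 2) 0) (Nat.ble 4 g.k))

def productRow (W M10 M5 : ℕ) (gs : List Row) (is : List ℕ) : Row :=
  @List.rec ℕ (fun _ => Row) (Row.mk 0 0 1)
    (fun i _ r => mulRow W M10 M5 r (nthD (Row.mk 0 0 1) gs i)) is

/-- The generators obtained from a program. -/
def generators (N S : ℕ) (pr : List (ℕ × ℕ)) : List Row :=
  (fun W M10 M5 => ((fun g1 : List ℕ =>
    runProgram W M10 M5 (Letter.mk 1 g1) (letters W M10 M5 N g1 S g1 1) pr [Node.mk 0 0 [1]])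
      (packedGeoms N (Nat.pred N) 1)).tail.map fun n =>
        Row.mk n.k n.l (foldDigits M10 M5 (lastOrZero n.vals)))
    (repdigit N 1048575) (repdigit N 1023) (repdigit N 31)

/-- All products of one of the monomials `st` with a monomial in the generators that are not even
rows. -/
def productRows (N K L S : ℕ) (pr : List (ℕ × ℕ)) (st : List (List ℕ)) : List Row :=
  (fun W M10 M5 => (fun gs : List Row =>
    (st.map (productRow W M10 M5 gs)).foldr (fun e acc =>
      monomialRows W M10 M5 K L K (gs.filter fun g => !isEvenRow g) e acc) [])
    (generators N S pr)) (repdigit N 1048575) (repdigit N 1023) (repdigit N 31)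

def rowRank (N : ℕ) (rows : List Row) : ℕ :=
  eliminate (repdigit N 1023) (repdigit N 31) (rows.map Row.x)

def hasFullRank (N : ℕ) (rows : List Row) : Bool := Nat.beq (rowRank N rows) N

/-- The number of rows is `N`, and there are enough rows for each triple `(k, l, d)`. -/
def checkCounts (N : ℕ) (rows : List Row) (t : List (ℕ × ℕ × ℕ)) : Bool :=
  and (Nat.beq rows.length N) (t.all fun c => Nat.ble c.2.2
    (rows.filter fun r => and (Nat.ble r.k c.1) (Nat.ble r.l c.2.1)).length)

end Generation

/-! ### Reduction modulo 31 and correctness of the packed series. -/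

noncomputable section Generation

open Finset PowerSeries

theorem map_geomBracket {R S : Type*} [CommRing R] [CommRing S] (φ : R →+* S) (s : List ℕ) :
    PowerSeries.map φ (geomBracket R s) = geomBracket S s := by
  have h1 : ∀ m, PowerSeries.map φ (geomSeq R m) = geomSeq S m := by
    intro m
    ext n
    rw [coeff_map, geomSeq, geomSeq, coeff_dilate, coeff_dilate]
    split_ifs <;> simp
  have h2 : ∀ u, PowerSeries.map φ (nestedSum (s.map fun s => geomSeq R ^ s) u) =
      nestedSum (s.map fun s => geomSeq S ^ s) u := by
    induction s with
    | nil => intro u; simp [nestedSum]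
    | cons a s ih =>
      intro u
      simp only [List.map_cons, nestedSum, map_sum, map_mul, Pi.pow_apply, map_pow, h1, ih]
  ext n
  rw [coeff_map, geomBracket, geomBracket, coeff_diagLimit, coeff_diagLimit, ← h2, coeff_map]

/-- Linear independence of the reductions modulo a prime gives linear independence. -/
theorem linearIndependent_of_zmod {ι : Type*} [Fintype ι] {N : ℕ} (F : ι → ℤ⟦X⟧)
    (h : LinearIndependent (ZMod 31) fun i =>
      trunc N (PowerSeries.map (Int.castRingHom (ZMod 31)) (F i))) :
    LinearIndependent ℚ fun i => PowerSeries.map (Int.castRingHom ℚ) (F i) := by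
  rw [← LinearIndependent.iff_fractionRing ℤ ℚ, Fintype.linearIndependent_iff]
  intro c hc
  replace hc : ∑ i, c i • F i = 0 := by
    have hinj : Function.Injective (PowerSeries.map (Int.castRingHom ℚ)) :=
      PowerSeries.map_injective _ Int.cast_injective
    apply hinj
    rw [map_sum, map_zero, ← hc]
    exact Finset.sum_congr rfl fun i _ => map_zsmul _ _ _
  -- Infinite descent: independence modulo 31 makes every coefficient of an integral relation
  -- divisible by 31, and the relation divided by 31 is again one.
  have key : ∀ n : ℕ, ∀ c : ι → ℤ, ∑ i, c i • F i = 0 → ∀ i, (31 : ℤ) ^ n ∣ c i := by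
    intro n
    induction n with
    | zero => exact fun c _ i => by simp
    | succ n ih =>
      intro c hc
      have h31 : ∀ i, (31 : ℤ) ∣ c i := by
        intro i
        refine (ZMod.intCast_zmod_eq_zero_iff_dvd (c i) 31).1 ?_
        refine Fintype.linearIndependent_iff.1 h (fun i => (c i : ZMod 31)) ?_ i
        ext m
        simp only [Polynomial.finsetSum_coeff, Polynomial.coeff_smul, coeff_trunc, coeff_map,
          Polynomial.coeff_zero]
        split_ifs
        · have := congrArg (fun f => ((coeff m f : ℤ) : ZMod 31)) hc
          simp only [map_sum, map_zsmul, smul_eq_mul, Int.cast_sum, Int.cast_mul, map_zero,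
            Int.cast_zero] at this
          simpa using this
        · simp
      choose d hd using h31
      have hd' : ∑ i, d i • F i = 0 := by
        have : (31 : ℤ) • ∑ i, d i • F i = 0 := by
          rw [Finset.smul_sum, ← hc]
          exact Finset.sum_congr rfl fun i _ => by rw [smul_smul, ← hd]
        ext m
        have hm := congrArg (coeff m) this
        rw [map_zsmul, map_zero, smul_eq_mul] at hm
        exact (mul_eq_zero.1 hm).resolve_left (by norm_num)
      intro i
      rw [hd i, pow_succ']
      exact mul_dvd_mul_left _ (ih d hd' i)
  intro i
  by_contra hne
  have h1 := Int.le_of_dvd (abs_pos.2 hne) ((dvd_abs _ _).2 (key (c i).natAbs c hc i))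
  have h2 : (c i).natAbs < 31 ^ (c i).natAbs := Nat.lt_pow_self (by norm_num)
  zify at h2
  omega

theorem packs_one {N : ℕ} (hN : 0 < N) : Packs N 33 1 (trunc N (1 : (ZMod 31)⟦X⟧)) := by
  refine ⟨1, by simp, fun i => ?_, fun i hi => ?_, ?_⟩
  · rw [Polynomial.coeff_one]
    split_ifs <;> norm_num
  · rw [Polynomial.coeff_one, if_neg (by omega)]
  · obtain ⟨n, rfl⟩ := Nat.exists_eq_add_of_le' hN
    simp [trunc_one]

theorem Packs.mono_length {N N' M x : ℕ} {p : Polynomial (ZMod 31)} (h : Packs N M x p)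
    (hN : N ≤ N') : Packs N' M x p := by
  obtain ⟨P, h1, h2, h3, h4⟩ := h
  exact ⟨P, h1, h2, fun i hi => h3 i (hN.trans hi), h4⟩

theorem Packs.trunc {N M x : ℕ} {p : Polynomial (ZMod 31)} (hx : Packs N M x p)
    (hM : M < 1048576) (K : ℕ) {f : (ZMod 31)⟦X⟧} (h : ∀ i < K, p.coeff i = coeff i f) :
    Packs K 33 (_root_.foldDigits (repdigit K 1023) (repdigit K 31)
      (Nat.land x (repdigit K 1048575))) (trunc K f) := by
  have h1 := (hx.truncate hM K).foldDigits hM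
  rwa [eq_sum_monomial_of_coeff (p := PowerSeries.trunc K f)
    (fun i hi => by rw [coeff_trunc, if_neg (by omega)])
    (fun i hi => by rw [coeff_trunc, if_pos hi, h i hi])] at h1

theorem packs_mulTrunc {N x y : ℕ} (hN : N ≤ 960) {f g : (ZMod 31)⟦X⟧}
    (hx : Packs N 33 x (trunc N f)) (hy : Packs N 33 y (trunc N g)) :
    Packs N 33 (mulTrunc (repdigit N 1048575) (repdigit N 1023) (repdigit N 31) x y)
      (trunc N (f * g)) := by
  refine (hx.mul hy).trunc (by omega) N fun i hi => ?_
  rw [coeff_mul_eq_coeff_trunc_mul_trunc _ _ hi, ← Polynomial.coe_mul, Polynomial.coeff_coe]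

/-- A number is congruent to its digit sum modulo the base minus one. -/
theorem sum_mod_eq_eval_mod (P : Polynomial ℕ) (b : ℕ) :
    P.eval (b + 1) % b = P.eval 1 % b := by
  rw [Polynomial.eval_eq_sum_range, Polynomial.eval_eq_sum_range, Finset.sum_nat_mod,
    Finset.sum_nat_mod _ _ fun i => P.coeff i * 1 ^ i]
  congr 1
  refine Finset.sum_congr rfl fun i _ => ?_
  rw [Nat.mul_mod, Nat.pow_mod, Nat.add_mod_left, ← Nat.pow_mod, ← Nat.mul_mod]

/-- A bound for the digits of a product in terms of the sum of the digits of one factor. -/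
theorem Packs.mul_of_mod_le {N M x y c : ℕ} {p q : Polynomial (ZMod 31)} (hN : N ≤ 960)
    (hx : Packs N 33 x p) (hy : Packs N M y q) (hc : x % 1048575 ≤ c) :
    Packs (2 * N) (c * M) (Nat.mul x y) (p * q) := by
  obtain ⟨P, hP, h2, h3, rfl⟩ := hx
  obtain ⟨Q, rfl, h2', h3', rfl⟩ := hy
  have hsum : ∑ i ∈ range N, P.coeff i ≤ c := by
    have h4 := sum_mod_eq_eval_mod P 1048575
    rw [hP, eval_eq_sum_range_of_coeff h3 1] at h4
    simp only [one_pow, mul_one] at h4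
    have h5 : ∑ i ∈ range N, P.coeff i ≤ ∑ i ∈ range N, 33 := Finset.sum_le_sum fun i _ => h2 i
    rw [Finset.sum_const, card_range, smul_eq_mul] at h5
    -- The digit sum is at most `960 * 33 < 1048575`, so its residue is the sum itself.
    rw [Nat.mod_eq_of_lt (by omega : ∑ i ∈ range N, P.coeff i < 1048575)] at h4
    omega
  refine ⟨P * Q, by rw [Polynomial.eval_mul, hP]; rfl, fun i => ?_, fun i hi => ?_, by simp⟩
  · rw [Polynomial.coeff_mul,
      Finset.Nat.sum_antidiagonal_eq_sum_range_succ fun a b => P.coeff a * Q.coeff b]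
    calc ∑ k ∈ range (i + 1), P.coeff k * Q.coeff (i - k)
        ≤ ∑ k ∈ range N, P.coeff k * M := by
          rw [← Finset.sum_filter_of_ne (p := fun k => k < N) (fun k _ h => by
            by_contra hk
            exact h (by rw [h3 k (by omega), zero_mul]))]
          refine (Finset.sum_le_sum fun k _ => Nat.mul_le_mul_left _ (h2' _)).trans ?_
          refine Finset.sum_le_sum_of_subset fun k hk => ?_
          simp only [mem_filter, Finset.mem_range] at hk ⊢
          exact hk.2
      _ ≤ c * M := by
          rw [← Finset.sum_mul]
          exact Nat.mul_le_mul_right _ hsum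
  · rw [Polynomial.coeff_mul]
    refine Finset.sum_eq_zero fun k hk => ?_
    have hk := HasAntidiagonal.mem_antidiagonal.1 hk
    by_cases h : N ≤ k.1
    · rw [h3 _ h, zero_mul]
    · rw [h3' _ (by omega), mul_zero]

theorem Packs.trunc_foldStep {N M x : ℕ} {p : Polynomial (ZMod 31)} (hx : Packs N M x p)
    (hM : M < 1048576) (K : ℕ) {f : (ZMod 31)⟦X⟧} (h : ∀ i < K, p.coeff i = coeff i f) :
    Packs K 2046 (_root_.foldStep 10 (repdigit K 1023)
      (Nat.land x (repdigit K 1048575))) (PowerSeries.trunc K f) := by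
  have h1 := (hx.truncate hM K).foldStep hM 10 (by decide) (by norm_num) 1023 (by norm_num)
  rw [eq_sum_monomial_of_coeff (p := PowerSeries.trunc K f)
    (fun i hi => by rw [coeff_trunc, if_neg (by omega)])
    (fun i hi => by rw [coeff_trunc, if_pos hi, h i hi])] at h1
  exact h1.mono (by omega)

/-- No carry in either branch: `2046 + 960 * 33 ^ 2` and `2046 + 511 * 2046` are both below `2 ^
20`. -/
theorem packs_mulAddTrunc {N a x y : ℕ} (hN : N ≤ 960) {e f g : (ZMod 31)⟦X⟧}
    (ha : Packs N 2046 a (trunc N e)) (hx : Packs N 33 x (trunc N f))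
    (hy : Packs N 2046 y (trunc N g)) :
    Packs N 2046 (mulAddTrunc (repdigit N 1048575) (repdigit N 1023) (repdigit N 31) a x y)
      (trunc N (e + f * g)) := by
  have hcoeff : ∀ i < N, (trunc N e + trunc N f * trunc N g).coeff i = coeff i (e + f * g) := by
    intro i hi
    rw [Polynomial.coeff_add, map_add, coeff_mul_eq_coeff_trunc_mul_trunc _ _ hi,
      ← Polynomial.coe_mul, Polynomial.coeff_coe, coeff_trunc, if_pos hi]
  have ha' := ha.mono_length (show N ≤ 2 * N by omega)
  unfold mulAddTrunc
  cases h : Nat.ble (Nat.mod x 1048575) 511 with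
  | false =>
    have h1 := ha'.add (hx.mul (hy.foldDigits (by norm_num)))
    exact (h1.trunc (by omega) N hcoeff).mono (by norm_num)
  | true =>
    have h1 := ha'.add (hx.mul_of_mod_le hN hy (Nat.le_of_ble_eq_true h))
    exact h1.trunc_foldStep (by norm_num) N hcoeff

/-- The list `ts`, with the last entry repeated, packs the truncations of `g u, g (u + 1), …`, with
digits at most `2046`. -/
def PacksSeq (N : ℕ) (ts : List ℕ) (g : ℕ → (ZMod 31)⟦X⟧) (u : ℕ) : Prop :=
  ∀ i, Packs N 2046 (headOrZero (advance^[i] ts)) (trunc N (g (u + i)))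

/-- The list `Gs` packs the truncations of `a u, a (u + 1), …`; later truncations vanish. -/
def PacksLetter (N : ℕ) : List ℕ → (ℕ → (ZMod 31)⟦X⟧) → ℕ → Prop
  | [], a, u => ∀ m, u ≤ m → X ^ N ∣ a m
  | g :: Gs, a, u => Packs N 33 g (trunc N (a u)) ∧ PacksLetter N Gs a (u + 1)

theorem PacksSeq.advance {N : ℕ} {ts : List ℕ} {g : ℕ → (ZMod 31)⟦X⟧} {u : ℕ}
    (h : PacksSeq N ts g u) : PacksSeq N (advance ts) g (u + 1) := fun i => by
  have := h (i + 1)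
  rwa [Function.iterate_succ_apply, ← add_assoc, add_right_comm] at this

theorem advance_iterate_singleton (a i : ℕ) : advance^[i] [a] = [a] := by
  induction i with
  | zero => rfl
  | succ i ih => exact ih

theorem headOrZero_advance_iterate (ts : List ℕ) : ∀ i, ts.length ≤ i →
    headOrZero (advance^[i] ts) = lastOrZero ts := by
  induction ts with
  | nil =>
    intro i _
    have : advance^[i] [] = [] := by
      induction i with
      | zero => rfl
      | succ i ih => exact ih (Nat.zero_le _)
    rw [this]
    rfl
  | cons a l ih =>
    intro i hi
    rcases l with _ | ⟨b, l⟩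
    · rw [advance_iterate_singleton]
      rfl
    · rcases i with _ | i
      · simp at hi
      · exact ih i (by simpa using hi)

theorem trunc_eq_of_dvd_sub {R : Type*} [CommRing R] {N : ℕ} {f g : R⟦X⟧} (h : X ^ N ∣ f - g) :
    trunc N f = trunc N g := by
  ext i
  rw [coeff_trunc, coeff_trunc]
  split_ifs with hi
  · have := X_pow_dvd_iff.1 h i hi
    rwa [map_sub, sub_eq_zero] at this
  · rfl

theorem partialSums_ne_nil (W M10 M5 : ℕ) (Gs ts : List ℕ) (acc : ℕ) :
    ∃ l, partialSums W M10 M5 Gs ts acc = acc :: l := by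
  cases Gs
  · exact ⟨_, rfl⟩
  · exact ⟨_, rfl⟩

/-- Once the list of letter values is exhausted, all further summands vanish modulo `X ^ N`. The
partial sums are constant from there on, as `advance` assumes. -/
theorem packsSeq_partialSums {N : ℕ} (hN : N ≤ 960) {a g T : ℕ → (ZMod 31)⟦X⟧}
    (hT : ∀ m, T (m + 1) = T m + a m * g m) (Gs : List ℕ) : ∀ ts acc u,
    PacksLetter N Gs a u → PacksSeq N ts g u → Packs N 2046 acc (trunc N (T u)) →
    PacksSeq N (partialSums (repdigit N 1048575) (repdigit N 1023) (repdigit N 31) Gs ts acc)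
      T u := by
  induction Gs with
  | nil =>
    intro ts acc u ha _ hacc i
    change Packs N 2046 (headOrZero (advance^[i] [acc])) _
    rw [advance_iterate_singleton]
    have h : trunc N (T (u + i)) = trunc N (T u) := by
      induction i with
      | zero => rfl
      | succ i ih =>
        rw [← ih]
        refine trunc_eq_of_dvd_sub ?_
        rw [← add_assoc, hT, add_sub_cancel_left]
        exact (ha _ (by omega)).mul_right _
    rw [h]
    exact hacc
  | cons x Gs ih =>
    intro ts acc u ha hts hacc i
    have e : partialSums (repdigit N 1048575) (repdigit N 1023) (repdigit N 31) (x :: Gs) ts acc =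
        acc :: partialSums (repdigit N 1048575) (repdigit N 1023) (repdigit N 31) Gs (advance ts)
          (mulAddTrunc (repdigit N 1048575) (repdigit N 1023) (repdigit N 31) acc x
            (headOrZero ts)) := by
      conv_rhs => rw [← force_eq (mulAddTrunc (repdigit N 1048575) (repdigit N 1023)
        (repdigit N 31) acc x (headOrZero ts)) (partialSums _ _ _ _ _ _)]
      rfl
    rw [e]
    rcases i with _ | i
    · exact hacc
    · obtain ⟨l, hl⟩ := partialSums_ne_nil (repdigit N 1048575) (repdigit N 1023) (repdigit N 31)
        Gs (advance ts) (mulAddTrunc (repdigit N 1048575) (repdigit N 1023) (repdigit N 31) acc x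
            (headOrZero ts))
      have h0 : Packs N 2046 (headOrZero ts) (trunc N (g u)) := hts 0
      have h1 := ih (advance ts) _ (u + 1) ha.2 hts.advance
        (hT u ▸ packs_mulAddTrunc hN hacc ha.1 h0) i
      rw [hl] at h1 ⊢
      rw [Function.iterate_succ_apply, ← add_assoc, add_right_comm]
      exact h1

/-- The truncation is `X^u + X^(2u) + ⋯ + X^(nu)` with `n = (N - 1) / u`, a finite geometric sum
that is evaluated by one division. -/
theorem packs_packedGeom (N : ℕ) {u : ℕ} (hu : 0 < u) :
    Packs N 33 (packedGeom N u) (trunc N (geomSeq (ZMod 31) u)) := by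
  set n := (N - 1) / u with hn
  have hcoeff : ∀ i, (∑ v ∈ range n, (Polynomial.X : Polynomial ℕ) ^ (u * (v + 1))).coeff i =
      if u ∣ i ∧ i ≠ 0 ∧ i / u ≤ n then 1 else 0 := by
    intro i
    simp only [Polynomial.finsetSum_coeff, Polynomial.coeff_X_pow]
    split_ifs with h
    · obtain ⟨⟨v, rfl⟩, h2, h3⟩ := h
      rw [Nat.mul_div_cancel_left _ hu] at h3
      have hv : v ≠ 0 := by rintro rfl; simp at h2
      rw [Finset.sum_eq_single (v - 1)]
      · rw [if_pos (by rw [Nat.sub_add_cancel (Nat.pos_of_ne_zero hv)])]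
      · intro w _ hw
        rw [if_neg]
        intro e
        have := Nat.eq_of_mul_eq_mul_left hu e
        omega
      · intro h
        simp only [Finset.mem_range] at h
        omega
    · refine Finset.sum_eq_zero fun v hv => ?_
      rw [if_neg]
      rintro rfl
      refine h ⟨dvd_mul_right _ _, by positivity, ?_⟩
      rw [Nat.mul_div_cancel_left _ hu]
      simpa using hv
  refine ⟨∑ v ∈ range n, Polynomial.X ^ (u * (v + 1)), ?_, fun i => ?_, fun i hi => ?_, ?_⟩
  · simp only [Polynomial.eval_finsetSum, Polynomial.eval_pow, Polynomial.eval_X]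
    change _ = 2 ^ (20 * u) * ((2 ^ (20 * u * n) - 1) / (2 ^ (20 * u) - 1))
    have h2 : 2 ≤ 2 ^ (20 * u) := by
      calc 2 = 2 ^ 1 := rfl
        _ ≤ 2 ^ (20 * u) := Nat.pow_le_pow_right (by norm_num) (by omega)
    rw [pow_mul 2 (20 * u) n, ← Nat.geomSum_eq h2, Finset.mul_sum]
    refine Finset.sum_congr rfl fun v _ => ?_
    rw [pow_mul 2 20 u, show (2 : ℕ) ^ 20 = 1048576 by norm_num, ← pow_mul, ← pow_add]
    ring
  · rw [hcoeff]
    split_ifs <;> norm_num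
  · rw [hcoeff, if_neg]
    rintro ⟨⟨v, rfl⟩, h2, h3⟩
    rw [Nat.mul_div_cancel_left _ hu, hn, Nat.le_div_iff_mul_le hu, mul_comm] at h3
    have : 0 < u * v := Nat.pos_of_ne_zero h2
    omega
  · ext i
    rw [Polynomial.coeff_map, hcoeff, coeff_trunc, geomSeq, coeff_dilate]
    by_cases h1 : u ∣ i ∧ i ≠ 0
    · have h2 : i / u ≤ n ↔ i < N := by
        obtain ⟨⟨v, rfl⟩, h2⟩ := h1
        have : 0 < u * v := Nat.pos_of_ne_zero h2
        rw [Nat.mul_div_cancel_left _ hu, hn, Nat.le_div_iff_mul_le hu, mul_comm]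
        omega
      rw [if_pos h1]
      simp only [h1.1, h1.2, h2, true_and, ne_eq, not_false_eq_true]
      split_ifs <;> simp
    · rw [if_neg h1, if_neg (fun h => h1 ⟨h.1, h.2.1⟩)]
      simp

theorem X_pow_dvd_geomSeq_pow_of_le {N s m : ℕ} (h : N ≤ s * m) :
    (X : (ZMod 31)⟦X⟧) ^ N ∣ (geomSeq (ZMod 31) ^ s) m := by
  refine (pow_dvd_pow X h).trans ?_
  rw [mul_comm, pow_mul, Pi.pow_apply]
  exact pow_dvd_pow_of_dvd (X_pow_dvd_dilate _ m) s

theorem packsLetter_packedGeoms (N q : ℕ) : ∀ u, 0 < u → N ≤ u + q →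
    PacksLetter N (packedGeoms N q u) (geomSeq (ZMod 31) ^ 1) u := by
  induction q with
  | zero =>
    intro u _ h m hm
    exact X_pow_dvd_geomSeq_pow_of_le (by omega)
  | succ q ih =>
    intro u hu h
    refine ⟨?_, ih (u + 1) (by omega) (by omega)⟩
    rw [pow_one]
    exact packs_packedGeom N hu

theorem packsLetter_pointwiseMul {N : ℕ} (hN : N ≤ 960) {a b : ℕ → (ZMod 31)⟦X⟧} (q : ℕ) :
    ∀ gs hs u, PacksLetter N gs a u → PacksLetter N hs b u →
      (∀ m, u + q ≤ m → X ^ N ∣ (a * b) m) →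
      PacksLetter N (pointwiseMul (repdigit N 1048575) (repdigit N 1023) (repdigit N 31) q gs hs)
        (a * b) u := by
  induction q with
  | zero => exact fun gs hs u _ _ h => h
  | succ q ih =>
    intro gs hs u ha hb h
    rcases gs with _ | ⟨x, gs⟩
    · exact fun m hm => (ha m hm).mul_right _
    rcases hs with _ | ⟨y, hs⟩
    · exact fun m hm => (hb m hm).mul_left _
    · exact ⟨packs_mulTrunc hN ha.1 hb.1, ih gs hs (u + 1) ha.2 hb.2 fun m hm => h m (by omega)⟩

end Generation

/-! ### Validity of the generated rows, and the rank criterion. -/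

noncomputable section Generation

open Finset PowerSeries

theorem nthD_induction {α : Type} {q : α → Prop} {d : α} (hd : q d) (l : List α)
    (hl : ∀ a ∈ l, q a) : ∀ n, q (nthD d l n) := by
  induction l with
  | nil => exact fun _ => hd
  | cons a l ih =>
    intro n
    rcases n with _ | n
    · exact hl a (by simp)
    · exact ih (fun b hb => hl b (by simp [hb])) n

/-- The letter packs the powers of the geometric sequence. -/
def Letter.Valid (N : ℕ) (a : Letter) : Prop :=
  0 < a.s ∧ PacksLetter N a.vals (geomSeq (ZMod 31) ^ a.s) 1

/-- The node packs the nested sums of a word of the given weight and length. -/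
def Node.Valid (N : ℕ) (n : Node) : Prop :=
  ∃ s : List ℕ, (∀ x ∈ s, 0 < x) ∧ s.sum = n.k ∧ s.length = n.l ∧
    PacksSeq N n.vals (nestedSum (s.map fun s => geomSeq (ZMod 31) ^ s)) 1

/-- The row packs the reduction of an integral series in the given step of the filtration. -/
def Row.Valid (N : ℕ) (r : Row) : Prop :=
  ∃ f : ℤ⟦X⟧, PowerSeries.map (Int.castRingHom ℚ) f ∈ filWL r.k r.l ∧
    Packs N 33 r.x (trunc N (PowerSeries.map (Int.castRingHom (ZMod 31)) f))

theorem valid_letters {N : ℕ} (hN : N ≤ 960) {g1 : List ℕ}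
    (h1 : PacksLetter N g1 (geomSeq (ZMod 31) ^ 1) 1) (S : ℕ) : ∀ g s, 0 < s →
    PacksLetter N g (geomSeq (ZMod 31) ^ s) 1 →
    ∀ a ∈ letters (repdigit N 1048575) (repdigit N 1023) (repdigit N 31) N g1 S g s,
      a.Valid N := by
  induction S with
  | zero => exact fun g s _ _ a ha => absurd ha List.not_mem_nil
  | succ S ih =>
    intro g s hs hg a ha
    rcases List.mem_cons.1 ha with rfl | ha
    · exact ⟨hs, hg⟩
    · refine ih _ (s + 1) (by omega) ?_ a ha
      rw [pow_succ, ← pow_one (geomSeq (ZMod 31)), ← pow_mul, one_mul]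
      refine packsLetter_pointwiseMul hN _ _ _ _ hg h1 fun m hm => ?_
      rw [pow_one, ← pow_succ]
      refine X_pow_dvd_geomSeq_pow_of_le ?_
      have h2 : N - 1 < (s + 1) * ((N - 1) / (s + 1) + 1) := Nat.lt_mul_div_succ _ (by omega)
      have h3 : (s + 1) * ((N - 1) / (s + 1) + 1) ≤ (s + 1) * m :=
        Nat.mul_le_mul_left _ (by rw [add_comm]; exact hm)
      omega

theorem valid_empty_node {N : ℕ} (hN : 0 < N) : (Node.mk 0 0 [1]).Valid N := by
  refine ⟨[], by simp, rfl, rfl, fun i => ?_⟩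
  rw [advance_iterate_singleton]
  exact (packs_one hN).mono (by norm_num)

theorem Node.Valid.cons {N : ℕ} (hN : N ≤ 960) {a : Letter} {n : Node} (ha : a.Valid N)
    (hn : n.Valid N) : (Node.mk (Nat.add a.s n.k) (Nat.succ n.l)
      (partialSums (repdigit N 1048575) (repdigit N 1023) (repdigit N 31) a.vals n.vals 0)).Valid
        N := by
  obtain ⟨s, h1, h2, h3, h4⟩ := hn
  refine ⟨a.s :: s, ?_, ?_, ?_, ?_⟩
  · simpa using ⟨ha.1, h1⟩
  · rw [List.sum_cons, h2]
    rfl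
  · rw [List.length_cons, h3]
  · refine packsSeq_partialSums hN (fun m => ?_) a.vals n.vals 0 1 ha.2 h4 ?_
    · exact Finset.sum_range_succ _ m
    · have h0 : nestedSum ((a.s :: s).map fun s => geomSeq (ZMod 31) ^ s) 1 = 0 := by
        simp [nestedSum, geomSeq, dilate_zero, ha.1.ne']
      rw [h0, map_zero]
      exact Packs.zero.mono (Nat.zero_le _)

theorem valid_runProgram {N : ℕ} (hN : 0 < N) (hN' : N ≤ 960) {d : Letter} (hd : d.Valid N)
    {tb : List Letter} (htb : ∀ a ∈ tb, a.Valid N) (pr : List (ℕ × ℕ)) :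
    ∀ ns : List Node, (∀ n ∈ ns, n.Valid N) →
      ∀ n ∈ runProgram (repdigit N 1048575) (repdigit N 1023) (repdigit N 31) d tb pr ns,
        n.Valid N := by
  induction pr with
  | nil => exact fun ns h => h
  | cons c pr ih =>
    intro ns h
    refine ih _ fun n hn => ?_
    rcases List.mem_append.1 hn with hn | hn
    · exact h n hn
    · rw [List.mem_singleton.1 hn]
      exact Node.Valid.cons hN' (nthD_induction hd tb htb _)
        (nthD_induction (valid_empty_node hN) ns h _)

theorem Node.Valid.row {N : ℕ} {n : Node} (hn : n.Valid N) :
    (Row.mk n.k n.l (foldDigits (repdigit N 1023) (repdigit N 31) (lastOrZero n.vals))).Valid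
      N := by
  obtain ⟨s, h1, h2, h3, h4⟩ := hn
  refine ⟨geomBracket ℤ s, ?_, ?_⟩
  · rw [map_geomBracket]
    simpa only [h2, h3] using geomBracket_mem h1
  · have h5 := h4 (n.vals.length + N)
    rw [headOrZero_advance_iterate _ _ (by omega)] at h5
    rw [map_geomBracket]
    convert h5.foldDigits (by norm_num) using 1
    ext i
    rw [coeff_trunc, coeff_trunc]
    split_ifs with hi
    · rw [geomBracket, coeff_diagLimit]
      refine (isStable_nestedSum (fun a ha m => ?_) i _ (by omega)).symm
      obtain ⟨x, hx, rfl⟩ := List.mem_map.1 ha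
      exact X_pow_dvd_geomSeq_pow (h1 x hx) m
    · rfl

theorem valid_one_row {N : ℕ} (hN : 0 < N) : (Row.mk 0 0 1).Valid N :=
  ⟨1, by rw [map_one]; exact one_mem_filWL 0 0, by rw [map_one]; exact packs_one hN⟩

theorem Row.Valid.mul {N : ℕ} (hN : N ≤ 960) {r g : Row} (hr : r.Valid N) (hg : g.Valid N) :
    (mulRow (repdigit N 1048575) (repdigit N 1023) (repdigit N 31) r g).Valid N := by
  obtain ⟨f, h1, h2⟩ := hr
  obtain ⟨e, h3, h4⟩ := hg
  refine ⟨f * e, ?_, ?_⟩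
  · rw [map_mul]
    exact mul_mem_filWL h1 h3
  · rw [map_mul]
    exact packs_mulTrunc hN h2 h4

theorem valid_monomialRows {N : ℕ} (hN : N ≤ 960) (K L fuel : ℕ) : ∀ gs r acc,
    (∀ g ∈ gs, g.Valid N) → r.Valid N → (∀ a ∈ acc, a.Valid N) →
    ∀ a ∈ monomialRows (repdigit N 1048575) (repdigit N 1023) (repdigit N 31) K L fuel gs r acc,
      a.Valid N := by
  induction fuel with
  | zero =>
    intro gs r acc _ hr hacc a ha
    rcases List.mem_cons.1 ha with rfl | ha
    exacts [hr, hacc a ha]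
  | succ fuel ih =>
    intro gs r acc hgs hr hacc a ha
    refine (List.mem_cons.1 ha).elim (fun e => e ▸ hr) ?_
    clear ha
    revert a
    induction gs with
    | nil => exact hacc
    | cons g gs ih2 =>
      have h2 := ih2 fun b hb => hgs b (by simp [hb])
      simp only
      cases Nat.ble (Nat.add r.k g.k) K with
      | false => exact hacc
      | true =>
        cases Nat.ble (Nat.add r.l g.l) L with
        | false => exact h2
        | true => exact ih _ _ _ hgs (hr.mul hN (hgs g (by simp))) h2

theorem valid_productRow {N : ℕ} (hN : 0 < N) (hN' : N ≤ 960) {gs : List Row}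
    (hgs : ∀ g ∈ gs, g.Valid N) (is : List ℕ) :
    (productRow (repdigit N 1048575) (repdigit N 1023) (repdigit N 31) gs is).Valid N := by
  induction is with
  | nil => exact valid_one_row hN
  | cons i is ih => exact ih.mul hN' (nthD_induction (valid_one_row hN) gs hgs i)

theorem valid_generators {N : ℕ} (hN : 0 < N) (hN' : N ≤ 960) (S : ℕ) (pr : List (ℕ × ℕ)) :
    ∀ g ∈ generators N S pr, g.Valid N := by
  intro g hg
  obtain ⟨n, hn, rfl⟩ := List.mem_map.1 hg
  have h1 := packsLetter_packedGeoms N (N - 1) 1 one_pos (by omega)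
  refine (valid_runProgram hN hN' ⟨one_pos, h1⟩ (valid_letters hN' h1 S _ 1 one_pos h1) pr _ ?_ n
    (List.mem_of_mem_tail hn)).row
  intro n hn
  rw [List.mem_singleton.1 hn]
  exact valid_empty_node hN

theorem valid_productRows {N : ℕ} (hN : 0 < N) (hN' : N ≤ 960) (K L S : ℕ) (pr : List (ℕ × ℕ))
    (st : List (List ℕ)) : ∀ r ∈ productRows N K L S pr st, r.Valid N := by
  have hgs := valid_generators hN hN' S pr
  unfold productRows
  simp only
  induction st with
  | nil => simp
  | cons is st ih =>
    exact valid_monomialRows hN' K L K _ _ _ (fun g hg => hgs g (List.mem_of_mem_filter hg))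
      (valid_productRow hN hN' hgs is) ih

/-- If the packed rows are linearly independent, they give lower bounds for the dimensions. -/
theorem length_filter_le_finrank {N : ℕ} (hN : N ≤ 960) {rows : List Row}
    (hrows : ∀ r ∈ rows, r.Valid N) (hlen : rows.length = N) (hrank : rowRank N rows = N)
    (k l : ℕ) : (rows.filter fun r => and (Nat.ble r.k k) (Nat.ble r.l l)).length ≤
      Module.finrank ℚ (filWL k l) := by
  choose! F hF hP using hrows
  let p : Fin rows.length → Polynomial (ZMod 31) := fun i =>
    trunc N (PowerSeries.map (Int.castRingHom (ZMod 31)) (F (rows.get i)))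
  have hind : LinearIndependent (ZMod 31) p := by
    have := FiniteDimensional.span_of_finite (ZMod 31) (Set.finite_range p)
    rw [linearIndependent_iff_card_le_finrank_span, Fintype.card_fin, Set.finrank]
    -- The span of the truncations has dimension at least the number of pivots, which is the number
    -- of rows.
    have := eliminate_le (N := N) (Submodule.span (ZMod 31) (Set.range p)) (rows.map Row.x)
      (by rw [List.length_map]; omega) fun x hx => by
        obtain ⟨r, hr, rfl⟩ := List.mem_map.1 hx
        obtain ⟨i, rfl⟩ := List.get_of_mem hr
        exact ⟨p i, Submodule.subset_span ⟨i, rfl⟩, hP _ hr⟩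
    rw [rowRank] at hrank
    omega
  have hind' := linearIndependent_of_zmod _ hind
  obtain ⟨e, he⟩ := List.sublist_iff_exists_fin_orderEmbedding_get_eq.1
    (List.filter_sublist (l := rows) (p := fun r => and (Nat.ble r.k k) (Nat.ble r.l l)))
  have hind'' := hind'.comp e e.injective
  have hmem : ∀ i, PowerSeries.map (Int.castRingHom ℚ) (F (rows.get (e i))) ∈ filWL k l := by
    intro i
    rw [← he]
    have hi := List.get_mem (rows.filter fun r => and (Nat.ble r.k k) (Nat.ble r.l l)) i
    obtain ⟨h1, h2⟩ := List.mem_filter.1 hi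
    rw [Bool.and_eq_true, Nat.ble_eq, Nat.ble_eq] at h2
    exact filWL_mono h2.1 h2.2 (hF _ h1)
  have hind3 : LinearIndependent ℚ fun i => (⟨_, hmem i⟩ : filWL k l) :=
    LinearIndependent.of_comp (filWL k l).subtype hind''
  simpa using hind3.fintype_card_le_finrank

/-- The kernel computation gives lower bounds for the dimensions. -/
theorem le_finrank_of_check {N K L S : ℕ} {pr : List (ℕ × ℕ)} {st : List (List ℕ)}
    {t : List (ℕ × ℕ × ℕ)} (hN : 0 < N) (hN' : N ≤ 960)
    (h1 : checkCounts N (productRows N K L S pr st) t = true)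
    (h2 : hasFullRank N (productRows N K L S pr st) = true) :
    ∀ c ∈ t, c.2.2 ≤ Module.finrank ℚ (filWL c.1 c.2.1) := by
  intro c hc
  rw [checkCounts, Bool.and_eq_true, Nat.beq_eq, List.all_eq_true] at h1
  have h3 := h1.2 c hc
  rw [Nat.ble_eq] at h3
  exact h3.trans (length_filter_le_finrank hN' (valid_productRows hN hN' K L S pr st) h1.1
    (Nat.eq_of_beq_eq_true h2) c.1 c.2.1)

end Generation

/-! ### The four certificates for the lower bounds. -/

section LowerBounds

/-- A program for generators up to weight 11 and length 11. -/
def programEleven : List (ℕ × ℕ) :=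
  [(1, 0), (2, 0), (3, 0), (2, 1), (4, 0), (1, 4), (5, 0), (4, 1), (2, 4), (1, 6), (6, 0), (3,
   4), (2, 6), (1, 10), (7, 0), (6, 1), (4, 4), (3, 6), (1, 12), (2, 10), (1, 13), (1, 14), (8,
   0), (6, 2), (5, 4), (3, 8), (4, 6), (3, 9), (3, 10), (1, 19), (1, 18), (2, 14), (1, 21), (1,
   22), (9, 0), (8, 1), (6, 4), (5, 6), (4, 9), (1, 26), (4, 10), (3, 13), (2, 19), (1, 27), (3,
   14), (2, 21), (1, 30), (1, 31), (2, 22), (1, 33), (1, 32), (1, 34), (10, 0), (8, 2), (7, 4),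
   (5, 8), (3, 16), (6, 6), (5, 9), (4, 12), (5, 10), (4, 13), (3, 19), (1, 40), (1, 39), (4,
   14), (3, 21), (2, 30), (2, 31), (1, 44), (1, 43), (3, 22), (2, 33), (1, 47), (1, 48), (1,
   46), (1, 45), (2, 34), (1, 50), (1, 51), (1, 52), (11, 0), (10, 1), (8, 4), (6, 8), (7, 6),
   (6, 9), (5, 12), (4, 17), (1, 57), (6, 10), (5, 13), (4, 19), (4, 18), (3, 28), (2, 40), (1,
   58), (5, 14), (4, 21), (4, 20), (3, 30), (2, 44), (1, 64), (1, 65), (1, 63), (1, 62), (4,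
   22), (3, 33), (3, 32), (2, 47), (2, 48), (1, 70), (1, 71), (1, 68), (1, 69), (1, 67), (3,
   34), (2, 50), (2, 51), (1, 74), (1, 75), (1, 76), (1, 77), (1, 73), (2, 52), (1, 79), (1,
   80), (1, 78), (1, 81)]

/-- Monomials in the generators that are even rows. -/
def startsEleven : List (List ℕ) :=
  [[], [4], [10], [22], [52]]

/-- Lower bounds `(k, l, d)` in weight at most eleven. -/
def boundsEleven : List (ℕ × ℕ × ℕ) :=
  [(0, 0, 1), (1, 0, 1), (1, 1, 2), (2, 0, 1), (2, 1, 3), (2, 2, 4), (3, 0, 1), (3, 1, 4), (3,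
   2, 7), (3, 3, 8), (4, 0, 1), (4, 1, 5), (4, 2, 10), (4, 3, 14), (4, 4, 15), (5, 0, 1), (5, 1,
   6), (5, 2, 14), (5, 3, 22), (5, 4, 27), (5, 5, 28), (6, 0, 1), (6, 1, 7), (6, 2, 18), (6, 3,
   32), (6, 4, 44), (6, 5, 50), (6, 6, 51), (7, 0, 1), (7, 1, 8), (7, 2, 23), (7, 3, 44), (7, 4,
   67), (7, 5, 84), (7, 6, 91), (7, 7, 92), (8, 0, 1), (8, 1, 9), (8, 2, 28), (8, 3, 59), (8, 4,
   97), (8, 5, 133), (8, 6, 156), (8, 7, 164), (8, 8, 165), (9, 0, 1), (9, 1, 10), (9, 2, 34),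
   (9, 3, 76), (9, 4, 135), (9, 5, 200), (9, 6, 254), (9, 7, 284), (9, 8, 293), (9, 9, 294),
   (10, 0, 1), (10, 1, 11), (10, 2, 40), (10, 3, 97), (10, 4, 183), (10, 5, 290), (10, 6, 396),
   (10, 7, 474), (10, 8, 512), (10, 9, 522), (10, 10, 523), (11, 0, 1), (11, 1, 12), (11, 2,
   47), (11, 3, 120), (11, 4, 242), (11, 5, 408), (11, 6, 594), (11, 7, 760), (11, 8, 869), (11,
   9, 916), (11, 10, 927), (11, 11, 928)]

/-- In a program, place 0 is the empty word, so place `i + 1` is the generator that a start calls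
`i`. The nonempty starts here are the one-letter words of weight 4, 6, 8 and 10. Further monomials
in even rows are left out because identities of modular forms such as `E₄² = E₈` suggest that they
are redundant; the proof uses only the check. -/
theorem checkCounts_eleven : checkCounts 928
    (productRows 928 11 11 11 programEleven startsEleven) boundsEleven = true := by
  decide +kernel

/-- There are as many rows as coefficients kept, so this says that a square matrix is invertible
modulo 31. -/
theorem hasFullRank_eleven : hasFullRank 928
    (productRows 928 11 11 11 programEleven startsEleven) = true := by
  decide +kernel

/-- A program for generators up to weight 12 and length 5. -/
def programTwelve : List (ℕ × ℕ) :=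
  [(1, 0), (2, 0), (3, 0), (2, 1), (4, 0), (1, 4), (5, 0), (4, 1), (2, 4), (1, 6), (6, 0), (3,
   4), (2, 6), (1, 10), (7, 0), (6, 1), (4, 4), (3, 6), (1, 12), (2, 10), (1, 13), (8, 0), (6,
   2), (5, 4), (3, 8), (4, 6), (3, 9), (3, 10), (1, 19), (1, 18), (9, 0), (8, 1), (6, 4), (5,
   6), (4, 9), (1, 25), (4, 10), (3, 13), (2, 19), (1, 26), (10, 0), (8, 2), (7, 4), (5, 8), (3,
   16), (6, 6), (5, 9), (4, 12), (5, 10), (4, 13), (3, 19), (1, 36), (1, 35), (11, 0), (10, 1),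
   (8, 4), (6, 8), (7, 6), (6, 9), (5, 12), (4, 17), (1, 45), (6, 10), (5, 13), (4, 19), (4,
   18), (3, 27), (2, 36), (1, 46), (12, 0), (10, 2), (9, 4), (7, 8), (5, 16), (8, 6), (7, 9),
   (6, 12), (5, 17), (4, 24), (7, 10), (6, 13), (5, 19), (5, 18), (4, 27), (4, 26), (1, 62), (1,
   61), (1, 60)]

/-- Monomials in the generators that are even rows. -/
def startsTwelve : List (List ℕ) :=
  [[], [4], [10], [10, 10], [21], [40], [69]]

/-- Lower bounds `(k, l, d)` in weight twelve. -/
def boundsTwelve : List (ℕ × ℕ × ℕ) :=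
  [(12, 0, 1), (12, 1, 13), (12, 2, 54), (12, 3, 147), (12, 4, 313), (12, 5, 559)]

/-- From weight twelve on, the starts include the square of the even row of weight six, matching the
second dimension of modular forms of weight twelve. -/
theorem checkCounts_twelve : checkCounts 559
    (productRows 559 12 5 12 programTwelve startsTwelve) boundsTwelve = true := by
  decide +kernel

theorem hasFullRank_twelve : hasFullRank 559
    (productRows 559 12 5 12 programTwelve startsTwelve) = true := by
  decide +kernel

/-- A program for generators up to weight 14 and length 4. -/
def programFourteen : List (ℕ × ℕ) :=
  [(1, 0), (2, 0), (3, 0), (2, 1), (4, 0), (1, 4), (5, 0), (4, 1), (2, 4), (1, 6), (6, 0), (3,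
   4), (2, 6), (7, 0), (6, 1), (4, 4), (3, 6), (1, 12), (8, 0), (6, 2), (5, 4), (3, 8), (4, 6),
   (3, 9), (9, 0), (8, 1), (6, 4), (5, 6), (4, 9), (1, 22), (10, 0), (8, 2), (7, 4), (5, 8), (3,
   15), (6, 6), (5, 9), (4, 12), (11, 0), (10, 1), (8, 4), (6, 8), (7, 6), (6, 9), (5, 12), (4,
   16), (1, 35), (12, 0), (10, 2), (9, 4), (7, 8), (5, 15), (8, 6), (7, 9), (6, 12), (5, 16),
   (4, 21), (13, 0), (12, 1), (10, 4), (8, 8), (6, 15), (9, 6), (8, 9), (7, 12), (6, 16), (5,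
   22), (5, 21), (1, 52), (14, 0), (12, 2), (10, 5), (11, 4), (9, 8), (7, 15), (6, 20), (10, 6),
   (9, 9), (8, 12), (7, 16), (6, 22), (6, 21)]

/-- Monomials in the generators that are even rows. -/
def startsFourteen : List (List ℕ) :=
  [[], [4], [10], [10, 10], [18], [30], [47], [69]]

/-- Lower bounds `(k, l, d)` in weight thirteen and fourteen. -/
def boundsFourteen : List (ℕ × ℕ × ℕ) :=
  [(13, 0, 1), (13, 1, 14), (13, 2, 62), (13, 3, 177), (13, 4, 398), (14, 0, 1), (14, 1, 15),
   (14, 2, 70), (14, 3, 212), (14, 4, 498)]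

theorem checkCounts_fourteen : checkCounts 498
    (productRows 498 14 4 14 programFourteen startsFourteen) boundsFourteen = true := by
  decide +kernel

theorem hasFullRank_fourteen : hasFullRank 498
    (productRows 498 14 4 14 programFourteen startsFourteen) = true := by
  decide +kernel

/-- A program for generators up to weight 15 and length 3. -/
def programFifteen : List (ℕ × ℕ) :=
  [(1, 0), (2, 0), (3, 0), (2, 1), (4, 0), (1, 4), (5, 0), (4, 1), (2, 4), (6, 0), (3, 4), (7,
   0), (6, 1), (4, 4), (8, 0), (6, 2), (5, 4), (3, 8), (9, 0), (8, 1), (6, 4), (10, 0), (8, 2),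
   (7, 4), (5, 8), (3, 13), (11, 0), (10, 1), (8, 4), (6, 8), (12, 0), (10, 2), (9, 4), (7, 8),
   (5, 13), (13, 0), (12, 1), (10, 4), (8, 8), (6, 13), (14, 0), (12, 2), (10, 5), (11, 4), (9,
   8), (7, 13), (6, 16), (15, 0), (14, 1), (12, 4), (10, 8), (8, 13)]

/-- Monomials in the generators that are even rows. -/
def startsFifteen : List (List ℕ) :=
  [[], [4], [9], [9, 9], [14], [21], [30], [40]]

/-- Lower bounds `(k, l, d)` in weight fifteen. -/
def boundsFifteen : List (ℕ × ℕ × ℕ) :=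
  [(15, 0, 1), (15, 1, 16), (15, 2, 79), (15, 3, 249)]

theorem checkCounts_fifteen : checkCounts 249
    (productRows 249 15 3 15 programFifteen startsFifteen) boundsFifteen = true := by
  decide +kernel

theorem hasFullRank_fifteen : hasFullRank 249
    (productRows 249 15 3 15 programFifteen startsFifteen) = true := by
  decide +kernel

theorem le_finrank_filWL : ∀ c ∈ boundsEleven ++ boundsTwelve ++ boundsFourteen ++ boundsFifteen,
    c.2.2 ≤ Module.finrank ℚ (filWL c.1 c.2.1) := by
  intro c hc
  simp only [List.mem_append] at hc
  rcases hc with ((hc | hc) | hc) | hc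
  · exact le_finrank_of_check (N := 928) (by norm_num) (by norm_num) checkCounts_eleven
      hasFullRank_eleven c hc
  · exact le_finrank_of_check (N := 559) (by norm_num) (by norm_num) checkCounts_twelve
      hasFullRank_twelve c hc
  · exact le_finrank_of_check (N := 498) (by norm_num) (by norm_num) checkCounts_fourteen
      hasFullRank_fourteen c hc
  · exact le_finrank_of_check (N := 249) (by norm_num) (by norm_num) checkCounts_fifteen
      hasFullRank_fifteen c hc

end LowerBounds

theorem theorem1p3 :
    (∀ t ∈ ([
      (0, [1]),
      (1, [1, 2]),
      (2, [1, 3, 4]),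
      (3, [1, 4, 7, 8]),
      (4, [1, 5, 10, 14, 15]),
      (5, [1, 6, 14, 22, 27, 28]),
      (6, [1, 7, 18, 32]),
      (7, [1, 8, 23]),
      (8, [1, 9, 28]),
      (9, [1, 10, 34]),
      (10, [1, 11, 40]),
      (11, [1, 12, 47]),
      (12, [1, 13, 54]),
      (13, [1, 14, 62]),
      (14, [1, 15, 70]),
      (15, [1, 16, 79])] : List (ℕ × List ℕ)),
      ∀ (l : ℕ) (hl : l < t.2.length), Module.finrank ℚ (filWL t.1 l) = t.2[l]) ∧
    (∀ t ∈ ([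
      (6, 4, [44, 50, 51]),
      (7, 3, [44, 67, 84, 91, 92]),
      (8, 3, [59, 97, 133, 156, 164, 165]),
      (9, 3, [76, 135, 200, 254, 284, 293, 294]),
      (10, 3, [97, 183, 290, 396, 474, 512, 522, 523]),
      (11, 3, [120, 242, 408, 594, 760, 869, 916, 927, 928]),
      (12, 3, [147, 313, 559]),
      (13, 3, [177, 398]),
      (14, 3, [212, 498]),
      (15, 3, [249])] : List (ℕ × ℕ × List ℕ)),
      ∀ (i : ℕ) (hi : i < t.2.2.length),
        t.2.2[i] ≤ Module.finrank ℚ (filWL t.1 (t.2.1 + i))) := by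
  refine ⟨fun t ht l hl => le_antisymm (finrank_filWL_le_of_mem_table t ht l hl) ?_,
    fun t ht i hi => ?_⟩
  · refine le_finrank_filWL (t.1, l, t.2[l]) ?_
    revert t l
    decide +kernel
  · refine le_finrank_filWL (t.1, t.2.1 + i, t.2.2[i]) ?_
    revert t i
    decide +kernel
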